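/- Let $n_\bullet=(1\le n_1<\dots<n_r<n)$ with $r\ge 1$, let $P\subset SL(n,\mathbb C)$ be the parabolic subgroup with $\Delta_P=\{\alpha_i : i\notin n_\bullet\}$, and let $Fl(n_\bullet)=SL(n,\mathbb C)/P$ be the variety of flags $F_{n_1}\subset\dots\subset F_{n_r}\subset\mathbb C^n$, $\dim F_{n_j}=n_j$. A flag is represented by $n_r\times n$ matrices of rank $n_r$ whose first $n_j$ rows span $F_{n_j}$ for all $j$; for $J\subset[n]=\{1,\dots,n\}$ with $|J|=n_j$, the Plücker coordinate $x_J$ is the minor on the first $n_j$ rows and the columns in $J$. Write $(a,b]=\{a+1,\dots,b\}$ and $[i]=(0,i]$, and write $J,J'$ for $J\cup J'$. Let $B$, $B^-$ be the upper and lower triangular subgroups of $SL(n,\mathbb C)$. For $u\in S_n$ let $X^u$ and $X_u$ be the closures of $BuB/B$ and $B^-uB/B$ in $SL(n,\mathbb C)/B$, let $X_v^u=X_v\cap X^u$, and let $\pi_P: SL(n,\mathbb C)/B\to Fl(n_\bullet)$ be the projection. Let $s_i=(i\;\,i+1)$, let $w_0$ be the longest element of $S_n$ and $w_P$ the longest element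 of $W_P=\langle s_i : i\notin n_\bullet\rangle$. Let $i\in[n-1]$. Then the following hold. Here "$Z$ is defined by $f=0$" means that $Z$ is the hypersurface $f=0$ in $Fl(n_\bullet)$, both as a set and as a reduced subscheme (divisor with multiplicity one). Equivalently, a flag lies in $Z$ if and only if $f$ vanishes on the matrices representing it, and the ideal of all polynomials in the entries of an $n_r\times n$ matrix that vanish on all matrices representing points of $Z$ is generated by $f$. 1. If $i\in n_\bullet$, then $\pi_P(X_{\mathrm{id}}^{w_0s_iw_P})$ is the Schubert divisor $\overline{Bw_0s_iw_PP/P}$, and it is defined by $x_{(n-i,n]}=0$. 2. If $i\in n_\bullet$, then $\pi_P(X_{s_i}^{w_0w_P})$ is the (opposite) Schubert divisor $\overline{B^-s_iP/P}$, and it is defined by $x_{[i]}=0$. 3. If $i<n_1$, then $\pi_P(X_{s_i}^{w_0w_P})$ is defined by $x_{[i],(n-n_1+i,n]}=0$. 4. If $i>n_r$, then $\pi_P(X_{s_i}^{w_0w_P})$ is defined by $x_{(i-n_r,i]}=0$. 5. If $n_j<i<n_{j+1}$ for some $1\le j\le r-1$, put $k=i-n_j$ and $l=\min\{i,\,n-n_{j+1}+k\}$.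 Then $\pi_P(X_{s_i}^{w_0w_P})$ is defined by $$\sum_{J\subset[l],\ \#J=k}(-1)^{|J|}\,x_{[i]\smallsetminus J}\cdot x_{J,(n-n_{j+1}+k,n]}=0,$$ where $|J|$ denotes the sum of the elements of $J$. -/

import Mathlib

open MvPolynomial

namespace FlagVariety

/-- A partial flag in `ℂⁿ` of type `D = {n₁ < ⋯ < n_r}`: a chain of subspaces `F_j`, `j ∈ D`,
with `dim F_j = j`. -/
@[ext]
structure PartialFlag (n : ℕ) (D : Finset ℕ) where
  space : D → Submodule ℂ (Fin n → ℂ)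
  finrank_space : ∀ j : D, Module.finrank ℂ (space j) = (j : ℕ)
  mono : ∀ i j : D, (i : ℕ) ≤ (j : ℕ) → space i ≤ space j

/-- The complete flag variety `SL(n, ℂ)/B`. -/
abbrev FullFlag (n : ℕ) : Type := PartialFlag n (Finset.Ioo 0 n)

/-- The projection between flag varieties that forgets subspaces. -/
def proj {n : ℕ} {D E : Finset ℕ} (h : D ⊆ E) (F : PartialFlag n E) : PartialFlag n D where
  space j := F.space ⟨j, h j.2⟩
  finrank_space j := F.finrank_space ⟨j, h j.2⟩
  mono i j hij := F.mono ⟨i, h i.2⟩ ⟨j, h j.2⟩ hij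

/-- The action of `SL(n, ℂ)` on flags. -/
noncomputable def act {n : ℕ} {D : Finset ℕ} (g : Matrix.SpecialLinearGroup (Fin n) ℂ)
    (F : PartialFlag n D) : PartialFlag n D where
  space j := (F.space j).map (Matrix.SpecialLinearGroup.toLin' g).toLinearMap
  finrank_space j := by
    rw [LinearEquiv.finrank_map_eq]
    exact F.finrank_space j
  mono i j hij := Submodule.map_mono (F.mono i j hij)

theorem finrank_coord {n : ℕ} (w : Equiv.Perm (Fin n)) {j : ℕ} (hj : j ≤ n) :
    Module.finrank ℂ (Submodule.span ℂ
      ((fun a : Fin n => (Pi.single (w a) 1 : Fin n → ℂ)) '' {a | (a : ℕ) < j})) = j := by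
  have hli : LinearIndependent ℂ (fun a : Fin n => (Pi.single (w a) 1 : Fin n → ℂ)) := by
    have h := (Pi.basisFun ℂ (Fin n)).linearIndependent.comp w w.injective
    convert h using 1
    funext a
    simp
  have h2 := hli.comp (Fin.castLE hj) (Fin.castLE_injective hj)
  have h3 := finrank_span_eq_card h2
  rw [Fintype.card_fin] at h3
  have hs : ((fun a : Fin n => (Pi.single (w a) 1 : Fin n → ℂ)) '' {a | (a : ℕ) < j}) =
      Set.range ((fun a : Fin n => (Pi.single (w a) 1 : Fin n → ℂ)) ∘ Fin.castLE hj) := by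
    ext v
    constructor
    · rintro ⟨a, ha, rfl⟩
      exact ⟨⟨a, ha⟩, rfl⟩
    · rintro ⟨a, rfl⟩
      exact ⟨Fin.castLE hj a, a.2, rfl⟩
  rw [hs]
  exact h3

/-- The torus-fixed point `wP/P` : the flag with `F_j = ⟨e_{w(1)}, …, e_{w(j)}⟩`. -/
noncomputable def coordFlag {n : ℕ} {D : Finset ℕ} (hD : D ⊆ Finset.Ioo 0 n)
    (w : Equiv.Perm (Fin n)) : PartialFlag n D where
  space j := Submodule.span ℂ
    ((fun a : Fin n => (Pi.single (w a) 1 : Fin n → ℂ)) '' {a | (a : ℕ) < (j : ℕ)})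
  finrank_space j := finrank_coord w (Finset.mem_Ioo.mp (hD j.2)).2.le
  mono _ _ hij := Submodule.span_mono (Set.image_mono fun _ ha => lt_of_lt_of_le ha hij)

/-- The Schubert cell `BwP/P`, with `B ⊂ SL(n, ℂ)` the upper triangular matrices. -/
def schubertCell {n : ℕ} {D : Finset ℕ} (hD : D ⊆ Finset.Ioo 0 n) (w : Equiv.Perm (Fin n)) :
    Set (PartialFlag n D) :=
  {F | ∃ b : Matrix.SpecialLinearGroup (Fin n) ℂ,
    (∀ p q : Fin n, q < p → b.1 p q = 0) ∧ F = act b (coordFlag hD w)}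

/-- The opposite Schubert cell `B⁻wP/P`, with `B⁻` the lower triangular matrices. -/
def oppositeSchubertCell {n : ℕ} {D : Finset ℕ} (hD : D ⊆ Finset.Ioo 0 n)
    (w : Equiv.Perm (Fin n)) : Set (PartialFlag n D) :=
  {F | ∃ b : Matrix.SpecialLinearGroup (Fin n) ℂ,
    (∀ p q : Fin n, p < q → b.1 p q = 0) ∧ F = act b (coordFlag hD w)}

/-- `A` is an `n_r × n` matrix of full rank `n_r = max D` representing the flag `F`: for each
`j ∈ D` the span of the first `j` rows of `A` is `F_j`. -/
def Represents {n : ℕ} {D : Finset ℕ} (A : Matrix (Fin (D.sup id)) (Fin n) ℂ)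
    (F : PartialFlag n D) : Prop :=
  LinearIndependent ℂ A.row ∧
    ∀ j : D, F.space j = Submodule.span ℂ (A.row '' {a | (a : ℕ) < (j : ℕ)})

/-- The matrices (as points of affine space) that represent the flags in `Z`. -/
def reps {n : ℕ} {D : Finset ℕ} (Z : Set (PartialFlag n D)) :
    Set (Fin (D.sup id) × Fin n → ℂ) :=
  {x | ∃ F ∈ Z, Represents (Matrix.of fun a c => x (a, c)) F}

/-- The ideal of all polynomials in the matrix entries which vanish at every matrix that
represents a point of `Z`. -/
noncomputable def matrixIdeal {n : ℕ} {D : Finset ℕ} (Z : Set (PartialFlag n D)) :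
    Ideal (MvPolynomial (Fin (D.sup id) × Fin n) ℂ) :=
  vanishingIdeal ℂ (reps Z)

/-- Zariski closure in the flag variety. The flag variety is the quotient of the variety of
full rank `n_r × n` matrices by the block-triangular group acting on rows, so `Z` is closed if
and only if the set `reps Z` is closed in the set of full rank matrices. -/
def zariskiClosure {n : ℕ} {D : Finset ℕ} (Z : Set (PartialFlag n D)) :
    Set (PartialFlag n D) :=
  {F | reps {F} ⊆ zeroLocus ℂ (matrixIdeal Z)}

/-- The Schubert variety `X^w`, the closure of `BwP/P`. -/
def schubertVariety {n : ℕ} {D : Finset ℕ} (hD : D ⊆ Finset.Ioo 0 n)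
    (w : Equiv.Perm (Fin n)) : Set (PartialFlag n D) :=
  zariskiClosure (schubertCell hD w)

/-- The opposite Schubert variety `X_w`, the closure of `B⁻wP/P`. -/
def oppositeSchubertVariety {n : ℕ} {D : Finset ℕ} (hD : D ⊆ Finset.Ioo 0 n)
    (w : Equiv.Perm (Fin n)) : Set (PartialFlag n D) :=
  zariskiClosure (oppositeSchubertCell hD w)

/-- The closed Richardson variety `X_v^w = X_v ∩ X^w` in the complete flag variety. -/
def richardson {n : ℕ} (v w : Equiv.Perm (Fin n)) : Set (FullFlag n) :=
  oppositeSchubertVariety (Finset.Subset.refl _) v ∩ schubertVariety (Finset.Subset.refl _) w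

/-- The projected Richardson variety, the image of `X_v^w` in the partial flag variety. -/
def projRichardson {n : ℕ} {D : Finset ℕ} (hD : D ⊆ Finset.Ioo 0 n)
    (v w : Equiv.Perm (Fin n)) : Set (PartialFlag n D) :=
  proj hD '' richardson v w

/-- The simple transposition `s_i` exchanging `i` and `i + 1` in `{1, …, n}` (whose elements are
`0, …, n - 1` in `Fin n`), for `0 < i < n`. -/
def simpleTransposition (n i : ℕ) : Equiv.Perm (Fin n) :=
  if h : 0 < i ∧ i < n then Equiv.swap ⟨i - 1, by omega⟩ ⟨i, h.2⟩ else 1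

/-- The Coxeter length of a permutation, its number of inversions. -/
def length {n : ℕ} (w : Equiv.Perm (Fin n)) : ℕ :=
  (Finset.univ.filter fun p : Fin n × Fin n => p.1 < p.2 ∧ w p.2 < w p.1).card

/-- The longest element of a subgroup of the symmetric group (an element of maximal length;
there is only one in a subgroup generated by simple transpositions). -/
noncomputable def longestElement {n : ℕ} (H : Subgroup (Equiv.Perm (Fin n))) :
    Equiv.Perm (Fin n) :=
  ((Finite.exists_max fun u : H => length (u : Equiv.Perm (Fin n))).choose : H)

/-- The longest element `w₀` of `S_n`. -/
noncomputable def longestW (n : ℕ) : Equiv.Perm (Fin n) := longestElement ⊤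

/-- The parabolic subgroup `W_P` generated by the `s_i` with `i ∈ {1, …, n - 1} ∖ D`. -/
def parabolicSubgroup (n : ℕ) (D : Finset ℕ) : Subgroup (Equiv.Perm (Fin n)) :=
  Subgroup.closure (simpleTransposition n '' {i | 0 < i ∧ i < n ∧ i ∉ D})

/-- The longest element `w_P` of `W_P`. -/
noncomputable def longestWP (n : ℕ) (D : Finset ℕ) : Equiv.Perm (Fin n) :=
  longestElement (parabolicSubgroup n D)

/-- The Plücker coordinate `x_J` of a matrix: the minor on the first `|J|` rows and the columns
in `J`, in increasing order. -/
def plucker {R : Type*} [CommRing R] {m n : ℕ} (A : Matrix (Fin m) (Fin n) R)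
    (J : Finset (Fin n)) : R :=
  if h : J.card ≤ m then (A.submatrix (Fin.castLE h) (J.orderEmbOfFin rfl)).det else 0

/-- The interval `(a, b] = {a + 1, …, b}` in `{1, …, n}`, where `c : Fin n` stands for the
number `c + 1`. -/
def interval (n a b : ℕ) : Finset (Fin n) :=
  Finset.univ.filter fun c => a < (c : ℕ) + 1 ∧ (c : ℕ) + 1 ≤ b

/-- The sum of the elements of `J ⊆ {1, …, n}`. -/
def indexSum {n : ℕ} (J : Finset (Fin n)) : ℕ := ∑ c ∈ J, ((c : ℕ) + 1)

/-- The polynomial in the entries of an `n_r × n` matrix obtained from a polynomial in the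
Plücker coordinates. -/
noncomputable def toEntries {n : ℕ} (D : Finset ℕ) (f : MvPolynomial (Finset (Fin n)) ℂ) :
    MvPolynomial (Fin (D.sup id) × Fin n) ℂ :=
  aeval (plucker (Matrix.mvPolynomialX (Fin (D.sup id)) (Fin n) ℂ)) f

/-- The set `Z` of flags is the hypersurface `f = 0`, where `f` is a polynomial in the Plücker
coordinates which is homogeneous in each group of them. The first clause says so for points.
The second one says that the equation is reduced, so that `Z` is `f = 0` as a subscheme (and as
a divisor, with multiplicity one): on the variety of full rank matrices, which is a principal
bundle over the flag variety, `f` generates the ideal of `Z`. -/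
def IsDefinedBy {n : ℕ} {D : Finset ℕ} (Z : Set (PartialFlag n D))
    (f : MvPolynomial (Finset (Fin n)) ℂ) : Prop :=
  (∀ F : PartialFlag n D, F ∈ Z ↔
    ∀ A : Matrix (Fin (D.sup id)) (Fin n) ℂ, Represents A F → aeval (plucker A) f = 0) ∧
  matrixIdeal Z = Ideal.span {toEntries D f}

end FlagVariety

open FlagVariety

/-! Membership in a projected Richardson variety is turned into linear algebra on the flag F. For
either Borel subgroup, encoded by an order θ on the coordinates, the closure of a Schubert cell is
given by lower bounds on dim(F_j ∩ E_m), where E_m is spanned by the first m coordinates in the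
order θ (`mem_closure_cell`, `rk_le_of_mem_closure`). One inclusion comes from the Bruhat
decomposition and explicit one-parameter degenerations, the other from minors that vanish on the
cell.

For X_{s_i} the only bound that is not automatic says that G_i contains a nonzero vector supported
on the last n - i coordinates. For X^{w₀w_P} nothing is imposed on the spaces indexed by D. If a < i
< b are the neighbours of i in D ∪ {0, n}, the essential bound on G_i is dim(G_i ∩ E) ≥ i - a, with
E spanned by the first n - b + (i - a) coordinates. Eliminating G_i, the flag F lies in the
projection iff there are x ∈ F_a and y ∈ F_b, not both zero, with y ∈ E and x + y supported on the
last n - i coordinates (`mem_projRichardson_iff`). For i ∈ D the condition on G_i is already one on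
F_i.

Such a pair is a left null vector of a square matrix of size a + b. The Laplace expansion of its
determinant along the first a rows is the quadratic equation (`det_incidenceMatrix`,
`det_incidenceMatrix_eq_zero_iff`). When a = 0 or b = n the condition on (x, y) collapses to the
vanishing of one minor.

For the ideal, the equation is shown to be irreducible by looking at its degree in each row
(`irreducible_plucker`, `irreducible_incidencePoly`). It then generates a prime ideal, and the
Nullstellensatz identifies this ideal with that of Z once one maximal minor, nonzero somewhere on Z,
is cancelled (`isDefinedBy_of_irreducible`). -/

namespace FlagVariety

/-! ### Coordinate subspaces, rank functions and cells for an arbitrary order θ (θ = 1 gives B,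
reversal gives B⁻). -/

variable {n : ℕ}

/-- The vectors of `ℂⁿ` supported on `T`. -/
def coordSub (T : Finset (Fin n)) : Submodule ℂ (Fin n → ℂ) where
  carrier := {z | ∀ c, c ∉ T → z c = 0}
  zero_mem' _ _ := rfl
  add_mem' hx hy c hc := by simp [hx c hc, hy c hc]
  smul_mem' r x hx c hc := by simp [hx c hc]

theorem mem_coordSub {T : Finset (Fin n)} {z : Fin n → ℂ} :
    z ∈ coordSub T ↔ ∀ c, c ∉ T → z c = 0 := Iff.rfl

theorem coordSub_inf (S T : Finset (Fin n)) : coordSub S ⊓ coordSub T = coordSub (S ∩ T) := by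
  ext z
  simp only [Submodule.mem_inf, mem_coordSub, Finset.mem_inter]
  constructor
  · rintro ⟨h1, h2⟩ c hc
    by_cases h : c ∈ S
    · exact h2 c fun h' => hc ⟨h, h'⟩
    · exact h1 c h
  · intro h
    exact ⟨fun c hc => h c fun h' => hc h'.1, fun c hc => h c fun h' => hc h'.2⟩

theorem coordSub_mono {S T : Finset (Fin n)} (h : S ⊆ T) : coordSub S ≤ coordSub T :=
  fun _ hz c hc => hz c fun h' => hc (h h')

theorem finrank_coordSub (T : Finset (Fin n)) :
    Module.finrank ℂ (coordSub T) = T.card := by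
  let e : coordSub T ≃ₗ[ℂ] (T → ℂ) :=
    { toFun := fun z c => z.1 c
      map_add' := fun _ _ => rfl
      map_smul' := fun _ _ => rfl
      invFun := fun f => ⟨fun c => if h : c ∈ T then f ⟨c, h⟩ else 0, fun c hc => by simp [hc]⟩
      left_inv := by
        rintro ⟨z, hz⟩
        ext c
        by_cases h : c ∈ T
        · simp [h]
        · simp [h, hz c h]
      right_inv := by
        intro f
        ext c
        simp }
  rw [e.finrank_eq]
  simp

theorem single_mem_coordSub {T : Finset (Fin n)} {c : Fin n} (hc : c ∈ T) (r : ℂ) :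
    (Pi.single c r : Fin n → ℂ) ∈ coordSub T := by
  intro d hd
  have : d ≠ c := fun h => hd (h ▸ hc)
  simp [this]

/-- The number of `p < j` with `u p < m`. -/
def rk (u : Equiv.Perm (Fin n)) (j m : ℕ) : ℕ :=
  (Finset.univ.filter fun p : Fin n => (p : ℕ) < j ∧ (u p : ℕ) < m).card

/-- The coordinates which come before `m` in the order given by `θ`. -/
def below (θ : Equiv.Perm (Fin n)) (m : ℕ) : Finset (Fin n) :=
  Finset.univ.filter fun c => (θ c : ℕ) < m

theorem mem_below {θ : Equiv.Perm (Fin n)} {m : ℕ} {c : Fin n} :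
    c ∈ below θ m ↔ (θ c : ℕ) < m := by simp [below]

theorem card_below (θ : Equiv.Perm (Fin n)) {m : ℕ} (hm : m ≤ n) : (below θ m).card = m := by
  have : (below θ m).card = (Finset.univ.filter fun c : Fin n => (c : ℕ) < m).card := by
    refine Finset.card_bij (fun c _ => θ c) ?_ ?_ ?_
    · intro c hc; simpa [below] using hc
    · intro a _ b _ h; exact θ.injective h
    · intro c hc; exact ⟨θ.symm c, by simpa [below] using hc, by simp⟩
  rw [this, Fin.card_filter_val_lt]
  omega

theorem coordFlag_space {D : Finset ℕ} (hD : D ⊆ Finset.Ioo 0 n) (w : Equiv.Perm (Fin n)) (j : D) :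
    (coordFlag hD w).space j = coordSub (below w⁻¹ j) := by
  have hj := Finset.mem_Ioo.mp (hD j.2)
  refine Submodule.eq_of_le_of_finrank_eq ?_ ?_
  · refine Submodule.span_le.2 ?_
    rintro _ ⟨a, ha, rfl⟩
    exact single_mem_coordSub (by simpa [below] using ha) 1
  · rw [finrank_coordSub, card_below _ hj.2.le]
    exact (coordFlag hD w).finrank_space j

theorem act_mul {D : Finset ℕ} (g h : Matrix.SpecialLinearGroup (Fin n) ℂ) (F : PartialFlag n D) :
    act (g * h) F = act g (act h F) := by
  ext1
  funext j
  simp only [act, map_mul, ← Submodule.map_comp]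
  rfl

/-- `b` preserves the coordinate flag in the order given by `θ`. -/
def IsTriangular (θ : Equiv.Perm (Fin n)) (b : Matrix.SpecialLinearGroup (Fin n) ℂ) : Prop :=
  ∀ p q : Fin n, θ q < θ p → b.1 p q = 0

/-- Schubert cells for the Borel subgroup given by the order `θ` on the coordinates. -/
def cell (θ : Equiv.Perm (Fin n)) {D : Finset ℕ} (hD : D ⊆ Finset.Ioo 0 n)
    (w : Equiv.Perm (Fin n)) : Set (PartialFlag n D) :=
  {F | ∃ b, IsTriangular θ b ∧ F = act b (coordFlag hD w)}

theorem schubertCell_eq {D : Finset ℕ} (hD : D ⊆ Finset.Ioo 0 n) (w : Equiv.Perm (Fin n)) :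
    schubertCell hD w = cell 1 hD w := rfl

theorem oppositeSchubertCell_eq {D : Finset ℕ} (hD : D ⊆ Finset.Ioo 0 n)
    (w : Equiv.Perm (Fin n)) : oppositeSchubertCell hD w = cell Fin.revPerm hD w := by
  simp [oppositeSchubertCell, cell, IsTriangular, Fin.rev_lt_rev]

theorem IsTriangular.mul {θ : Equiv.Perm (Fin n)} {b c : Matrix.SpecialLinearGroup (Fin n) ℂ}
    (hb : IsTriangular θ b) (hc : IsTriangular θ c) : IsTriangular θ (b * c) := by
  intro p q hpq
  rw [Matrix.SpecialLinearGroup.coe_mul, Matrix.mul_apply]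
  refine Finset.sum_eq_zero fun r _ => ?_
  by_cases h : θ r < θ p
  · rw [hb p r h, zero_mul]
  · rw [hc r q (lt_of_lt_of_le hpq (not_lt.1 h)), mul_zero]

theorem det_of_triangular (θ : Equiv.Perm (Fin n)) (b : Matrix (Fin n) (Fin n) ℂ)
    (hb : ∀ p q : Fin n, θ q < θ p → b p q = 0) : b.det = ∏ c, b c c := by
  rw [← Matrix.det_submatrix_equiv_self θ.symm b, Matrix.det_of_isUpperTriangular]
  · exact Equiv.prod_comp θ.symm fun c => b c c
  · intro p q hpq
    exact hb _ _ (by simpa using hpq)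

theorem IsTriangular.diag_ne_zero {θ : Equiv.Perm (Fin n)}
    {b : Matrix.SpecialLinearGroup (Fin n) ℂ} (hb : IsTriangular θ b) (c : Fin n) :
    b.1 c c ≠ 0 := by
  have h := det_of_triangular θ b.1 hb
  rw [b.2] at h
  intro hc
  exact one_ne_zero (h.trans (Finset.prod_eq_zero (Finset.mem_univ c) hc))

theorem toLin'_toLinearMap_apply (b : Matrix.SpecialLinearGroup (Fin n) ℂ) (z : Fin n → ℂ)
    (c : Fin n) :
    (Matrix.SpecialLinearGroup.toLin' b).toLinearMap z c = ∑ d, b.1 c d * z d := by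
  simp [Matrix.SpecialLinearGroup.toLin'_apply, Matrix.mulVec, dotProduct]

theorem IsTriangular.map_coordSub {θ : Equiv.Perm (Fin n)}
    {b : Matrix.SpecialLinearGroup (Fin n) ℂ} (hb : IsTriangular θ b) (m : ℕ) :
    (coordSub (below θ m)).map (Matrix.SpecialLinearGroup.toLin' b).toLinearMap =
      coordSub (below θ m) := by
  refine Submodule.eq_of_le_of_finrank_eq ?_ (LinearEquiv.finrank_map_eq _ _)
  rintro _ ⟨z, hz, rfl⟩ c hc
  rw [toLin'_toLinearMap_apply]
  refine Finset.sum_eq_zero fun d _ => ?_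
  by_cases hd : d ∈ below θ m
  · rw [hb c d, zero_mul]
    rw [mem_below] at hc hd
    exact Fin.lt_def.2 (by omega)
  · rw [hz d hd, mul_zero]

theorem card_inter_below (θ v : Equiv.Perm (Fin n)) (j m : ℕ) :
    (below v⁻¹ j ∩ below θ m).card = rk (θ * v) j m := by
  rw [rk]
  refine Finset.card_bij (fun c _ => v⁻¹ c) ?_ ?_ ?_
  · intro c hc
    rw [Finset.mem_inter, mem_below, mem_below] at hc
    exact Finset.mem_filter.2 ⟨Finset.mem_univ _, hc.1, by simpa using hc.2⟩
  · intro a _ c _ h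
    exact (v⁻¹).injective h
  · intro p hp
    have hp := (Finset.mem_filter.1 hp).2
    refine ⟨v p, ?_, by simp⟩
    rw [Finset.mem_inter, mem_below, mem_below]
    exact ⟨by simpa using hp.1, hp.2⟩

/-- A θ-triangular b preserves every E_m, so the dimension may be computed at the torus-fixed point,
where it is a count of coordinates. -/
theorem finrank_inf_below {θ : Equiv.Perm (Fin n)} {D : Finset ℕ} (hD : D ⊆ Finset.Ioo 0 n)
    {b : Matrix.SpecialLinearGroup (Fin n) ℂ} (hb : IsTriangular θ b) (v : Equiv.Perm (Fin n))
    (j : D) (m : ℕ) :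
    Module.finrank ℂ ((act b (coordFlag hD v)).space j ⊓ coordSub (below θ m) : Submodule ℂ _) =
      rk (θ * v) j m := by
  have h : (act b (coordFlag hD v)).space j ⊓ coordSub (below θ m) =
      (coordSub (below v⁻¹ j ∩ below θ m)).map
        (Matrix.SpecialLinearGroup.toLin' b).toLinearMap := by
    rw [← coordSub_inf, Submodule.map_inf _ (LinearEquiv.injective _), hb.map_coordSub,
      ← coordFlag_space hD]
    rfl
  rw [h, LinearEquiv.finrank_map_eq, finrank_coordSub, card_inter_below]

/-- A left null vector of the minor gives a combination of rows that vanishes on J, and independence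
of the rows keeps it nonzero. This is how equations in Plücker coordinates become incidence
conditions. -/
theorem plucker_eq_zero_iff {k : ℕ} {A : Matrix (Fin k) (Fin n) ℂ}
    (hA : LinearIndependent ℂ A.row) {J : Finset (Fin n)} (hJ : J.card ≤ k) :
    plucker A J = 0 ↔
      ∃ z ∈ Submodule.span ℂ (A.row '' {a | (a : ℕ) < J.card}), z ≠ 0 ∧ ∀ c ∈ J, z c = 0 := by
  have hset : A.row '' {a | (a : ℕ) < J.card} = Set.range (A.row ∘ Fin.castLE hJ) := by
    ext v
    constructor
    · rintro ⟨a, ha, rfl⟩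
      exact ⟨⟨a, ha⟩, rfl⟩
    · rintro ⟨a, rfl⟩
      exact ⟨Fin.castLE hJ a, a.2, rfl⟩
  rw [plucker, dif_pos hJ, ← Matrix.exists_vecMul_eq_zero_iff, hset]
  have hli := hA.comp _ (Fin.castLE_injective hJ)
  constructor
  · rintro ⟨v, hv, h⟩
    refine ⟨∑ a, v a • (A.row ∘ Fin.castLE hJ) a, ?_, ?_, ?_⟩
    · exact Submodule.sum_mem _ fun a _ => Submodule.smul_mem _ _ (Submodule.subset_span ⟨a, rfl⟩)
    · intro h0
      exact hv (funext (Fintype.linearIndependent_iff.1 hli v h0))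
    · intro c hc
      have : c ∈ Set.range (J.orderEmbOfFin rfl) := by simpa using hc
      obtain ⟨p, rfl⟩ := this
      have := congrFun h p
      simpa [Matrix.vecMul, dotProduct] using this
  · rintro ⟨z, hz, hz0, hzJ⟩
    obtain ⟨v, rfl⟩ := (Submodule.mem_span_range_iff_exists_fun ℂ).1 hz
    refine ⟨v, ?_, ?_⟩
    · rintro rfl
      exact hz0 (by simp)
    · funext p
      have := hzJ _ (Finset.orderEmbOfFin_mem J rfl p)
      simpa [Matrix.vecMul, dotProduct] using this

end FlagVariety

/-! ### Bruhat decomposition by a greedy choice of adapted basis. -/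

namespace FlagVariety

variable {n : ℕ}

/-- The smallest space of the flag of dimension greater than `a`. -/
def PartialFlag.above {D : Finset ℕ} (F : PartialFlag n D) (a : ℕ) : Submodule ℂ (Fin n → ℂ) :=
  ⨅ j : D, ⨅ _ : a < (j : ℕ), F.space j

theorem PartialFlag.mem_above {D : Finset ℕ} {F : PartialFlag n D} {a : ℕ} {z : Fin n → ℂ} :
    z ∈ F.above a ↔ ∀ j : D, a < (j : ℕ) → z ∈ F.space j := by
  simp [PartialFlag.above, Submodule.mem_iInf]

/-- The infimum contains the space of the least index exceeding a; if there is no such index, it is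
an empty infimum, hence everything. -/
theorem PartialFlag.lt_finrank_above {D : Finset ℕ} (F : PartialFlag n D) {a : ℕ} (ha : a < n) :
    a < Module.finrank ℂ (F.above a) := by
  by_cases h : ∃ j : D, a < (j : ℕ)
  · have hne : (D.filter (a < ·)).Nonempty := by
      obtain ⟨j, hj⟩ := h
      exact ⟨j, Finset.mem_filter.2 ⟨j.2, hj⟩⟩
    have hm := Finset.mem_filter.1 (Finset.min'_mem _ hne)
    have hle : F.space ⟨_, hm.1⟩ ≤ F.above a := by
      intro z hz
      rw [PartialFlag.mem_above]
      intro j hj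
      exact F.mono ⟨_, hm.1⟩ j (Finset.min'_le _ _ (Finset.mem_filter.2 ⟨j.2, hj⟩)) hz
    have := Submodule.finrank_mono hle
    rw [F.finrank_space] at this
    exact lt_of_lt_of_le hm.2 this
  · have : F.above a = ⊤ := by
      rw [eq_top_iff]
      intro z _
      rw [PartialFlag.mem_above]
      intro j hj
      exact absurd ⟨j, hj⟩ h
    rw [this, finrank_top]
    simpa using ha

/-- `y`, with leading coordinate `c`, is a vector with the smallest possible leading coordinate
among those which may follow `u 0, …, u (a - 1)` in a basis adapted to `F`. -/
structure IsNext (θ : Equiv.Perm (Fin n)) {D : Finset ℕ} (F : PartialFlag n D)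
    (u : ℕ → Fin n → ℂ) (a : ℕ) (y : Fin n → ℂ) (c : Fin n) : Prop where
  mem_above : y ∈ F.above a
  notMem_span : y ∉ Submodule.span ℂ (u '' Set.Iio a)
  mem_coordSub : y ∈ coordSub (below θ (θ c + 1))
  minimal : F.above a ⊓ coordSub (below θ (θ c)) ≤ Submodule.span ℂ (u '' Set.Iio a)

theorem finrank_span_image_Iio_le (u : ℕ → Fin n → ℂ) (a : ℕ) :
    Module.finrank ℂ (Submodule.span ℂ (u '' Set.Iio a)) ≤ a := by
  classical
  have h := finrank_span_finset_le_card (R := ℂ) ((Finset.range a).image u)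
  have hc : (((Finset.range a).image u : Finset _) : Set (Fin n → ℂ)) = u '' Set.Iio a := by
    ext; simp
  rw [hc] at h
  exact h.trans (Finset.card_image_le.trans (by simp))

theorem exists_isNext (θ : Equiv.Perm (Fin n)) {D : Finset ℕ} (F : PartialFlag n D)
    (u : ℕ → Fin n → ℂ) {a : ℕ} (ha : a < n) : ∃ y c, IsNext θ F u a y c := by
  set S := Submodule.span ℂ (u '' Set.Iio a)
  -- The leading coordinate is the one in position m - 1, for the least m at which E_m contributes
  -- something new. Some m works because the space above has dimension greater than a, while at most
  -- a vectors have been chosen.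
  have hex : ∃ m, ¬ F.above a ⊓ coordSub (below θ m) ≤ S := by
    refine ⟨n, fun h => ?_⟩
    have htop : F.above a ⊓ coordSub (below θ n) = F.above a := by
      refine inf_eq_left.2 fun z _ c hc => ?_
      exact absurd (mem_below.2 (θ c).2) hc
    rw [htop] at h
    have h1 := Submodule.finrank_mono h
    have h2 : Module.finrank ℂ S ≤ a := finrank_span_image_Iio_le u a
    have h3 := F.lt_finrank_above ha
    omega
  classical
  have hspec := Nat.find_spec hex
  have hmin : ∀ m < Nat.find hex, F.above a ⊓ coordSub (below θ m) ≤ S :=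
    fun m hm => not_not.1 (Nat.find_min hex hm)
  obtain ⟨y, hy, hyS⟩ := Set.not_subset.1 hspec
  have hpos : Nat.find hex ≠ 0 := by
    intro h0
    rw [h0] at hy
    have : y = 0 := by
      funext c
      exact hy.2 c (by simp [below])
    exact hyS (this ▸ S.zero_mem)
  have hlt : Nat.find hex - 1 < n := by
    by_contra hge
    refine hyS (hmin (Nat.find hex - 1) (by omega) ⟨hy.1, fun c hc => ?_⟩)
    exact absurd (mem_below.2 (by have := (θ c).2; omega)) hc
  refine ⟨y, θ.symm ⟨Nat.find hex - 1, hlt⟩, hy.1, hyS, ?_, ?_⟩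
  · have : ((θ (θ.symm ⟨Nat.find hex - 1, hlt⟩) : Fin n) : ℕ) + 1 = Nat.find hex := by
      simp only [Equiv.apply_symm_apply]; omega
    rw [this]
    exact hy.2
  · simp only [Equiv.apply_symm_apply]
    exact hmin _ (by omega)

theorem IsNext.congr {θ : Equiv.Perm (Fin n)} {D : Finset ℕ} {F : PartialFlag n D}
    {u u' : ℕ → Fin n → ℂ} {a : ℕ} {y : Fin n → ℂ} {c : Fin n} (h : IsNext θ F u a y c)
    (hu : ∀ q < a, u' q = u q) : IsNext θ F u' a y c := by
  have : u' '' Set.Iio a = u '' Set.Iio a := Set.image_congr hu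
  obtain ⟨h1, h2, h3, h4⟩ := h
  exact ⟨h1, by rwa [this], h3, by rwa [this]⟩

theorem exists_isNext_seq (θ : Equiv.Perm (Fin n)) {D : Finset ℕ} (F : PartialFlag n D)
    (hn : 0 < n) :
    ∃ (u : ℕ → Fin n → ℂ) (v : ℕ → Fin n), ∀ a < n, IsNext θ F u a (u a) (v a) := by
  suffices h : ∀ N ≤ n, ∃ (u : ℕ → Fin n → ℂ) (v : ℕ → Fin n),
      ∀ a < N, IsNext θ F u a (u a) (v a) from h n le_rfl
  intro N
  induction N with
  | zero => exact fun _ => ⟨fun _ => 0, fun _ => ⟨0, hn⟩, fun a ha => absurd ha (by omega)⟩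
  | succ N ih =>
    intro hN
    obtain ⟨u, v, h⟩ := ih (by omega)
    obtain ⟨y, c, hy⟩ := exists_isNext θ F u (a := N) (by omega)
    have hu : ∀ a ≤ N, ∀ q < a, Function.update u N y q = u q := fun a ha q hq =>
      Function.update_of_ne (by omega) _ _
    refine ⟨Function.update u N y, Function.update v N c, fun a ha => ?_⟩
    rcases Nat.lt_succ_iff_lt_or_eq.1 ha with h' | rfl
    · rw [Function.update_of_ne (by omega), Function.update_of_ne (by omega)]
      exact (h a h').congr (hu a h'.le)
    · simpa using hy.congr (hu a le_rfl)

theorem IsNext.apply_ne_zero {θ : Equiv.Perm (Fin n)} {D : Finset ℕ} {F : PartialFlag n D}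
    {u : ℕ → Fin n → ℂ} {a : ℕ} {y : Fin n → ℂ} {c : Fin n} (h : IsNext θ F u a y c) :
    y c ≠ 0 := by
  intro h0
  refine h.notMem_span (h.minimal ⟨h.mem_above, fun d hd => ?_⟩)
  rw [mem_below] at hd
  by_cases hdc : d = c
  · rw [hdc, h0]
  · refine h.mem_coordSub d fun h' => ?_
    rw [mem_below] at h'
    exact hdc (θ.injective (Fin.ext (by omega)))

theorem PartialFlag.above_mono {D : Finset ℕ} (F : PartialFlag n D) {a a' : ℕ} (h : a ≤ a') :
    F.above a ≤ F.above a' := by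
  intro z hz
  rw [PartialFlag.mem_above] at hz ⊢
  exact fun j hj => hz j (by omega)

/-- If two leading coordinates agreed, subtracting a multiple of the earlier vector would lower the
lead of the later one. Minimality then puts the difference, and so the later vector itself, in the
span of its predecessors. -/
theorem isNext_lead_ne {θ : Equiv.Perm (Fin n)} {D : Finset ℕ} {F : PartialFlag n D}
    {u : ℕ → Fin n → ℂ} {v : ℕ → Fin n} (h : ∀ a < n, IsNext θ F u a (u a) (v a))
    {a a' : ℕ} (haa : a < a') (ha' : a' < n) : v a ≠ v a' := by
  intro hv
  have h1 := h a (haa.trans ha')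
  have h2 := h a' ha'
  have hmem : u a ∈ Submodule.span ℂ (u '' Set.Iio a') := Submodule.subset_span ⟨a, haa, rfl⟩
  have h3 : u a' - (u a' (v a) / u a (v a)) • u a ∈ Submodule.span ℂ (u '' Set.Iio a') := by
    refine h2.minimal ⟨Submodule.sub_mem _ h2.mem_above
      (Submodule.smul_mem _ _ (F.above_mono haa.le h1.mem_above)), fun d hd => ?_⟩
    rw [← hv, mem_below] at hd
    by_cases hdc : d = v a
    · subst hdc
      have := h1.apply_ne_zero
      simp [this]
    · have hd' : d ∉ below θ (θ (v a) + 1) := by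
        rw [mem_below]
        intro h'
        exact hdc (θ.injective (Fin.ext (by omega)))
      have e1 := h1.mem_coordSub d hd'
      have e2 := h2.mem_coordSub d (hv ▸ hd')
      simp [e1, e2]
  have := Submodule.add_mem _ h3 (Submodule.smul_mem _ (u a' (v a) / u a (v a)) hmem)
  rw [sub_add_cancel] at this
  exact h2.notMem_span this

/-- Bruhat decomposition, with a representative of the coset which is increasing on blocks. -/
theorem exists_bruhat (θ : Equiv.Perm (Fin n)) {D : Finset ℕ} (hD : D ⊆ Finset.Ioo 0 n)
    (F : PartialFlag n D) (hn : 0 < n) :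
    ∃ (b : Matrix.SpecialLinearGroup (Fin n) ℂ) (v : Equiv.Perm (Fin n)),
      IsTriangular θ b ∧ F = act b (coordFlag hD v) ∧
      ∀ a a' : Fin n, (a' : ℕ) = a + 1 → (a' : ℕ) ∉ D → θ (v a) < θ (v a') := by
  obtain ⟨u, v, h⟩ := exists_isNext_seq θ F hn
  have hinj : Function.Injective fun a : Fin n => v a := by
    intro a a' haa
    by_contra hne
    rcases lt_or_gt_of_ne (fun h' => hne (Fin.ext h') : (a : ℕ) ≠ a') with h' | h'
    · exact isNext_lead_ne h h' a'.2 haa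
    · exact isNext_lead_ne h h' a.2 haa.symm
  let w : Equiv.Perm (Fin n) := Equiv.ofBijective _ (Finite.injective_iff_bijective.1 hinj)
  have hw : ∀ a : Fin n, w a = v a := fun _ => rfl
  have hN : ∀ a : Fin n, IsNext θ F u a (u a) (w a) := fun a => h a a.2
  let M : Matrix (Fin n) (Fin n) ℂ := Matrix.of fun r c => u (w.symm c) r
  have hM : ∀ p q : Fin n, θ q < θ p → M p q = 0 := by
    intro p q hpq
    refine (hN (w.symm q)).mem_coordSub p ?_
    rw [mem_below, Equiv.apply_symm_apply]
    exact Nat.not_lt.2 hpq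
  have hdiag : ∀ c, M c c ≠ 0 := by
    intro c
    have := (hN (w.symm c)).apply_ne_zero
    rwa [Equiv.apply_symm_apply] at this
  have hdet : M.det ≠ 0 := by
    rw [det_of_triangular θ M hM]
    exact Finset.prod_ne_zero_iff.2 fun c _ => hdiag c
  -- Rescaling one column normalises the determinant to 1 without changing any span.
  let d : Fin n → ℂ := fun c => if c = ⟨0, hn⟩ then M.det⁻¹ else 1
  let b : Matrix.SpecialLinearGroup (Fin n) ℂ := ⟨M * Matrix.diagonal d, by
    rw [Matrix.det_mul, Matrix.det_diagonal, Finset.prod_ite_eq']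
    simp [hdet]⟩
  have hbapp : ∀ p q, b.1 p q = M p q * d q := fun p q => Matrix.mul_diagonal ..
  refine ⟨b, w, ?_, ?_, ?_⟩
  · intro p q hpq
    rw [hbapp, hM p q hpq, zero_mul]
  · ext1
    funext j
    symm
    refine Submodule.eq_of_le_of_finrank_eq ?_ ?_
    · simp only [act, coordFlag]
      rw [Submodule.map_span_le]
      rintro _ ⟨a, ha, rfl⟩
      have : (Matrix.SpecialLinearGroup.toLin' b).toLinearMap (Pi.single (w a) 1) =
          d (w a) • u a := by
        funext c
        rw [toLin'_toLinearMap_apply, Finset.sum_eq_single (w a)]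
        · rw [hbapp]
          simp [M, mul_comm]
        · intro q _ hq
          simp [hq]
        · simp
      rw [this]
      exact Submodule.smul_mem _ _ (PartialFlag.mem_above.1 (hN a).mem_above j ha)
    · rw [F.finrank_space, (act b (coordFlag hD w)).finrank_space]
  · intro a a' haa ha'
    by_contra hle
    have hne : θ (w a') ≠ θ (w a) := by
      intro h'
      have := w.injective (θ.injective h')
      rw [this] at haa
      omega
    have hlt : θ (w a') < θ (w a) := lt_of_le_of_ne (not_lt.1 hle) hne
    -- No index of D separates a from a' = a + 1, so both vectors were chosen from the same space. A
    -- smaller lead at a' would contradict minimality at a.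
    have hab : F.above a' ≤ F.above a := by
      intro z hz
      rw [PartialFlag.mem_above] at hz ⊢
      intro j hj
      have : (j : ℕ) ≠ a' := fun h' => ha' (h' ▸ j.2)
      exact hz j (by omega)
    refine (hN a').notMem_span (Submodule.span_mono (Set.image_mono ?_)
      ((hN a).minimal ⟨hab (hN a').mem_above, ?_⟩))
    · intro q hq
      simp only [Set.mem_Iio] at hq ⊢
      omega
    · refine coordSub_mono ?_ (hN a').mem_coordSub
      intro c hc
      rw [mem_below] at hc ⊢
      have := Fin.lt_def.1 hlt
      omega

end FlagVariety

/-! ### Zariski closure and degenerations between neighbouring cells. -/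

namespace FlagVariety

variable {n : ℕ}

theorem mem_reps_singleton {D : Finset ℕ} {F : PartialFlag n D}
    {x : Fin (D.sup id) × Fin n → ℂ} :
    x ∈ reps {F} ↔ Represents (Matrix.of fun a c => x (a, c)) F := by
  simp [reps]

theorem subset_zariskiClosure {D : Finset ℕ} (Z : Set (PartialFlag n D)) :
    Z ⊆ zariskiClosure Z := by
  intro F hF x hx p hp
  rw [mem_reps_singleton] at hx
  exact hp x ⟨F, hF, hx⟩

theorem zariskiClosure_subset {D : Finset ℕ} {Z W : Set (PartialFlag n D)}
    (h : Z ⊆ zariskiClosure W) : zariskiClosure Z ⊆ zariskiClosure W := by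
  intro F hF x hx p hp
  refine hF hx p ?_
  rintro y ⟨G, hG, hy⟩
  exact h hG (mem_reps_singleton.2 hy) p hp

theorem Represents.map {D : Finset ℕ} {F : PartialFlag n D}
    {A : Matrix (Fin (D.sup id)) (Fin n) ℂ} (hA : Represents A F)
    (g : Matrix.SpecialLinearGroup (Fin n) ℂ) :
    Represents (Matrix.of fun a => (Matrix.SpecialLinearGroup.toLin' g).toLinearMap (A a))
      (act g F) := by
  refine ⟨?_, fun j => ?_⟩
  · exact hA.1.map' _ (LinearEquiv.ker _)
  · simp only [act]
    rw [hA.2 j, Submodule.map_span, ← Set.image_comp]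
    rfl

/-- The matrix `1 + t e_{pq}`. -/
def elem (p q : Fin n) (h : p ≠ q) (t : ℂ) : Matrix.SpecialLinearGroup (Fin n) ℂ :=
  ⟨Matrix.transvection p q t, Matrix.det_transvection_of_ne p q h t⟩

theorem elem_apply {p q : Fin n} (h : p ≠ q) (t : ℂ) (z : Fin n → ℂ) :
    (Matrix.SpecialLinearGroup.toLin' (elem p q h t)).toLinearMap z = z + Pi.single p (t * z q) := by
  have : (Matrix.SpecialLinearGroup.toLin' (elem p q h t)).toLinearMap z =
      Matrix.mulVec (Matrix.transvection p q t) z := rfl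
  rw [this, Matrix.transvection, Matrix.add_mulVec, Matrix.one_mulVec]
  congr 1
  funext c
  simp only [Matrix.mulVec, dotProduct, Matrix.single_apply]
  by_cases hc : c = p
  · subst hc; simp
  · simp [hc, Ne.symm hc]

theorem elem_triangular {θ : Equiv.Perm (Fin n)} {p q : Fin n} (h : θ p < θ q) (t : ℂ) :
    IsTriangular θ (elem p q (fun h' => by simp [h'] at h) t) := by
  intro r s hrs
  have h1 : r ≠ s := fun h' => by simp [h'] at hrs
  have h2 : ¬ (p = r ∧ q = s) := by
    rintro ⟨rfl, rfl⟩
    exact lt_asymm h hrs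
  simp [elem, Matrix.transvection, h1, h2]

/-- For t ≠ 0 the vectors e_{v p} + t e_{v q} and e_{v q} + t⁻¹ e_{v p} span the same line; once
position q is reached, both sides contain the whole coordinate plane. -/
theorem act_elem_coordFlag {D : Finset ℕ} (hD : D ⊆ Finset.Ioo 0 n) (v : Equiv.Perm (Fin n))
    {p q : Fin n} (hpq : p < q) {t : ℂ} (ht : t ≠ 0) (h : v p ≠ v q) :
    act (elem (v q) (v p) h.symm t) (coordFlag hD v) =
      act (elem (v p) (v q) h t⁻¹) (coordFlag hD (v * Equiv.swap p q)) := by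
  ext1
  funext j
  refine Submodule.eq_of_le_of_finrank_eq ?_
    (((act _ _).finrank_space j).trans ((act _ _).finrank_space j).symm)
  set S := (act (elem (v p) (v q) h t⁻¹) (coordFlag hD (v * Equiv.swap p q))).space j
  have hS : ∀ a : Fin n, (a : ℕ) < j → (Pi.single (v (Equiv.swap p q a)) 1 +
      Pi.single (v p) (t⁻¹ * (Pi.single (v (Equiv.swap p q a)) 1 : Fin n → ℂ) (v q)) :
        Fin n → ℂ) ∈ S := by
    intro a ha
    rw [← elem_apply h]
    exact Submodule.mem_map_of_mem (Submodule.subset_span ⟨a, ha, rfl⟩)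
  simp only [act, coordFlag]
  rw [Submodule.map_span_le]
  rintro _ ⟨a, ha, rfl⟩
  rw [elem_apply]
  have ha' : (a : ℕ) < j := ha
  by_cases hap : a = p
  · subst hap
    have h1 := Submodule.smul_mem S t (hS a ha')
    rw [Equiv.swap_apply_left] at h1
    convert h1 using 1
    funext c
    simp only [Pi.add_apply, Pi.smul_apply, Pi.single_apply, smul_eq_mul]
    by_cases h1 : c = v a <;> by_cases h2 : c = v q <;> simp [h1, h2, ht, h, h.symm]
  · have h0 : v p ≠ v a := fun h' => hap (v.injective h').symm
    by_cases haq : a = q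
    · subst haq
      have h1 := hS a ha'
      have h2 := hS p (lt_trans hpq ha')
      rw [Equiv.swap_apply_right] at h1
      rw [Equiv.swap_apply_left] at h2
      have h3 := Submodule.sub_mem S h2 (Submodule.smul_mem S t⁻¹ h1)
      convert h3 using 1
      funext c
      simp only [Pi.add_apply, Pi.smul_apply, Pi.single_apply, smul_eq_mul, Pi.sub_apply]
      by_cases h1 : c = v a <;> by_cases h2 : c = v p <;> simp [h1, h2, h, h.symm]
    · have h1 := hS a ha'
      rw [Equiv.swap_apply_of_ne_of_ne hap haq] at h1
      have h0' : v q ≠ v a := fun h' => haq (v.injective h').symm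
      convert h1 using 1
      simp [h0, h0']

/-- Each cell lies in the closure of the cell obtained by sorting two values downwards. -/
theorem cell_subset_closure_swap {θ : Equiv.Perm (Fin n)} {D : Finset ℕ}
    (hD : D ⊆ Finset.Ioo 0 n) (v : Equiv.Perm (Fin n)) {p q : Fin n} (hpq : p < q)
    (hv : θ (v p) < θ (v q)) :
    cell θ hD v ⊆ zariskiClosure (cell θ hD (v * Equiv.swap p q)) := by
  rintro _ ⟨b, hb, rfl⟩ x hx g hg
  have h : v p ≠ v q := fun h' => by simp [h'] at hv
  rw [mem_reps_singleton] at hx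
  -- A curve through the identity at t = 0 whose other points carry the given flag into the cell of
  -- the swapped permutation. Conjugation by b makes it act on b·vP as the elementary matrix acts on
  -- vP. A polynomial that vanishes along it for t ≠ 0 also vanishes at t = 0.
  let N : ℂ → Matrix.SpecialLinearGroup (Fin n) ℂ := fun t =>
    b * elem (v q) (v p) h.symm t * b⁻¹
  let A : ℂ → Fin (D.sup id) × Fin n → ℂ := fun t s =>
    (Matrix.SpecialLinearGroup.toLin' (N t)).toLinearMap (fun c => x (s.1, c)) s.2
  have hel : Continuous fun t : ℂ => (elem (v q) (v p) h.symm t).1 := by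
    refine continuous_matrix fun e f => ?_
    simp only [elem, Matrix.transvection, Matrix.add_apply, Matrix.single_apply]
    refine continuous_const.add ?_
    split_ifs
    · exact continuous_id
    · exact continuous_const
  have hN : Continuous fun t => (N t).1 := by
    simp only [N, Matrix.SpecialLinearGroup.coe_mul]
    exact (continuous_const.matrix_mul hel).matrix_mul continuous_const
  have hAcont : Continuous A := by
    refine continuous_pi fun s => ?_
    simp only [A, toLin'_toLinearMap_apply]
    refine continuous_finsetSum _ fun d _ => Continuous.mul ?_ continuous_const
    exact hN.matrix_elem _ _
  have hA0 : A 0 = x := by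
    have : elem (v q) (v p) h.symm 0 = 1 := by
      ext1
      simp [elem]
    funext s
    simp only [A, N, this, mul_one, mul_inv_cancel, map_one]
    rfl
  have hAt : ∀ t : ℂ, t ≠ 0 → MvPolynomial.eval (A t) g = 0 := by
    intro t ht
    rw [← MvPolynomial.aeval_eq_eval]
    refine hg _ ⟨act (N t) (act b (coordFlag hD v)), ?_, hx.map (N t)⟩
    refine ⟨b * elem (v p) (v q) h t⁻¹, hb.mul (elem_triangular hv _), ?_⟩
    rw [← act_mul]
    simp only [N]
    rw [inv_mul_cancel_right, act_mul, act_mul, act_elem_coordFlag hD v hpq ht h]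
  have hcont : Continuous fun t => MvPolynomial.eval (A t) g := (MvPolynomial.continuous_eval g).comp hAcont
  have hclosed : IsClosed {t | MvPolynomial.eval (A t) g = 0} := isClosed_singleton.preimage hcont
  have hmem : (0 : ℂ) ∈ closure {t : ℂ | t ≠ 0} := by
    have : Dense ({0}ᶜ : Set ℂ) := dense_compl_singleton 0
    exact this 0
  have := hclosed.closure_subset_iff.2 hAt hmem
  rw [MvPolynomial.aeval_eq_eval, ← hA0]
  exact this

end FlagVariety

/-! ### Bruhat order through rank functions, and rank conditions as sufficient for lying in a
closure. -/

namespace FlagVariety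

variable {n : ℕ}

theorem exists_first_ne {x y : Equiv.Perm (Fin n)} (h : x ≠ y) :
    ∃ p, x p ≠ y p ∧ ∀ a < p, x a = y a := by
  have hne : ({p | x p ≠ y p} : Set (Fin n)).Nonempty := by
    by_contra h'
    refine h (Equiv.ext fun p => ?_)
    by_contra hp
    exact h' ⟨p, hp⟩
  obtain ⟨p, hp, hmin⟩ := WellFounded.has_min (wellFounded_lt (α := Fin n)) _ hne
  exact ⟨p, hp, fun a ha => by_contra fun h' => hmin a h' ha⟩

theorem mem_rk_filter {x : Equiv.Perm (Fin n)} {j m : ℕ} {a : Fin n} :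
    a ∈ (Finset.univ.filter fun p : Fin n => (p : ℕ) < j ∧ (x p : ℕ) < m) ↔
      (a : ℕ) < j ∧ (x a : ℕ) < m := by simp

/-- A covering step in the Bruhat order, in terms of the rank function. -/
theorem exists_swap_rk_le {x y : Equiv.Perm (Fin n)} (hxy : x ≠ y)
    (h : ∀ j m, rk y j m ≤ rk x j m) :
    ∃ p q, p < q ∧ x p < x q ∧ ∀ j m, rk y j m ≤ rk (x * Equiv.swap p q) j m := by
  classical
  obtain ⟨p, hp, hlt⟩ := exists_first_ne hxy
  -- At the first disagreement x p > y p would give y the larger rank at (p + 1, y p + 1).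
  have hxp : x p < y p := by
    by_contra hle
    have hgt : y p < x p := lt_of_le_of_ne (not_lt.1 hle) hp.symm
    refine absurd (h (p + 1) (y p + 1)) (not_le.2 (Finset.card_lt_card ?_))
    rw [Finset.ssubset_iff_of_subset]
    · refine ⟨p, mem_rk_filter.2 ⟨by omega, by omega⟩, fun h' => ?_⟩
      have h1 := (mem_rk_filter.1 h').2
      have h2 := Fin.lt_def.1 hgt
      omega
    · intro a ha
      rw [mem_rk_filter] at ha ⊢
      rcases lt_or_eq_of_le (show a ≤ p from Fin.le_def.2 (by omega)) with h1 | rfl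
      · rw [← hlt a h1]; exact ha
      · have h2 := Fin.lt_def.1 hgt
        omega
  -- q will be the first position after p whose value lies in (x p, y p]. The position where x takes
  -- the value y p shows that there is one.
  have hne : ({q | p < q ∧ x p < x q ∧ x q ≤ y p} : Set (Fin n)).Nonempty := by
    refine ⟨x.symm (y p), ?_, by simpa using hxp, by simp⟩
    by_contra hle
    rcases lt_or_eq_of_le (not_lt.1 hle) with h1 | h1
    · have h2 := hlt _ h1
      rw [Equiv.apply_symm_apply] at h2
      exact h1.ne' (y.injective h2)
    · rw [← h1, Equiv.apply_symm_apply, h1] at hp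
      exact hp rfl
  obtain ⟨q, ⟨hpq, hxq, hqy⟩, hmin⟩ := WellFounded.has_min (wellFounded_lt (α := Fin n)) _ hne
  refine ⟨p, q, hpq, hxq, fun j m => ?_⟩
  have hpq' := Fin.lt_def.1 hpq
  have hxq' := Fin.lt_def.1 hxq
  have hqy' := Fin.le_def.1 hqy
  have hxp' := Fin.lt_def.1 hxp
  have hxswap : ∀ a, a ≠ p → a ≠ q → (x * Equiv.swap p q) a = x a := fun a h1 h2 => by
    rw [Equiv.Perm.mul_apply, Equiv.swap_apply_of_ne_of_ne h1 h2]
  have hswp : (x * Equiv.swap p q) p = x q := by simp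
  have hswq : (x * Equiv.swap p q) q = x p := by simp
  -- The swap lowers the rank, by one, only for p < j ≤ q and x p < m ≤ x q. On this rectangle the
  -- inequality must be shown to have been strict.
  by_cases hj : (p : ℕ) < j ∧ j ≤ q
  · by_cases hm : (x p : ℕ) < m ∧ m ≤ x q
    · have h1 : rk x j m ≤ rk (x * Equiv.swap p q) j m + 1 := by
        have : (Finset.univ.filter fun a : Fin n => (a : ℕ) < j ∧ (x a : ℕ) < m) ⊆
            insert p (Finset.univ.filter fun a : Fin n => (a : ℕ) < j ∧
              ((x * Equiv.swap p q) a : ℕ) < m) := by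
          intro a ha
          rw [mem_rk_filter] at ha
          rw [Finset.mem_insert]
          by_cases hap : a = p
          · exact Or.inl hap
          · refine Or.inr (mem_rk_filter.2 ?_)
            rw [hxswap a hap fun h' => by subst h'; omega]
            exact ha
        exact (Finset.card_le_card this).trans (Finset.card_insert_le _ _)
      have h2 := h j (y p + 1)
      -- By the choice of q, no position strictly between p and j has an x-value in [m, y p], and x
      -- p < m. So only positions before p contribute to the difference.
      have h3 : rk x j (y p + 1) ≤ rk x j m +
          (Finset.univ.filter fun a : Fin n => (a : ℕ) < p ∧ m ≤ x a ∧ x a ≤ y p).card := by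
        refine (Finset.card_le_card ?_).trans (Finset.card_union_le _ _)
        intro a ha
        rw [mem_rk_filter] at ha
        rw [Finset.mem_union, mem_rk_filter, Finset.mem_filter]
        by_cases ham : (x a : ℕ) < m
        · exact Or.inl ⟨ha.1, ham⟩
        · refine Or.inr ⟨Finset.mem_univ _, ?_, by omega, Fin.le_def.2 (by omega)⟩
          by_contra hap
          have : a ≠ p := by rintro rfl; omega
          have hpa : p < a := lt_of_le_of_ne (Fin.le_def.2 (by omega)) this.symm
          exact hmin a ⟨hpa, Fin.lt_def.2 (by omega), Fin.le_def.2 (by omega)⟩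
            (Fin.lt_def.2 (by omega))
      -- Before p the two permutations agree, and p itself has y-value in [m, y p]; this extra 1 is
      -- the strictness sought.
      have h4 : rk y j m + ((Finset.univ.filter fun a : Fin n =>
          (a : ℕ) < p ∧ m ≤ x a ∧ x a ≤ y p).card + 1) ≤ rk y j (y p + 1) := by
        have hp' : p ∉ Finset.univ.filter fun a : Fin n =>
          (a : ℕ) < p ∧ m ≤ x a ∧ x a ≤ y p := by simp
        rw [← Finset.card_insert_of_notMem hp', rk, ← Finset.card_union_of_disjoint]
        · refine Finset.card_le_card ?_
          intro a ha
          rw [Finset.mem_union, mem_rk_filter, Finset.mem_insert, Finset.mem_filter] at ha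
          rw [mem_rk_filter]
          rcases ha with ha | rfl | ⟨-, ha1, ha2, ha3⟩
          · omega
          · omega
          · rw [hlt a (Fin.lt_def.2 ha1)] at ha3
            have := Fin.le_def.1 ha3
            omega
        · rw [Finset.disjoint_left]
          intro a ha ha'
          rw [mem_rk_filter] at ha
          rw [Finset.mem_insert, Finset.mem_filter] at ha'
          rcases ha' with rfl | ⟨-, ha1, ha2, ha3⟩
          · omega
          · rw [hlt a (Fin.lt_def.2 ha1)] at ha2
            omega
      omega
    · refine (h j m).trans (Finset.card_le_card fun a ha => ?_)
      rw [mem_rk_filter] at ha ⊢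
      refine ⟨ha.1, ?_⟩
      by_cases hap : a = p
      · subst hap
        rw [hswp]
        omega
      · rw [hxswap a hap fun h' => by subst h'; omega]
        exact ha.2
  · refine (h j m).trans (Finset.card_le_card_of_injOn (Equiv.swap p q) ?_
      (Equiv.injective _).injOn)
    intro a ha
    have ha := mem_rk_filter.1 ha
    refine mem_rk_filter.2 ⟨?_, by simpa using ha.2⟩
    by_cases hap : a = p
    · subst hap
      rw [Equiv.swap_apply_left]
      omega
    · by_cases haq : a = q
      · subst haq
        rw [Equiv.swap_apply_right]
        omega
      · rw [Equiv.swap_apply_of_ne_of_ne hap haq]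
        exact ha.1

/-- The closure of a Schubert cell contains every cell which is smaller in the Bruhat order. -/
theorem cell_subset_closure (θ : Equiv.Perm (Fin n)) {D : Finset ℕ} (hD : D ⊆ Finset.Ioo 0 n)
    (w v : Equiv.Perm (Fin n)) (h : ∀ j m, rk (θ * w) j m ≤ rk (θ * v) j m) :
    cell θ hD v ⊆ zariskiClosure (cell θ hD w) := by
  -- Each swap increases the word of θ ∘ v lexicographically, and there are finitely many words.
  induction hx : toLex (fun a : Fin n => θ (v a)) using
    (wellFounded_gt (α := Lex (Fin n → Fin n))).induction generalizing v with
  | _ x ih =>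
  subst hx
  by_cases hvw : θ * v = θ * w
  · rw [mul_left_cancel hvw]
    exact subset_zariskiClosure _
  · obtain ⟨p, q, hpq, hx, h'⟩ := exists_swap_rk_le hvw h
    refine (cell_subset_closure_swap hD v hpq hx).trans (zariskiClosure_subset ?_)
    refine ih _ ?_ (v * Equiv.swap p q) (by rwa [← mul_assoc]) rfl
    refine ⟨p, fun a ha => ?_, ?_⟩
    · have h1 : a ≠ p := ha.ne
      have h2 : a ≠ q := (ha.trans hpq).ne
      simp [Equiv.swap_apply_of_ne_of_ne h1 h2]
    · simpa using hx

theorem rk_succ (x : Equiv.Perm (Fin n)) (a : Fin n) (m : ℕ) :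
    rk x (a + 1) m = rk x a m + if (x a : ℕ) < m then 1 else 0 := by
  classical
  rw [rk, rk]
  split_ifs with h
  · rw [← Finset.card_insert_of_notMem (a := a) (by simp)]
    congr 1
    ext c
    rw [mem_rk_filter, Finset.mem_insert, mem_rk_filter]
    constructor
    · intro hc
      by_cases hca : c = a
      · exact Or.inl hca
      · have := Fin.val_ne_of_ne hca
        exact Or.inr ⟨by omega, hc.2⟩
    · rintro (rfl | hc)
      · exact ⟨by omega, h⟩
      · exact ⟨by omega, hc.2⟩
  · rw [add_zero]
    congr 1
    ext c
    rw [mem_rk_filter, mem_rk_filter]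
    constructor
    · intro hc
      have : (c : ℕ) ≠ a := fun h' => h (by rw [← Fin.ext h']; exact hc.2)
      exact ⟨by omega, hc.2⟩
    · exact fun hc => ⟨by omega, hc.2⟩

theorem rk_zero (x : Equiv.Perm (Fin n)) (m : ℕ) : rk x 0 m = 0 := by simp [rk]

theorem rk_of_le (x : Equiv.Perm (Fin n)) {j : ℕ} (hj : n ≤ j) (m : ℕ) :
    rk x j m = (below (1 : Equiv.Perm (Fin n)) m).card := by
  rw [rk]
  refine Finset.card_bij (fun a _ => x a) ?_ (fun a _ b _ h => x.injective h) ?_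
  · intro a ha
    rw [mem_below]
    exact (mem_rk_filter.1 ha).2
  · intro b hb
    rw [mem_below] at hb
    exact ⟨x.symm b, mem_rk_filter.2 ⟨by omega, by simpa using hb⟩, by simp⟩

/-- On a block of an increasing x the values below m come first. As j runs through the block, the
rank of x grows by one at each step and then stays constant, so the inequality spreads from the ends
of the block. -/
theorem rk_le_of_increasing {x y : Equiv.Perm (Fin n)} {D : Finset ℕ}
    (hx : ∀ a a' : Fin n, (a' : ℕ) = a + 1 → (a' : ℕ) ∉ D → x a < x a')
    (h : ∀ j ∈ D, ∀ m, rk y j m ≤ rk x j m) (j m : ℕ) : rk y j m ≤ rk x j m := by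
  -- If x j < m, the rank of x has grown by one at every step since the block began, and that of y
  -- by at most one.
  have hA : ∀ j, ∀ hj : j < n, (x ⟨j, hj⟩ : ℕ) < m → rk y (j + 1) m ≤ rk x (j + 1) m := by
    intro j
    induction j with
    | zero =>
      intro hj hm
      have h1 := rk_succ x ⟨0, hj⟩ m
      have h2 := rk_succ y ⟨0, hj⟩ m
      simp only [rk_zero, hm, if_true] at h1 h2
      rw [h1, h2]
      split_ifs <;> omega
    | succ j ih =>
      intro hj hm
      have h1 := rk_succ x ⟨j + 1, hj⟩ m
      have h2 := rk_succ y ⟨j + 1, hj⟩ m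
      simp only [hm, if_true] at h1 h2
      have h3 : rk y (j + 1) m ≤ rk x (j + 1) m := by
        by_cases hD : j + 1 ∈ D
        · exact h _ hD m
        · have := Fin.lt_def.1 (hx ⟨j, by omega⟩ ⟨j + 1, hj⟩ rfl hD)
          exact ih (by omega) (by omega)
      rw [h1, h2]
      split_ifs <;> omega
  -- If x j ≥ m, the rank of x stays constant to the end of the block, and that of y cannot
  -- decrease. The number d bounds the distance to n, where both ranks agree.
  have hB : ∀ d j, ∀ hj : j < n, n - j ≤ d → m ≤ (x ⟨j, hj⟩ : ℕ) →
      rk y (j + 1) m ≤ rk x (j + 1) m := by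
    intro d
    induction d with
    | zero => intro j hj hd; omega
    | succ d ih =>
      intro j hj hd hm
      by_cases hD : j + 1 ∈ D
      · exact h _ hD m
      by_cases hjn : j + 1 < n
      · have h1 := Fin.lt_def.1 (hx ⟨j, hj⟩ ⟨j + 1, hjn⟩ rfl hD)
        have h2 := ih (j + 1) hjn (by omega) (by omega)
        have h3 := rk_succ x ⟨j + 1, hjn⟩ m
        have h4 := rk_succ y ⟨j + 1, hjn⟩ m
        rw [if_neg (by omega)] at h3
        simp only at h3 h4
        omega
      · rw [rk_of_le x (by omega), rk_of_le y (by omega)]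
  rcases Nat.eq_zero_or_pos j with rfl | hj
  · rw [rk_zero, rk_zero]
  · by_cases hjn : j - 1 < n
    · by_cases hm : (x ⟨j - 1, hjn⟩ : ℕ) < m
      · simpa [Nat.sub_add_cancel hj] using hA (j - 1) hjn hm
      · simpa [Nat.sub_add_cancel hj] using hB _ (j - 1) hjn le_rfl (not_lt.1 hm)
    · rw [rk_of_le x (by omega), rk_of_le y (by omega)]

theorem exists_bruhat_rk (θ : Equiv.Perm (Fin n)) {D : Finset ℕ} (hD : D ⊆ Finset.Ioo 0 n)
    (w : Equiv.Perm (Fin n)) (hn : 0 < n) (F : PartialFlag n D)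
    (h : ∀ (j : D) (m : ℕ), rk (θ * w) j m ≤
      Module.finrank ℂ (F.space j ⊓ coordSub (below θ m) : Submodule ℂ _)) :
    ∃ (b : Matrix.SpecialLinearGroup (Fin n) ℂ) (v : Equiv.Perm (Fin n)),
      IsTriangular θ b ∧ F = act b (coordFlag hD v) ∧ ∀ j m, rk (θ * w) j m ≤ rk (θ * v) j m := by
  obtain ⟨b, v, hb, rfl, hv⟩ := exists_bruhat θ hD F hn
  refine ⟨b, v, hb, rfl, rk_le_of_increasing (D := D) hv fun j hj m => ?_⟩
  have := h ⟨j, hj⟩ m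
  rwa [finrank_inf_below hD hb] at this

/-- The rank conditions define the closure of a Schubert cell. -/
theorem mem_closure_cell (θ : Equiv.Perm (Fin n)) {D : Finset ℕ} (hD : D ⊆ Finset.Ioo 0 n)
    (w : Equiv.Perm (Fin n)) (hn : 0 < n) (F : PartialFlag n D)
    (h : ∀ (j : D) (m : ℕ), rk (θ * w) j m ≤
      Module.finrank ℂ (F.space j ⊓ coordSub (below θ m) : Submodule ℂ _)) :
    F ∈ zariskiClosure (cell θ hD w) := by
  obtain ⟨b, v, hb, hF, hv⟩ := exists_bruhat_rk θ hD w hn F h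
  exact cell_subset_closure θ hD w v hv ⟨b, hb, hF⟩

/-- The block-increasing representative v satisfies the rank inequalities for all j, so b·v read in
the larger flag variety is a lift inside the closure. Conditions at the indices of D thus suffice
for lifting. -/
theorem exists_lift_mem_closure_cell (θ : Equiv.Perm (Fin n)) {D E : Finset ℕ} (hDE : D ⊆ E)
    (hE : E ⊆ Finset.Ioo 0 n)
    (w : Equiv.Perm (Fin n)) (hn : 0 < n) (F : PartialFlag n D)
    (h : ∀ (j : D) (m : ℕ), rk (θ * w) j m ≤
      Module.finrank ℂ (F.space j ⊓ coordSub (below θ m) : Submodule ℂ _)) :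
    ∃ G ∈ zariskiClosure (cell θ hE w), proj hDE G = F := by
  obtain ⟨b, v, hb, hF, hv⟩ := exists_bruhat_rk θ (hDE.trans hE) w hn F h
  exact ⟨act b (coordFlag hE v), cell_subset_closure θ hE w v hv ⟨b, hb, rfl⟩, hF.symm⟩

end FlagVariety

/-! ### Representing matrices, vanishing minors, and rank conditions as necessary for lying in a
closure. -/

namespace FlagVariety

variable {n : ℕ}

theorem map_plucker {R S : Type*} [CommRing R] [CommRing S] (φ : R →+* S) {m : ℕ}
    (A : Matrix (Fin m) (Fin n) R) (J : Finset (Fin n)) :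
    φ (plucker A J) = plucker (A.map φ) J := by
  unfold plucker
  split_ifs
  · rw [RingHom.map_det]
    rfl
  · exact map_zero φ

theorem algHom_toEntries {S : Type*} [CommRing S] [Algebra ℂ S] {D : Finset ℕ}
    (φ : MvPolynomial (Fin (D.sup id) × Fin n) ℂ →ₐ[ℂ] S) (f : MvPolynomial (Finset (Fin n)) ℂ) :
    φ (toEntries D f) =
      MvPolynomial.aeval (plucker (Matrix.of fun a c => φ (MvPolynomial.X (a, c)))) f := by
  rw [toEntries, ← AlgHom.comp_apply, MvPolynomial.comp_aeval]
  congr 2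
  funext J
  exact map_plucker φ.toRingHom _ J

theorem aeval_toEntries {D : Finset ℕ} (x : Fin (D.sup id) × Fin n → ℂ)
    (f : MvPolynomial (Finset (Fin n)) ℂ) :
    MvPolynomial.aeval x (toEntries D f) =
      MvPolynomial.aeval (plucker (Matrix.of fun a c => x (a, c))) f := by
  rw [algHom_toEntries]
  simp only [MvPolynomial.aeval_X]

theorem sup_lt {D : Finset ℕ} (hD : D ⊆ Finset.Ioo 0 n) (hn : 0 < n) : D.sup id < n :=
  (Finset.sup_lt_iff hn).2 fun _ hj => (Finset.mem_Ioo.1 (hD hj)).2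

theorem represents_act_coordFlag {D : Finset ℕ} (hD : D ⊆ Finset.Ioo 0 n) (hn : 0 < n)
    (b : Matrix.SpecialLinearGroup (Fin n) ℂ) (v : Equiv.Perm (Fin n)) :
    Represents (Matrix.of fun a c => b.1 c (v (Fin.castLE (sup_lt hD hn).le a)))
      (act b (coordFlag hD v)) := by
  set ι := Fin.castLE (sup_lt hD hn).le
  have hrow : (Matrix.of fun a c => b.1 c (v (ι a))).row =
      fun a => (Matrix.SpecialLinearGroup.toLin' b).toLinearMap (Pi.single (v (ι a)) 1) := by
    funext a c
    rw [toLin'_toLinearMap_apply]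
    simp [Matrix.row, Pi.single_apply]
  refine ⟨?_, fun j => ?_⟩
  · rw [hrow]
    have h := (Pi.basisFun ℂ (Fin n)).linearIndependent.comp (v ∘ ι)
      (v.injective.comp (Fin.castLE_injective _))
    have h2 := h.map' (Matrix.SpecialLinearGroup.toLin' b).toLinearMap (LinearEquiv.ker _)
    have e : (fun a => (Matrix.SpecialLinearGroup.toLin' b).toLinearMap
        (Pi.single (v (ι a)) 1)) =
        (Matrix.SpecialLinearGroup.toLin' b).toLinearMap ∘ Pi.basisFun ℂ (Fin n) ∘ v ∘ ι := by
      funext a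
      simp
    rw [e]
    exact h2
  · rw [hrow]
    simp only [act, coordFlag]
    rw [Submodule.map_span, ← Set.image_comp]
    congr 1
    ext z
    constructor
    · rintro ⟨a, ha, rfl⟩
      have hj : (j : ℕ) ≤ D.sup id := Finset.le_sup (f := id) j.2
      exact ⟨⟨a, lt_of_lt_of_le ha hj⟩, ha, rfl⟩
    · rintro ⟨a, ha, rfl⟩
      exact ⟨ι a, ha, rfl⟩

theorem exists_represents {D : Finset ℕ} (hD : D ⊆ Finset.Ioo 0 n) (hn : 0 < n)
    (F : PartialFlag n D) : ∃ A, Represents A F := by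
  obtain ⟨b, v, -, rfl, -⟩ := exists_bruhat 1 hD F hn
  exact ⟨_, represents_act_coordFlag hD hn b v⟩

theorem finrank_add_le_finrank_inf (S T : Submodule ℂ (Fin n → ℂ)) :
    Module.finrank ℂ S + Module.finrank ℂ T ≤ n + Module.finrank ℂ (S ⊓ T : Submodule ℂ _) := by
  have h1 := Submodule.finrank_sup_add_finrank_inf_eq S T
  have h2 := Submodule.finrank_le (S ⊔ T)
  rw [Module.finrank_fin_fun] at h2
  omega

theorem exists_ne_zero_of_finrank_pos {S : Submodule ℂ (Fin n → ℂ)}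
    (h : 0 < Module.finrank ℂ S) : ∃ z ∈ S, z ≠ 0 := by
  obtain ⟨z, hz⟩ := Module.finrank_pos_iff_exists_ne_zero.1 h
  exact ⟨z, z.2, fun h' => hz (Subtype.ext h')⟩

theorem exists_mem_inf_of_card_lt (S : Submodule ℂ (Fin n → ℂ)) (T : Finset (Fin n))
    (h : T.card < Module.finrank ℂ S) : ∃ z ∈ S, z ≠ 0 ∧ ∀ c ∈ T, z c = 0 := by
  have h1 := finrank_add_le_finrank_inf S (coordSub Tᶜ)
  rw [finrank_coordSub, Finset.card_compl, Fintype.card_fin] at h1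
  have h2 : T.card ≤ n := by simpa using T.card_le_univ
  obtain ⟨z, hz, hz0⟩ := exists_ne_zero_of_finrank_pos (S := S ⊓ coordSub Tᶜ) (by omega)
  exact ⟨z, hz.1, hz0, fun c hc => hz.2 c (by simpa using hc)⟩

theorem Represents.plucker_eq_zero_iff {D : Finset ℕ} {F : PartialFlag n D}
    {A : Matrix (Fin (D.sup id)) (Fin n) ℂ} (hA : Represents A F) (j : D)
    {J : Finset (Fin n)} (hJ : J.card = j) :
    plucker A J = 0 ↔ ∃ z ∈ F.space j, z ≠ 0 ∧ ∀ c ∈ J, z c = 0 := by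
  have hj : (j : ℕ) ≤ D.sup id := Finset.le_sup (f := id) j.2
  rw [FlagVariety.plucker_eq_zero_iff hA.1 (hJ.trans_le hj), hA.2 j, hJ]

/-- The J × J block of b is again triangular with nonzero diagonal. The θ-largest coordinate in the
support of y would survive in the image. -/
theorem IsTriangular.eq_zero_of_vanish {θ : Equiv.Perm (Fin n)}
    {b : Matrix.SpecialLinearGroup (Fin n) ℂ} (hb : IsTriangular θ b) {J : Finset (Fin n)}
    {y : Fin n → ℂ} (hy : y ∈ coordSub J)
    (h : ∀ c ∈ J, (Matrix.SpecialLinearGroup.toLin' b).toLinearMap y c = 0) : y = 0 := by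
  by_contra hy0
  have hne : (Finset.univ.filter fun c => y c ≠ 0).Nonempty := by
    obtain ⟨c, hc⟩ := Function.ne_iff.1 hy0
    exact ⟨c, by simpa using hc⟩
  obtain ⟨c, hc, hmax⟩ := Finset.exists_max_image _ θ hne
  have hc : y c ≠ 0 := by simpa using hc
  have hcJ : c ∈ J := by
    by_contra hcJ
    exact hc (hy c hcJ)
  have h1 := h c hcJ
  rw [toLin'_toLinearMap_apply, Finset.sum_eq_single c] at h1
  · exact (mul_ne_zero (hb.diag_ne_zero c) hc) h1
  · intro d _ hd
    by_cases hyd : y d = 0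
    · rw [hyd, mul_zero]
    · have h2 := hmax d (by simpa using hyd)
      rw [hb c d (lt_of_le_of_ne h2 fun h' => hd (θ.injective h')), zero_mul]
  · simp

theorem toEntries_X_mem_matrixIdeal {D : Finset ℕ} {Z : Set (PartialFlag n D)} (j : D)
    {J : Finset (Fin n)} (hJ : J.card = j)
    (h : ∀ F ∈ Z, ∃ z ∈ F.space j, z ≠ 0 ∧ ∀ c ∈ J, z c = 0) :
    toEntries D (MvPolynomial.X J) ∈ matrixIdeal Z := by
  rintro x ⟨F, hF, hx⟩
  rw [aeval_toEntries, MvPolynomial.aeval_X, hx.plucker_eq_zero_iff j hJ]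
  exact h F hF

theorem exists_of_mem_zariskiClosure {D : Finset ℕ} (hD : D ⊆ Finset.Ioo 0 n) (hn : 0 < n)
    {Z : Set (PartialFlag n D)} (j : D) {J : Finset (Fin n)} (hJ : J.card = j)
    (h : ∀ F ∈ Z, ∃ z ∈ F.space j, z ≠ 0 ∧ ∀ c ∈ J, z c = 0) {F : PartialFlag n D}
    (hF : F ∈ zariskiClosure Z) : ∃ z ∈ F.space j, z ≠ 0 ∧ ∀ c ∈ J, z c = 0 := by
  obtain ⟨A, hA⟩ := exists_represents hD hn F
  have hx : (fun s => A s.1 s.2) ∈ reps {F} := mem_reps_singleton.2 hA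
  have h0 := MvPolynomial.mem_zeroLocus_iff.1 (hF hx) _ (toEntries_X_mem_matrixIdeal j hJ h)
  rw [aeval_toEntries, MvPolynomial.aeval_X] at h0
  exact ((mem_reps_singleton.1 hx).plucker_eq_zero_iff j hJ).1 h0

/-- The closure of a Schubert cell satisfies the rank conditions. -/
theorem rk_le_of_mem_closure {θ : Equiv.Perm (Fin n)} {D : Finset ℕ} {hD : D ⊆ Finset.Ioo 0 n}
    {w : Equiv.Perm (Fin n)} (hn : 0 < n) {F : PartialFlag n D}
    (hF : F ∈ zariskiClosure (cell θ hD w)) (j : D) (m : ℕ) :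
    rk (θ * w) j m ≤
      Module.finrank ℂ (F.space j ⊓ coordSub (below θ m) : Submodule ℂ _) := by
  obtain ⟨b, v, hb, rfl, -⟩ := exists_bruhat θ hD F hn
  rw [finrank_inf_below hD hb]
  by_contra hlt
  have hj := Finset.mem_Ioo.1 (hD j.2)
  -- The test minor has columns v(p), p < j. It is nonzero at b·v, but if the rank of v is too small
  -- at (j, m), a dimension count inside F_j ∩ E_m makes it vanish on the whole cell of w.
  have hJ : (below v⁻¹ (j : ℕ)).card = j := card_below _ hj.2.le
  obtain ⟨z, hz, hz0, hzJ⟩ := exists_of_mem_zariskiClosure hD hn j hJ (by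
    rintro _ ⟨c, hc, rfl⟩
    obtain ⟨z, hz, hz0, hzJ⟩ := exists_mem_inf_of_card_lt
      ((act c (coordFlag hD w)).space j ⊓ coordSub (below θ m)) (below v⁻¹ (j : ℕ) ∩ below θ m)
      (by rw [finrank_inf_below hD hc, card_inter_below]; exact not_le.1 hlt)
    refine ⟨z, hz.1, hz0, fun d hd => ?_⟩
    by_cases hdm : d ∈ below θ m
    · exact hzJ d (Finset.mem_inter.2 ⟨hd, hdm⟩)
    · exact hz.2 d hdm) hF
  simp only [act] at hz
  rw [coordFlag_space] at hz
  obtain ⟨y, hy, rfl⟩ := hz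
  exact hz0 (by rw [hb.eq_zero_of_vanish hy hzJ, map_zero])

end FlagVariety

/-! ### Longest elements and the rank functions of the permutations that occur. -/

namespace FlagVariety

variable {n : ℕ}

/-- Applying the transposition to both members of a pair sends inversions of u injectively to
inversions of the product other than (p, q), and (p, q) is a new one. -/
theorem length_lt_mul_swap {u : Equiv.Perm (Fin n)} {p q : Fin n} (hpq : (q : ℕ) = p + 1)
    (h : u p < u q) : length u < length (u * Equiv.swap p q) := by
  classical
  have hlt : p < q := Fin.lt_def.2 (by omega)
  have hsw : ∀ a b : Fin n, a < b → ¬ (a = p ∧ b = q) → Equiv.swap p q a < Equiv.swap p q b := by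
    intro a b hab hne
    have hab' := Fin.lt_def.1 hab
    rw [Fin.lt_def]
    rw [Fin.ext_iff, Fin.ext_iff] at hne
    simp only [Equiv.swap_apply_def, Fin.ext_iff]
    split_ifs <;> omega
  have hmem : (p, q) ∈ Finset.univ.filter fun x : Fin n × Fin n =>
      x.1 < x.2 ∧ (u * Equiv.swap p q) x.2 < (u * Equiv.swap p q) x.1 := by
    refine Finset.mem_filter.2 ⟨Finset.mem_univ _, hlt, ?_⟩
    simpa using h
  refine lt_of_le_of_lt (Finset.card_le_card_of_injOn
    (fun x : Fin n × Fin n => (Equiv.swap p q x.1, Equiv.swap p q x.2)) ?_ ?_)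
    (Finset.card_erase_lt_of_mem hmem)
  · rintro ⟨a, b⟩ hab
    have hab : a < b ∧ u b < u a := by simpa using hab
    have hne : ¬ (a = p ∧ b = q) := by
      rintro ⟨rfl, rfl⟩
      exact lt_asymm h hab.2
    have h1 := hsw a b hab.1 hne
    refine Finset.mem_coe.2 (Finset.mem_erase.2 ⟨fun h' => ?_, ?_⟩)
    · rw [Prod.mk.injEq, Equiv.swap_apply_eq_iff, Equiv.swap_apply_eq_iff,
        Equiv.swap_apply_left, Equiv.swap_apply_right] at h'
      have h1 : a = q := h'.1
      have h2 : b = p := h'.2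
      rw [h1, h2] at hab
      exact lt_asymm hlt hab.1
    · refine Finset.mem_filter.2 ⟨Finset.mem_univ _, h1, ?_⟩
      simpa using hab.2
  · rintro ⟨a, b⟩ - ⟨c, d⟩ - h'
    simpa using h'

theorem longestElement_mem (H : Subgroup (Equiv.Perm (Fin n))) : longestElement H ∈ H :=
  (Finite.exists_max fun u : H => length (u : Equiv.Perm (Fin n))).choose.2

theorem length_le_longestElement {H : Subgroup (Equiv.Perm (Fin n))} {u : Equiv.Perm (Fin n)}
    (hu : u ∈ H) : length u ≤ length (longestElement H) :=
  (Finite.exists_max fun u : H => length (u : Equiv.Perm (Fin n))).choose_spec ⟨u, hu⟩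

theorem longestElement_lt {H : Subgroup (Equiv.Perm (Fin n))} {p q : Fin n}
    (hpq : (q : ℕ) = p + 1) (h : Equiv.swap p q ∈ H) : longestElement H q < longestElement H p := by
  by_contra hle
  have hne : longestElement H p ≠ longestElement H q := fun h' => by
    have := (longestElement H).injective h'
    rw [this] at hpq
    omega
  have h1 := length_lt_mul_swap hpq (lt_of_le_of_ne (not_lt.1 hle) hne)
  exact absurd (length_le_longestElement (H.mul_mem (longestElement_mem H) h)) (not_le.2 h1)

/-- Descending steps from the left end bound x from above, ascending steps from the right end bound
it from below, and the two bounds coincide. -/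
theorem eq_of_decreasing {x : Equiv.Perm (Fin n)} {a b : ℕ} (hb : b ≤ n)
    (hmap : ∀ p : Fin n, a ≤ p → (p : ℕ) < b → a ≤ x p ∧ (x p : ℕ) < b)
    (hdec : ∀ p q : Fin n, a ≤ p → (q : ℕ) < b → (q : ℕ) = p + 1 → x q < x p) (p : Fin n)
    (hap : a ≤ p) (hpb : (p : ℕ) < b) : (x p : ℕ) = a + b - 1 - p := by
  have h1 : ∀ d, ∀ h : a + d < n, a + d < b → (x ⟨a + d, h⟩ : ℕ) + d < b := by
    intro d
    induction d with
    | zero => intro h hd; simpa using (hmap ⟨a, h⟩ le_rfl hd).2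
    | succ d ih =>
      intro h hd
      have h2 := ih (by omega) (by omega)
      have h3 := Fin.lt_def.1 (hdec ⟨a + d, by omega⟩ ⟨a + (d + 1), h⟩ (by simp) hd
        (by simp only; omega))
      omega
  have h2 : ∀ d, ∀ h : b - 1 - d < n, a ≤ b - 1 - d → d < b → a + d ≤ x ⟨b - 1 - d, h⟩ := by
    intro d
    induction d with
    | zero => intro h hd hdb; simpa using (hmap ⟨b - 1 - 0, h⟩ hd (by simp only; omega)).1
    | succ d ih =>
      intro h hd hdb
      have h2 := ih (by omega) (by omega) (by omega)
      have h3 := Fin.lt_def.1 (hdec ⟨b - 1 - (d + 1), h⟩ ⟨b - 1 - d, by omega⟩ hd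
        (by simp only; omega) (by simp only; omega))
      omega
  have h3 := h1 (p - a) (by omega) (by omega)
  have h4 := h2 (b - 1 - p) (by omega) (by omega) (by omega)
  have e1 : (⟨a + (p - a), by omega⟩ : Fin n) = p := Fin.ext (by simp only; omega)
  have e2 : (⟨b - 1 - (b - 1 - p), by omega⟩ : Fin n) = p := Fin.ext (by simp only; omega)
  rw [e1] at h3
  rw [e2] at h4
  omega

theorem longestW_eq (n : ℕ) : longestW n = Fin.revPerm := by
  refine Equiv.ext fun p => Fin.ext ?_
  rw [Fin.revPerm_apply, Fin.val_rev, longestW,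
    eq_of_decreasing le_rfl (a := 0) (fun p _ _ => ⟨by omega, Fin.is_lt _⟩)
      (fun p q _ _ hpq => longestElement_lt hpq (Subgroup.mem_top _)) p (by omega) p.2]
  omega

theorem simpleTransposition_eq {p q : Fin n} (hpq : (q : ℕ) = p + 1) :
    simpleTransposition n q = Equiv.swap p q := by
  rw [simpleTransposition, dif_pos ⟨by omega, q.2⟩]
  congr 1
  exact Fin.ext (by simp only; omega)

theorem simpleTransposition_lt_iff {i j : ℕ} (hij : i ≠ j) (p : Fin n) :
    (simpleTransposition n i p : ℕ) < j ↔ (p : ℕ) < j := by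
  rw [simpleTransposition]
  split_ifs with h
  · simp only [Equiv.swap_apply_def, Fin.ext_iff]
    split_ifs <;> simp only <;> omega
  · rfl

/-- Each generator s_i with i ≠ j preserves the first j positions. Hence multiplication by w_P on
the right does not affect ranks at the indices of D. -/
theorem lt_iff_of_mem_parabolicSubgroup {D : Finset ℕ} {u : Equiv.Perm (Fin n)}
    (hu : u ∈ parabolicSubgroup n D) {j : ℕ} (hj : j ∈ D) (p : Fin n) :
    (u p : ℕ) < j ↔ (p : ℕ) < j := by
  induction hu using Subgroup.closure_induction generalizing p with
  | mem x hx =>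
    obtain ⟨i, hi, rfl⟩ := hx
    exact simpleTransposition_lt_iff (by rintro rfl; exact hi.2.2 hj) p
  | one => rfl
  | mul x y _ _ hx hy => rw [Equiv.Perm.mul_apply, hx, hy]
  | inv x _ hx =>
    rw [← hx (x⁻¹ p)]
    simp

theorem longestWP_lt_iff {D : Finset ℕ} {j : ℕ} (hj : j ∈ D ∨ j = 0 ∨ j = n) (p : Fin n) :
    (longestWP n D p : ℕ) < j ↔ (p : ℕ) < j := by
  rcases hj with hj | rfl | rfl
  · exact lt_iff_of_mem_parabolicSubgroup (longestElement_mem _) hj p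
  · simp
  · simp

theorem longestWP_apply {D : Finset ℕ} {a b : ℕ} (ha : a ∈ D ∨ a = 0 ∨ a = n)
    (hb : b ∈ D ∨ b = 0 ∨ b = n) (hbn : b ≤ n)
    (hab : ∀ c ∈ D, c ≤ a ∨ b ≤ c) (p : Fin n) (hap : a ≤ p) (hpb : (p : ℕ) < b) :
    (longestWP n D p : ℕ) = a + b - 1 - p := by
  refine eq_of_decreasing hbn (fun p h1 h2 => ⟨?_, ?_⟩) (fun p q h1 h2 hpq => ?_) p hap hpb
  · by_contra hlt
    have := (longestWP_lt_iff ha p).1 (not_le.1 hlt)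
    omega
  · exact (longestWP_lt_iff hb p).2 h2
  · refine longestElement_lt hpq (Subgroup.subset_closure ⟨q, ⟨by omega, q.2, fun hq => ?_⟩, ?_⟩)
    · have := hab _ hq
      omega
    · exact simpleTransposition_eq hpq

theorem rk_mul_of_lt_iff (x y : Equiv.Perm (Fin n)) {j : ℕ}
    (h : ∀ p, (y p : ℕ) < j ↔ (p : ℕ) < j) (m : ℕ) : rk (x * y) j m = rk x j m := by
  rw [rk, rk]
  refine Finset.card_bij (fun p _ => y p) ?_ (fun a _ b _ h => y.injective h) ?_
  · intro p hp
    have hp := mem_rk_filter.1 hp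
    exact mem_rk_filter.2 ⟨(h p).2 hp.1, hp.2⟩
  · intro q hq
    have hq := mem_rk_filter.1 hq
    refine ⟨y.symm q, mem_rk_filter.2 ⟨?_, by simpa using hq.2⟩, by simp⟩
    rw [← h, Equiv.apply_symm_apply]
    exact hq.1

theorem card_filter_le_of_Ico (P : Fin n → Prop) [DecidablePred P] (lo hi : ℕ)
    (h : ∀ p, P p → lo ≤ p ∧ (p : ℕ) < hi) : (Finset.univ.filter P).card ≤ hi - lo := by
  rw [← Nat.card_Ico]
  refine Finset.card_le_card_of_injOn (fun p : Fin n => (p : ℕ)) ?_ Fin.val_injective.injOn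
  intro p hp
  have := h p (by simpa using hp)
  simpa using this

theorem rk_rev_le (j m : ℕ) : rk (Fin.revPerm : Equiv.Perm (Fin n)) j m ≤ j - (n - m) := by
  rw [rk]
  refine card_filter_le_of_Ico _ (n - m) j fun p hp => ?_
  rw [Fin.revPerm_apply, Fin.val_rev] at hp
  omega

/-- This exceeds the bound max(0, i - (n - m)) valid for every flag only at m = n - i, where it is 1
instead of 0. So X_{s_i} is governed by one incidence condition. -/
theorem rk_rev_mul_simpleTransposition_le {i : ℕ} (hi : 0 < i) (hin : i < n) (m : ℕ) :
    rk (Fin.revPerm * simpleTransposition n i) i m ≤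
      (i - 1 - (n - m)) + if n - i ≤ m then 1 else 0 := by
  have hs := simpleTransposition_eq (n := n) (p := ⟨i - 1, by omega⟩) (q := ⟨i, hin⟩)
    (by simp only; omega)
  have h1 := rk_succ (Fin.revPerm * simpleTransposition n i) ⟨i - 1, by omega⟩ m
  have e1 : i - 1 + 1 = i := by omega
  simp only [e1] at h1
  rw [h1, rk_mul_of_lt_iff _ _ (fun p => simpleTransposition_lt_iff (by omega) p)]
  have h2 := rk_rev_le (n := n) (i - 1) m
  simp only at hs
  rw [Equiv.Perm.mul_apply, hs, Equiv.swap_apply_left, Fin.revPerm_apply, Fin.val_rev]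
  simp only
  split_ifs <;> omega

theorem one_le_rk_rev_mul_simpleTransposition {i : ℕ} (hi : 0 < i) (hin : i < n) :
    1 ≤ rk (Fin.revPerm * simpleTransposition n i) i (n - i) := by
  have hs := simpleTransposition_eq (n := n) (p := ⟨i - 1, by omega⟩) (q := ⟨i, hin⟩)
    (by simp only; omega)
  simp only at hs
  rw [rk, Nat.one_le_iff_ne_zero, Finset.card_ne_zero]
  refine ⟨⟨i - 1, by omega⟩, mem_rk_filter.2 ⟨by simp only; omega, ?_⟩⟩
  rw [Equiv.Perm.mul_apply, hs, Equiv.swap_apply_left, Fin.revPerm_apply, Fin.val_rev]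
  simp only
  omega

/-- On the block [a, b) the permutation w₀w_P is p ↦ n - a - b + p. The first summand bounds the
count over positions before a, the second over those in [a, i). -/
theorem rk_rev_mul_longestWP_le {D : Finset ℕ} {a b i : ℕ} (ha : a ∈ D ∨ a = 0 ∨ a = n)
    (hb : b ∈ D ∨ b = 0 ∨ b = n) (hbn : b ≤ n) (hab : ∀ c ∈ D, c ≤ a ∨ b ≤ c)
    (hib : i < b) (m : ℕ) :
    rk (Fin.revPerm * longestWP n D) i m ≤ (a - (n - m)) + (min i (m + a + b - n) - a) := by
  have h1 : rk (Fin.revPerm * longestWP n D) i m ≤ rk (Fin.revPerm * longestWP n D) a m +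
      (Finset.univ.filter fun p : Fin n => a ≤ p ∧ (p : ℕ) < i ∧
        ((Fin.revPerm * longestWP n D : Equiv.Perm (Fin n)) p : ℕ) < m).card := by
    refine (Finset.card_le_card ?_).trans (Finset.card_union_le _ _)
    intro p hp
    have hp := mem_rk_filter.1 hp
    rw [Finset.mem_union, mem_rk_filter, Finset.mem_filter]
    by_cases hpa : (p : ℕ) < a
    · exact Or.inl ⟨hpa, hp.2⟩
    · exact Or.inr ⟨Finset.mem_univ _, not_lt.1 hpa, hp⟩
  rw [rk_mul_of_lt_iff _ _ (longestWP_lt_iff ha)] at h1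
  have h2 := rk_rev_le (n := n) a m
  have h3 := card_filter_le_of_Ico (fun p : Fin n => a ≤ p ∧ (p : ℕ) < i ∧
        ((Fin.revPerm * longestWP n D : Equiv.Perm (Fin n)) p : ℕ) < m) a (min i (m + a + b - n)) fun p hp => by
    rw [Equiv.Perm.mul_apply, Fin.revPerm_apply, Fin.val_rev,
      longestWP_apply ha hb hbn hab p hp.1 (by omega)] at hp
    omega
  omega

/-- With this many coordinates every position in [a, i) is counted; this is the essential rank
condition on the i-th space. -/
theorem le_rk_rev_mul_longestWP {D : Finset ℕ} {a b i : ℕ} (ha : a ∈ D ∨ a = 0 ∨ a = n)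
    (hb : b ∈ D ∨ b = 0 ∨ b = n) (hbn : b ≤ n) (hab : ∀ c ∈ D, c ≤ a ∨ b ≤ c)
    (hib : i < b) : i - a ≤ rk (Fin.revPerm * longestWP n D) i (n - b + (i - a)) := by
  rw [rk]
  refine (Nat.card_Ico a i).ge.trans (Finset.card_le_card_of_injOn
    (fun p => if h : p < n then ⟨p, h⟩ else ⟨0, by omega⟩) ?_ ?_)
  · intro p hp
    have hp := Finset.mem_Ico.1 (Finset.mem_coe.1 hp)
    have hpn : p < n := by omega
    simp only [hpn, dif_pos]
    refine Finset.mem_coe.2 (mem_rk_filter.2 ⟨hp.2, ?_⟩)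
    rw [Equiv.Perm.mul_apply, Fin.revPerm_apply, Fin.val_rev,
      longestWP_apply ha hb hbn hab ⟨p, hpn⟩ hp.1 (by simp only; omega)]
    simp only
    omega
  · intro p hp q hq h
    have hp := Finset.mem_Ico.1 (Finset.mem_coe.1 hp)
    have hq := Finset.mem_Ico.1 (Finset.mem_coe.1 hq)
    have hpn : p < n := by omega
    have hqn : q < n := by omega
    simpa [hpn, hqn] using h

theorem sub_le_finrank_inf_below (θ : Equiv.Perm (Fin n)) (G : Submodule ℂ (Fin n → ℂ)) (m : ℕ) :
    Module.finrank ℂ G - (n - m) ≤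
      Module.finrank ℂ (G ⊓ coordSub (below θ m) : Submodule ℂ _) := by
  by_cases hm : m ≤ n
  · have h := finrank_add_le_finrank_inf G (coordSub (below θ m))
    rw [finrank_coordSub, card_below θ hm] at h
    omega
  · have : G ⊓ coordSub (below θ m) = G := by
      refine inf_eq_left.2 fun z _ c hc => ?_
      exact absurd (mem_below.2 (lt_trans (θ c).2 (not_le.1 hm))) hc
    rw [this]
    omega

theorem below_mono (θ : Equiv.Perm (Fin n)) {m m' : ℕ} (h : m ≤ m') : below θ m ⊆ below θ m' := by
  intro c hc
  rw [mem_below] at hc ⊢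
  omega

theorem finrank_inf_below_mono (θ : Equiv.Perm (Fin n)) (G : Submodule ℂ (Fin n → ℂ)) {m m' : ℕ}
    (h : m ≤ m') : Module.finrank ℂ (G ⊓ coordSub (below θ m) : Submodule ℂ _) ≤
      Module.finrank ℂ (G ⊓ coordSub (below θ m') : Submodule ℂ _) :=
  Submodule.finrank_mono (inf_le_inf_left _ (coordSub_mono (below_mono θ h)))

theorem finrank_inf_below_le_add (θ : Equiv.Perm (Fin n)) (G : Submodule ℂ (Fin n → ℂ))
    {m m' : ℕ} (h : m ≤ m') (hm' : m' ≤ n) :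
    Module.finrank ℂ (G ⊓ coordSub (below θ m') : Submodule ℂ _) ≤
      Module.finrank ℂ (G ⊓ coordSub (below θ m) : Submodule ℂ _) + (m' - m) := by
  have h1 := finrank_add_le_finrank_inf (G ⊓ coordSub (below θ m'))
    (coordSub (below θ m' \ below θ m)ᶜ)
  rw [finrank_coordSub, Finset.card_compl, Finset.card_sdiff_of_subset (below_mono θ h),
    card_below θ hm', card_below θ (h.trans hm'), Fintype.card_fin] at h1
  have h2 : G ⊓ coordSub (below θ m') ⊓ coordSub (below θ m' \ below θ m)ᶜ ≤
      G ⊓ coordSub (below θ m) := by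
    rintro z ⟨⟨hz, hz1⟩, hz2⟩
    refine ⟨hz, fun c hc => ?_⟩
    by_cases hc' : c ∈ below θ m'
    · exact hz2 c (by simp [hc, hc'])
    · exact hz1 c hc'
  have h3 := Submodule.finrank_mono h2
  omega

end FlagVariety

/-! ### Projected Richardson varieties as incidence conditions. -/

namespace FlagVariety

variable {n : ℕ}

theorem finrank_span_singleton_le (y : Fin n → ℂ) :
    Module.finrank ℂ (Submodule.span ℂ {y}) ≤ 1 := by
  have h := finrank_span_finset_le_card (R := ℂ) ({y} : Finset (Fin n → ℂ))
  rwa [Finset.coe_singleton, Finset.card_singleton] at h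

theorem exists_between_finrank {S T : Submodule ℂ (Fin n → ℂ)} (hST : S ≤ T) {k : ℕ}
    (hS : Module.finrank ℂ S ≤ k) (hT : k ≤ Module.finrank ℂ T) :
    ∃ U, S ≤ U ∧ U ≤ T ∧ Module.finrank ℂ U = k := by
  induction hd : k - Module.finrank ℂ S generalizing S with
  | zero => exact ⟨S, le_rfl, hST, by omega⟩
  | succ d ih =>
    have hne : ¬ T ≤ S := fun h => by
      have := Submodule.finrank_mono h
      omega
    obtain ⟨v, hvT, hvS⟩ := Set.not_subset.1 hne
    have h1 := Submodule.finrank_sup_span_singleton (K := ℂ) hvS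
    obtain ⟨U, hU, hUT, hUk⟩ := ih (S := S ⊔ Submodule.span ℂ {v})
      (sup_le hST ((Submodule.span_singleton_le_iff_mem _ _).2 hvT)) (by omega) (by omega)
    exact ⟨U, le_sup_left.trans hU, hUT, hUk⟩

/-- The rank conditions for the Schubert divisors. -/
theorem rk_divisor_le {θ x : Equiv.Perm (Fin n)} {D : Finset ℕ} {i : ℕ} (hi : 0 < i) (hin : i < n)
    (hx : ∀ j ∈ D, ∀ m, rk x j m = rk (Fin.revPerm * simpleTransposition n i) j m)
    {F : PartialFlag n D}
    (h : ∀ hiD : i ∈ D, ∃ z ∈ F.space ⟨i, hiD⟩, z ≠ 0 ∧ z ∈ coordSub (below θ (n - i)))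
    (j : D) (m : ℕ) :
    rk x j m ≤ Module.finrank ℂ (F.space j ⊓ coordSub (below θ m) : Submodule ℂ _) := by
  have h1 := sub_le_finrank_inf_below θ (F.space j) m
  rw [F.finrank_space] at h1
  rw [hx j j.2]
  obtain ⟨j, hj⟩ := j
  by_cases hij : i = j
  · subst hij
    simp only at h1 ⊢
    have h2 := rk_rev_mul_simpleTransposition_le hi hin m
    split_ifs at h2 with hm
    · obtain ⟨z, hz, hz0, hzE⟩ := h hj
      have h3 := finrank_inf_below_mono θ (F.space ⟨i, hj⟩) hm
      have h4 : 0 < Module.finrank ℂ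
          (F.space ⟨i, hj⟩ ⊓ coordSub (below θ (n - i)) : Submodule ℂ _) :=
        Module.finrank_pos_iff_exists_ne_zero.2
          ⟨⟨z, hz, hzE⟩, fun h' => hz0 (congrArg Subtype.val h')⟩
      omega
    · omega
  · rw [rk_mul_of_lt_iff _ _ fun p => simpleTransposition_lt_iff hij p]
    exact (rk_rev_le _ _).trans h1

theorem mem_closure_divisor_iff {θ w : Equiv.Perm (Fin n)} {D : Finset ℕ}
    (hD : D ⊆ Finset.Ioo 0 n) {i : ℕ} (hi : i ∈ D)
    (hw : ∀ j ∈ D, ∀ m, rk (θ * w) j m = rk (Fin.revPerm * simpleTransposition n i) j m)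
    {F : PartialFlag n D} :
    F ∈ zariskiClosure (cell θ hD w) ↔
      ∃ z ∈ F.space ⟨i, hi⟩, z ≠ 0 ∧ z ∈ coordSub (below θ (n - i)) := by
  have hin := Finset.mem_Ioo.1 (hD hi)
  have hn : 0 < n := hin.1.trans hin.2
  constructor
  · intro hF
    have h1 := rk_le_of_mem_closure hn hF ⟨i, hi⟩ (n - i)
    rw [hw _ hi] at h1
    obtain ⟨z, hz, hz0⟩ := exists_ne_zero_of_finrank_pos
      (lt_of_lt_of_le (one_le_rk_rev_mul_simpleTransposition hin.1 hin.2) h1)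
    exact ⟨z, hz.1, hz0, hz.2⟩
  · intro h
    exact mem_closure_cell θ hD w hn F (rk_divisor_le hin.1 hin.2 hw fun _ => h)

theorem rk_rev_mul_longestWP_mul {D : Finset ℕ} (x : Equiv.Perm (Fin n)) {j : ℕ} (hj : j ∈ D)
    (m : ℕ) : rk (x * longestWP n D) j m = rk x j m :=
  rk_mul_of_lt_iff _ _ (longestWP_lt_iff (Or.inl hj)) m

theorem mem_oppositeSchubertVariety_one {D : Finset ℕ} (hD : D ⊆ Finset.Ioo 0 n) (hn : 0 < n)
    (F : PartialFlag n D) : F ∈ oppositeSchubertVariety hD 1 := by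
  rw [oppositeSchubertVariety, oppositeSchubertCell_eq]
  refine mem_closure_cell _ hD 1 hn F fun j m => ?_
  have h1 := sub_le_finrank_inf_below Fin.revPerm (F.space j) m
  rw [F.finrank_space] at h1
  rw [mul_one]
  exact (rk_rev_le _ _).trans h1

theorem mem_oppositeSchubertVariety_simpleTransposition_iff {D : Finset ℕ}
    (hD : D ⊆ Finset.Ioo 0 n) {i : ℕ} (hi : i ∈ D) {F : PartialFlag n D} :
    F ∈ oppositeSchubertVariety hD (simpleTransposition n i) ↔
      ∃ z ∈ F.space ⟨i, hi⟩, z ≠ 0 ∧ z ∈ coordSub (below Fin.revPerm (n - i)) := by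
  rw [oppositeSchubertVariety, oppositeSchubertCell_eq]
  exact mem_closure_divisor_iff hD hi fun _ _ _ => rfl

theorem mem_schubertVariety_divisor_iff {D : Finset ℕ} (hD : D ⊆ Finset.Ioo 0 n) {i : ℕ}
    (hi : i ∈ D) {F : PartialFlag n D} :
    F ∈ schubertVariety hD (longestW n * simpleTransposition n i * longestWP n D) ↔
      ∃ z ∈ F.space ⟨i, hi⟩, z ≠ 0 ∧ z ∈ coordSub (below 1 (n - i)) := by
  rw [schubertVariety, schubertCell_eq]
  refine mem_closure_divisor_iff hD hi fun j hj m => ?_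
  rw [one_mul, longestW_eq, rk_rev_mul_longestWP_mul _ hj]

theorem mem_projRichardson_schubert_divisor_iff {D : Finset ℕ} (hD : D ⊆ Finset.Ioo 0 n) {i : ℕ}
    (hi : i ∈ D) {F : PartialFlag n D} :
    F ∈ projRichardson hD 1 (longestW n * simpleTransposition n i * longestWP n D) ↔
      ∃ z ∈ F.space ⟨i, hi⟩, z ≠ 0 ∧ z ∈ coordSub (below 1 (n - i)) := by
  have hin := Finset.mem_Ioo.1 (hD hi)
  have hn : 0 < n := hin.1.trans hin.2
  constructor
  · rintro ⟨G, ⟨-, hG⟩, rfl⟩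
    rw [schubertVariety, schubertCell_eq] at hG
    have h1 := rk_le_of_mem_closure hn hG ⟨i, hD hi⟩ (n - i)
    rw [one_mul, longestW_eq, rk_rev_mul_longestWP_mul _ hi] at h1
    obtain ⟨z, hz, hz0⟩ := exists_ne_zero_of_finrank_pos
      (lt_of_lt_of_le (one_le_rk_rev_mul_simpleTransposition hin.1 hin.2) h1)
    exact ⟨z, hz.1, hz0, hz.2⟩
  · intro h
    obtain ⟨G, hG, rfl⟩ := exists_lift_mem_closure_cell 1 hD (Finset.Subset.refl _)
      (longestW n * simpleTransposition n i * longestWP n D) hn F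
      (rk_divisor_le hin.1 hin.2 (fun j hj m => by
        rw [one_mul, longestW_eq, rk_rev_mul_longestWP_mul _ hj]) fun _ => h)
    exact ⟨G, ⟨mem_oppositeSchubertVariety_one _ hn G, hG⟩, rfl⟩

/-- The required rank never exceeds what the codimension of E_m guarantees, so X^{w₀w_P} imposes
nothing on the spaces indexed by D. -/
theorem rk_longest_le {D : Finset ℕ} (F : PartialFlag n D) (j : D) (m : ℕ) :
    rk (1 * (longestW n * longestWP n D)) j m ≤
      Module.finrank ℂ (F.space j ⊓ coordSub (below 1 m) : Submodule ℂ _) := by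
  have h1 := sub_le_finrank_inf_below 1 (F.space j) m
  rw [F.finrank_space] at h1
  rw [one_mul, longestW_eq, rk_rev_mul_longestWP_mul _ j.2]
  exact (rk_rev_le _ _).trans h1

theorem mem_projRichardson_opposite_divisor_iff {D : Finset ℕ} (hD : D ⊆ Finset.Ioo 0 n) {i : ℕ}
    (hi : i ∈ D) {F : PartialFlag n D} :
    F ∈ projRichardson hD (simpleTransposition n i) (longestW n * longestWP n D) ↔
      ∃ z ∈ F.space ⟨i, hi⟩, z ≠ 0 ∧ z ∈ coordSub (below Fin.revPerm (n - i)) := by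
  have hin := Finset.mem_Ioo.1 (hD hi)
  have hn : 0 < n := hin.1.trans hin.2
  constructor
  · rintro ⟨G, ⟨hG, -⟩, rfl⟩
    exact (mem_oppositeSchubertVariety_simpleTransposition_iff _ (hD hi)).1 hG
  · intro h
    obtain ⟨G, hG, rfl⟩ := exists_lift_mem_closure_cell 1 hD (Finset.Subset.refl _)
      (longestW n * longestWP n D) hn F (rk_longest_le F)
    exact ⟨G, ⟨(mem_oppositeSchubertVariety_simpleTransposition_iff _ (hD hi)).2 h, hG⟩, rfl⟩

/-- The flag obtained by inserting a subspace of dimension `i`. -/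
def PartialFlag.insert {D : Finset ℕ} (F : PartialFlag n D) {i : ℕ} (hi : i ∉ D)
    (S : Submodule ℂ (Fin n → ℂ)) (hS : Module.finrank ℂ S = i)
    (hlt : ∀ j : D, (j : ℕ) < i → F.space j ≤ S) (hgt : ∀ j : D, i < (j : ℕ) → S ≤ F.space j) :
    PartialFlag n (Insert.insert i D) where
  space j := if h : (j : ℕ) ∈ D then F.space ⟨j, h⟩ else S
  finrank_space j := by
    by_cases h : (j : ℕ) ∈ D
    · exact (congrArg (fun T : Submodule ℂ (Fin n → ℂ) => Module.finrank ℂ T)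
        (dif_pos h)).trans (F.finrank_space ⟨j, h⟩)
    · exact (congrArg (fun T : Submodule ℂ (Fin n → ℂ) => Module.finrank ℂ T)
        (dif_neg h)).trans (hS.trans ((Finset.mem_insert.1 j.2).resolve_right h).symm)
  mono j k hjk := by
    by_cases hj : (j : ℕ) ∈ D <;> by_cases hk : (k : ℕ) ∈ D
    · simp only [hj, hk, dif_pos]
      exact F.mono ⟨j, hj⟩ ⟨k, hk⟩ hjk
    · simp only [hj, hk, dif_pos, dif_neg, not_false_eq_true]
      have hki := (Finset.mem_insert.1 k.2).resolve_right hk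
      have hne : (j : ℕ) ≠ i := fun h => hi (h ▸ hj)
      exact hlt ⟨j, hj⟩ (by simp only; omega)
    · simp only [hj, hk, dif_pos, dif_neg, not_false_eq_true]
      have hji := (Finset.mem_insert.1 j.2).resolve_right hj
      have hne : (k : ℕ) ≠ i := fun h => hi (h ▸ hk)
      exact hgt ⟨k, hk⟩ (by simp only; omega)
    · simp only [hj, hk, dif_neg, not_false_eq_true]
      exact le_rfl

/-- Choose U of dimension i - a in F_b ∩ E containing y. Then F_a + U has dimension at most i and
contains x + y, so any enlargement to dimension i inside F_b works when x + y ≠ 0. -/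
theorem exists_intermediate_space {Fa Fb : Submodule ℂ (Fin n → ℂ)} (hle : Fa ≤ Fb) {a b i : ℕ}
    (hFa : Module.finrank ℂ Fa = a) (hFb : Module.finrank ℂ Fb = b) (hai : a < i) (hib : i < b)
    {x y : Fin n → ℂ} (hx : x ∈ Fa) (hy : y ∈ Fb)
    (hyE : y ∈ coordSub (below 1 (n - b + (i - a))))
    (hxy : x + y ∈ coordSub (below Fin.revPerm (n - i))) (h0 : x ≠ 0 ∨ y ≠ 0) :
    ∃ S, Fa ≤ S ∧ S ≤ Fb ∧ Module.finrank ℂ S = i ∧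
      i - a ≤ Module.finrank ℂ
        (S ⊓ coordSub (below 1 (n - b + (i - a))) : Submodule ℂ _) ∧
      ∃ z ∈ S, z ≠ 0 ∧ z ∈ coordSub (below Fin.revPerm (n - i)) := by
  have hbn : b ≤ n := by
    have := Submodule.finrank_le Fb
    rw [Module.finrank_fin_fun] at this
    omega
  have hV := sub_le_finrank_inf_below 1 Fb (n - b + (i - a))
  have hone : Module.finrank ℂ (Submodule.span ℂ {y}) ≤ 1 := finrank_span_singleton_le y
  obtain ⟨U, hyU, hUV, hU⟩ := exists_between_finrank (k := i - a)
    (S := Submodule.span ℂ {y}) (T := Fb ⊓ coordSub (below 1 (n - b + (i - a))))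
    ((Submodule.span_singleton_le_iff_mem _ _).2 ⟨hy, hyE⟩) (by omega) (by omega)
  have hyU : y ∈ U := (Submodule.span_singleton_le_iff_mem _ _).1 hyU
  have hdim := Submodule.finrank_sup_add_finrank_inf_eq Fa U
  suffices h : ∃ z, z ≠ 0 ∧ z ∈ coordSub (below Fin.revPerm (n - i)) ∧ ∃ S, Fa ⊔ U ≤ S ∧ S ≤ Fb ∧
      z ∈ S ∧ Module.finrank ℂ S ≤ i by
    obtain ⟨z, hz0, hz, S, hFS, hSb, hzS, hS⟩ := h
    obtain ⟨T, hST, hTb, hT⟩ := exists_between_finrank hSb hS (by omega)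
    refine ⟨T, le_sup_left.trans (hFS.trans hST), hTb, hT, ?_, z, hST hzS, hz0, hz⟩
    exact hU.ge.trans (Submodule.finrank_mono (le_inf (le_sup_right.trans (hFS.trans hST))
      (hUV.trans inf_le_right)))
  have hsup : Fa ⊔ U ≤ Fb := sup_le hle (hUV.trans inf_le_left)
  -- In this degenerate case y is a nonzero vector of F_a ∩ U, so F_a + U has dimension below i.
  -- That leaves room for a vector z of F_b on the last n - i coordinates, which exists because b +
  -- (n - i) > n.
  by_cases hz : x + y = 0
  · have hy0 : y ≠ 0 := by
      rcases h0 with h0 | h0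
      · rintro rfl
        exact h0 (by simpa using hz)
      · exact h0
    have hyFa : y ∈ Fa := by
      rw [(neg_eq_of_add_eq_zero_right hz).symm]
      exact Submodule.neg_mem _ hx
    have hpos : 0 < Module.finrank ℂ (Fa ⊓ U : Submodule ℂ _) :=
      Module.finrank_pos_iff_exists_ne_zero.2
        ⟨⟨y, hyFa, hyU⟩, fun h' => hy0 (congrArg Subtype.val h')⟩
    have hQ := sub_le_finrank_inf_below Fin.revPerm Fb (n - i)
    obtain ⟨z, hz, hz0⟩ := exists_ne_zero_of_finrank_pos
      (S := Fb ⊓ coordSub (below Fin.revPerm (n - i))) (by omega)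
    refine ⟨z, hz0, hz.2, Fa ⊔ U ⊔ Submodule.span ℂ {z}, le_sup_left,
      sup_le hsup ((Submodule.span_singleton_le_iff_mem _ _).2 hz.1),
      le_sup_right (a := Fa ⊔ U) (Submodule.mem_span_singleton_self z), ?_⟩
    have h1 := Submodule.finrank_add_le_finrank_add_finrank (Fa ⊔ U) (Submodule.span ℂ {z})
    have h2 : Module.finrank ℂ (Submodule.span ℂ {z}) ≤ 1 := finrank_span_singleton_le z
    omega
  · exact ⟨x + y, hz, hxy, Fa ⊔ U, le_rfl, hsup, Submodule.add_mem_sup hx hyU, by omega⟩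

/-- The projected Richardson hypersurfaces, for `i` strictly between consecutive dimensions
`a` and `b` of subspaces of the flag. -/
theorem mem_projRichardson_iff {D : Finset ℕ} (hD : D ⊆ Finset.Ioo 0 n) {a b i : ℕ}
    (ha : a ∈ D ∨ a = 0 ∨ a = n) (hb : b ∈ D ∨ b = 0 ∨ b = n)
    (hab : ∀ c ∈ D, c ≤ a ∨ b ≤ c) (hai : a < i) (hib : i < b)
    {F : PartialFlag n D} {Fa Fb : Submodule ℂ (Fin n → ℂ)} (hle : Fa ≤ Fb)
    (hFa : Module.finrank ℂ Fa = a) (hFb : Module.finrank ℂ Fb = b)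
    (hlt : ∀ j : D, (j : ℕ) ≤ a → F.space j ≤ Fa) (hgt : ∀ j : D, b ≤ (j : ℕ) → Fb ≤ F.space j)
    (hG : ∀ (G : FullFlag n) (j : Finset.Ioo 0 n), proj hD G = F → (j : ℕ) = i →
      Fa ≤ G.space j ∧ G.space j ≤ Fb) :
    F ∈ projRichardson hD (simpleTransposition n i) (longestW n * longestWP n D) ↔
      ∃ x ∈ Fa, ∃ y ∈ Fb, y ∈ coordSub (below 1 (n - b + (i - a))) ∧
        x + y ∈ coordSub (below Fin.revPerm (n - i)) ∧ (x ≠ 0 ∨ y ≠ 0) := by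
  have hbn : b ≤ n := by
    have := Submodule.finrank_le Fb
    rw [Module.finrank_fin_fun] at this
    omega
  have hn : 0 < n := by omega
  have hiI : i ∈ Finset.Ioo 0 n := Finset.mem_Ioo.2 ⟨by omega, by omega⟩
  have hiD : i ∉ D := fun h => by
    have := hab i h
    omega
  constructor
  · rintro ⟨G, ⟨hG1, hG2⟩, rfl⟩
    obtain ⟨hGa, hGb⟩ := hG G ⟨i, hiI⟩ rfl rfl
    obtain ⟨z, hz, hz0, hzE⟩ :=
      (mem_oppositeSchubertVariety_simpleTransposition_iff _ hiI).1 hG1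
    rw [schubertVariety, schubertCell_eq] at hG2
    have h1 := rk_le_of_mem_closure hn hG2 ⟨i, hiI⟩ (n - b + (i - a))
    rw [one_mul, longestW_eq] at h1
    have h2 := le_rk_rev_mul_longestWP ha hb hbn hab hib
    set V := G.space ⟨i, hiI⟩ ⊓ coordSub (below 1 (n - b + (i - a)))
    have hdim := Submodule.finrank_sup_add_finrank_inf_eq Fa V
    -- If F_a meets V, a common vector y with x = -y gives the pair. Otherwise G_i = F_a ⊕ V by
    -- dimension, and the vector z required by X_{s_i} splits as x + y.
    by_cases hpos : 0 < Module.finrank ℂ (Fa ⊓ V : Submodule ℂ _)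
    · obtain ⟨y, hy, hy0⟩ := exists_ne_zero_of_finrank_pos hpos
      exact ⟨-y, Submodule.neg_mem _ hy.1, y, hGb hy.2.1, hy.2.2, by simp, Or.inr hy0⟩
    · have hGi : Module.finrank ℂ (G.space ⟨i, hiI⟩) = i := G.finrank_space _
      have heq : Fa ⊔ V = G.space ⟨i, hiI⟩ :=
        Submodule.eq_of_le_of_finrank_le (sup_le hGa inf_le_left) (by
          simp only at h1
          omega)
      rw [← heq] at hz
      obtain ⟨x, hx, y, hy, rfl⟩ := Submodule.mem_sup.1 hz
      refine ⟨x, hx, y, hGb hy.1, hy.2, hzE, ?_⟩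
      by_contra h
      push Not at h
      exact hz0 (by rw [h.1, h.2, add_zero])
  · rintro ⟨x, hx, y, hy, hyE, hxy, h0⟩
    obtain ⟨S, hFS, hSF, hS, hSV, hSE⟩ :=
      exists_intermediate_space hle hFa hFb hai hib hx hy hyE hxy h0
    let F' := F.insert hiD S hS
      (fun j hj => (hlt j (by have := hab j j.2; omega)).trans hFS)
      (fun j hj => hSF.trans (hgt j (by have := hab j j.2; omega)))
    have hDD : D ⊆ insert i D := Finset.subset_insert _ _
    have hF' : proj hDD F' = F := by
      ext1
      funext j
      simp [proj, F', PartialFlag.insert]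
    have hF'i : F'.space ⟨i, Finset.mem_insert_self _ _⟩ = S := by
      simp [F', PartialFlag.insert, hiD]
    have hD' : insert i D ⊆ Finset.Ioo 0 n := Finset.insert_subset hiI hD
    -- Lifting from the flag enlarged by S, rather than from F, prescribes the i-th space of G.
    obtain ⟨G, hG, hGF⟩ := exists_lift_mem_closure_cell 1 hD' (Finset.Subset.refl _)
      (longestW n * longestWP n D) hn F' (by
        rintro ⟨j, hj⟩ m
        by_cases hjD : j ∈ D
        · have h1 := rk_longest_le F ⟨j, hjD⟩ m
          rw [← hF'] at h1
          exact h1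
        · obtain rfl := (Finset.mem_insert.1 hj).resolve_right hjD
          rw [hF'i, one_mul, longestW_eq]
          have h1 := rk_rev_mul_longestWP_le ha hb hbn hab hib m
          have h2 := sub_le_finrank_inf_below 1 S m
          simp only
          -- Above the threshold, monotonicity and the codimension bound suffice. Below it, each
          -- coordinate removed costs at most one dimension.
          by_cases hm : n - b + (j - a) ≤ m
          · have h3 := finrank_inf_below_mono 1 S hm
            omega
          · have h3 := finrank_inf_below_le_add 1 S (m := m) (m' := n - b + (j - a))
              (by omega) (by omega)
            omega)
    have hGi : G.space ⟨i, hiI⟩ = S := by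
      rw [← hF'i, ← hGF]
      rfl
    refine ⟨G, ⟨?_, hG⟩, ?_⟩
    · rw [mem_oppositeSchubertVariety_simpleTransposition_iff _ hiI, hGi]
      exact hSE
    · rw [← hF', ← hGF]
      rfl

end FlagVariety

/-! ### Laplace expansion along several rows. -/

namespace FlagVariety

variable {R : Type*} [CommRing R]

/-- For a shuffle, every inversion starts at a position i < a, and exactly τ i - i of them start
there. The exponent τ i + i has the same parity. -/
theorem sign_eq_of_strictMono {N a : ℕ} (ha : a ≤ N) (τ : Equiv.Perm (Fin N))
    (h1 : ∀ i j : Fin N, i < j → (j : ℕ) < a → τ i < τ j)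
    (h2 : ∀ i j : Fin N, i < j → a ≤ (i : ℕ) → τ i < τ j) :
    Equiv.Perm.sign τ =
      ∏ i : Fin a, (-1) ^ ((τ (Fin.castLE ha i) : ℕ) + (i : ℕ)) := by
  classical
  rw [Equiv.Perm.sign_eq_prod_prod_Ioi]
  have hin : ∀ i, ∏ j ∈ Finset.Ioi i, (if τ i < τ j then (1 : ℤˣ) else -1) =
      if (i : ℕ) < a then (-1) ^ ((τ i : ℕ) + (i : ℕ)) else 1 := by
    intro i
    split_ifs with hi
    · rw [Finset.prod_ite, Finset.prod_const_one, one_mul, Finset.prod_const]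
      have hc : ((Finset.Ioi i).filter fun j => ¬ τ i < τ j).card + i = τ i := by
        have e1 : (Finset.univ.filter fun j => τ j < τ i).card = τ i := by
          have : (Finset.univ.filter fun j => τ j < τ i) = (Finset.Iio (τ i)).map τ.symm.toEmbedding := by
            ext j
            simp
          rw [this, Finset.card_map, Fin.card_Iio]
        have e2 : (Finset.univ.filter fun j => τ j < τ i) =
            ((Finset.Ioi i).filter fun j => ¬ τ i < τ j) ∪ Finset.Iio i := by
          ext j
          simp only [Finset.mem_filter, Finset.mem_univ, true_and, Finset.mem_union,
            Finset.mem_Ioi, Finset.mem_Iio, not_lt]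
          rcases lt_trichotomy i j with h | rfl | h
          · constructor
            · exact fun h' => Or.inl ⟨h, h'.le⟩
            · rintro (h' | h')
              · exact lt_of_le_of_ne h'.2 fun h'' => h.ne' (τ.injective h'')
              · exact absurd h' (lt_asymm h)
          · simp
          · simp [h, lt_asymm h, h1 j i h hi]
        rw [← e1, e2, Finset.card_union_of_disjoint, Fin.card_Iio]
        rw [Finset.disjoint_left]
        intro j hj hj'
        simp only [Finset.mem_filter, Finset.mem_Ioi, Finset.mem_Iio] at hj hj'
        exact lt_asymm hj.1 hj'
      rw [← hc, add_assoc, pow_add, ← two_mul, pow_mul]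
      simp
    · refine Finset.prod_eq_one fun j hj => ?_
      rw [if_pos (h2 i j (Finset.mem_Ioi.1 hj) (not_lt.1 hi))]
  simp_rw [hin]
  rw [← Finset.prod_filter]
  symm
  refine Finset.prod_bij (fun i _ => Fin.castLE ha i) ?_ ?_ ?_ ?_
  · intro i _
    simp
  · intro i _ j _ h
    simpa using h
  · intro i hi
    exact ⟨⟨i, by simpa using hi⟩, Finset.mem_univ _, rfl⟩
  · intro i _
    simp

theorem plucker_eq_det {m n k : ℕ} (A : Matrix (Fin m) (Fin n) R) {J : Finset (Fin n)}
    (hJ : J.card = k) (hk : k ≤ m) :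
    plucker A J = (A.submatrix (Fin.castLE hk) (J.orderEmbOfFin hJ)).det := by
  subst hJ
  rw [plucker, dif_pos hk]

/-- Two families of rows, one below the other. -/
def stack {α : Type*} {a k N : ℕ} (X : Fin a → Fin N → α) (Y : Fin k → Fin N → α) :
    Matrix (Fin (a + k)) (Fin N) α :=
  Matrix.of (Fin.append X Y)

theorem stack_castAdd {α : Type*} {a k N : ℕ} (X : Fin a → Fin N → α) (Y : Fin k → Fin N → α)
    (i : Fin a) : stack X Y (Fin.castAdd k i) = X i := Fin.append_left _ _ _

theorem stack_natAdd {α : Type*} {a k N : ℕ} (X : Fin a → Fin N → α) (Y : Fin k → Fin N → α)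
    (i : Fin k) : stack X Y (Fin.natAdd a i) = Y i := Fin.append_right _ _ _

theorem stack_update {α : Type*} {a k N : ℕ} [DecidableEq (Fin a)] (X : Fin a → Fin N → α)
    (Y : Fin k → Fin N → α) (i : Fin a) (x : Fin N → α) :
    stack (Function.update X i x) Y = (stack X Y).updateRow (Fin.castAdd k i) x := by
  ext p c
  refine Fin.addCases (fun q => ?_) (fun q => ?_) p
  · rw [stack_castAdd]
    by_cases hq : q = i
    · subst hq; simp
    · rw [Function.update_of_ne hq, Matrix.updateRow_ne, stack_castAdd]
      simpa using hq
  · rw [stack_natAdd, Matrix.updateRow_ne, stack_natAdd]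
    intro h
    have := congrArg Fin.val h
    simp at this
    omega

/-- The determinant as an alternating function of the first rows. -/
def detTop {a k : ℕ} (Y : Fin k → Fin (a + k) → R) :
    (Fin (a + k) → R) [⋀^Fin a]→ₗ[R] R where
  toFun X := (stack X Y).det
  map_update_add' X i x y := by
    simp only [stack_update, Matrix.det_updateRow_add]
  map_update_smul' X i r x := by
    simp only [stack_update, Matrix.det_updateRow_smul, smul_eq_mul]
  map_eq_zero_of_eq' X i j h hij := by
    refine Matrix.det_zero_of_row_eq (i := Fin.castAdd k i) (j := Fin.castAdd k j) ?_ ?_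
    · simpa using hij
    · rw [stack_castAdd, stack_castAdd, h]

theorem alternatingMap_sum_apply {M N ι κ : Type*} [AddCommMonoid M] [AddCommMonoid N]
    [Module R M] [Module R N] (s : Finset κ) (f : κ → M [⋀^ι]→ₗ[R] N) (v : ι → M) :
    (∑ k ∈ s, f k) v = ∑ k ∈ s, f k v :=
  map_sum ({ toFun := fun g => g v
             map_zero' := rfl
             map_add' := fun _ _ => rfl } : (M [⋀^ι]→ₗ[R] N) →+ N) f s

/-- A maximal minor as an alternating function of the rows. -/
noncomputable def minorMap {a N : ℕ} (S : Finset (Fin N)) :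
    (Fin N → R) [⋀^Fin a]→ₗ[R] R :=
  if hS : S.card = a then
    Matrix.detRowAlternating.compLinearMap (LinearMap.funLeft R R (S.orderEmbOfFin hS)) else 0

theorem minorMap_apply {a N : ℕ} {S : Finset (Fin N)} (hS : S.card = a)
    (X : Fin a → Fin N → R) : minorMap S X = plucker (Matrix.of X) S := by
  rw [minorMap, dif_pos hS, plucker_eq_det _ hS le_rfl]
  rfl

theorem plucker_single {a N : ℕ} {S T : Finset (Fin N)} (hS : S.card = a) (hT : T.card = a) :
    plucker (Matrix.of fun i => (Pi.single (S.orderEmbOfFin hS i) 1 : Fin N → R)) T =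
      if S = T then 1 else 0 := by
  rw [plucker_eq_det _ hT le_rfl]
  split_ifs with h
  · subst h
    rw [← Matrix.det_one (n := Fin a)]
    congr 1
    ext i j
    simp [Pi.single_apply, Matrix.one_apply, eq_comm]
  · have : ∃ i, S.orderEmbOfFin hS i ∉ T := by
      by_contra h'
      push Not at h'
      refine h (Finset.eq_of_subset_of_card_le (fun c hc => ?_) (by omega))
      have : c ∈ Set.range (S.orderEmbOfFin hS) := by simpa using hc
      obtain ⟨i, rfl⟩ := this
      exact h' i
    obtain ⟨i, hi⟩ := this
    refine Matrix.det_eq_zero_of_row_eq_zero i fun j => ?_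
    have : T.orderEmbOfFin hT j ≠ S.orderEmbOfFin hS i := fun h' =>
      hi (h' ▸ Finset.orderEmbOfFin_mem T hT j)
    simp [this]

/-- Moving the columns of S to the front is a shuffle that makes the matrix block triangular with an
identity block. -/
theorem det_stack_single {a k : ℕ} {S : Finset (Fin (a + k))} (hS : S.card = a)
    (Y : Fin k → Fin (a + k) → R) :
    (stack (fun i => (Pi.single (S.orderEmbOfFin hS i) 1 : Fin (a + k) → R)) Y).det =
      (-1) ^ (∑ c ∈ S, (c : ℕ) + ∑ i : Fin a, (i : ℕ)) * plucker (Matrix.of Y) Sᶜ := by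
  have hSc : Sᶜ.card = k := by
    rw [Finset.card_compl, hS, Fintype.card_fin]
    omega
  let π : Fin a ⊕ Fin k ≃ Fin (a + k) := finSumEquivOfFinset hS hSc
  let τ : Equiv.Perm (Fin (a + k)) := finSumFinEquiv.symm.trans π
  have hτl : ∀ i : Fin a, τ (Fin.castAdd k i) = S.orderEmbOfFin hS i := fun i => by simp [τ, π]
  have hτr : ∀ i : Fin k, τ (Fin.natAdd a i) = Sᶜ.orderEmbOfFin hSc i := fun i => by simp [τ, π]
  have hsign := sign_eq_of_strictMono (Nat.le_add_right a k) τ (by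
    intro i j hij hj
    have hij' := Fin.lt_def.1 hij
    have e1 := hτl ⟨i, by omega⟩
    have e2 := hτl ⟨j, hj⟩
    exact (e1.trans_lt ((S.orderEmbOfFin hS).strictMono hij)).trans_eq e2.symm) (by
    intro i j hij hi
    have hij' := Fin.lt_def.1 hij
    obtain ⟨i, rfl⟩ : ∃ i', i = Fin.natAdd a i' :=
      ⟨⟨i - a, by omega⟩, Fin.ext (by simp only [Fin.natAdd]; omega)⟩
    obtain ⟨j, rfl⟩ : ∃ j', j = Fin.natAdd a j' :=
      ⟨⟨j - a, by omega⟩, Fin.ext (by simp only [Fin.natAdd]; omega)⟩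
    rw [hτr, hτr]
    exact (Sᶜ.orderEmbOfFin hSc).strictMono (by simpa using hij))
  have hsum : ∏ i : Fin a, (-1 : ℤˣ) ^ ((τ (Fin.castLE (Nat.le_add_right a k) i) : ℕ) + (i : ℕ)) =
      (-1) ^ (∑ c ∈ S, (c : ℕ) + ∑ i : Fin a, (i : ℕ)) := by
    rw [Finset.prod_pow_eq_pow_sum, Finset.sum_add_distrib]
    congr 2
    rw [← Finset.sum_coe_sort S, ← Equiv.sum_comp (S.orderIsoOfFin hS).toEquiv]
    exact Finset.sum_congr rfl fun i _ => congrArg Fin.val (hτl i)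
  set M := stack (fun i => (Pi.single (S.orderEmbOfFin hS i) 1 : Fin (a + k) → R)) Y
  have h1 := Matrix.det_permute' τ M
  have h2 : (M.submatrix id τ).det = plucker (Matrix.of Y) Sᶜ := by
    rw [← Matrix.det_submatrix_equiv_self finSumFinEquiv, plucker_eq_det _ hSc le_rfl]
    have : (M.submatrix id τ).submatrix finSumFinEquiv finSumFinEquiv =
        Matrix.fromBlocks 1 0 ((Matrix.of Y).submatrix id (S.orderEmbOfFin hS))
          ((Matrix.of Y).submatrix (Fin.castLE le_rfl) (Sᶜ.orderEmbOfFin hSc)) := by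
      ext p q
      rcases p with p | p <;> rcases q with q | q
      · have h0 : M (Fin.castAdd k p) (S.orderEmbOfFin hS q) =
            (Pi.single (S.orderEmbOfFin hS p) 1 : Fin (a + k) → R) (S.orderEmbOfFin hS q) :=
          congrFun (stack_castAdd _ _ p) _
        simp [hτl, h0, Pi.single_apply, Matrix.one_apply, eq_comm]
      · have : Sᶜ.orderEmbOfFin hSc q ≠ S.orderEmbOfFin hS p := fun h =>
          Finset.mem_compl.1 (Finset.orderEmbOfFin_mem Sᶜ hSc q)
            (h ▸ Finset.orderEmbOfFin_mem S hS p)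
        have h0 : M (Fin.castAdd k p) (Sᶜ.orderEmbOfFin hSc q) =
            (Pi.single (S.orderEmbOfFin hS p) 1 : Fin (a + k) → R) (Sᶜ.orderEmbOfFin hSc q) :=
          congrFun (stack_castAdd _ _ p) _
        simp [hτr, h0, this]
      · have h0 : M (Fin.natAdd a p) = Y p := stack_natAdd _ _ p
        simp [hτl, h0]
      · have h0 : M (Fin.natAdd a p) = Y p := stack_natAdd _ _ p
        simp [hτr, h0]
    rw [this, Matrix.det_fromBlocks_zero₁₂, Matrix.det_one, one_mul]
  rw [hsign, hsum] at h1
  rw [← h2, h1, ← mul_assoc]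
  push_cast
  rw [← pow_add, ← two_mul, pow_mul]
  simp

/-- Laplace expansion of a determinant along its first `a` rows. -/
theorem det_stack {a k : ℕ} (X : Fin a → Fin (a + k) → R) (Y : Fin k → Fin (a + k) → R) :
    (stack X Y).det = ∑ S ∈ (Finset.univ : Finset (Fin (a + k))).powersetCard a,
      (-1) ^ (∑ c ∈ S, (c : ℕ) + ∑ i : Fin a, (i : ℕ)) * plucker (Matrix.of X) S * plucker (Matrix.of Y) Sᶜ := by
  have h : detTop Y = ∑ S ∈ (Finset.univ : Finset (Fin (a + k))).powersetCard a,
      ((-1) ^ (∑ c ∈ S, (c : ℕ) + ∑ i : Fin a, (i : ℕ)) * plucker (Matrix.of Y) Sᶜ) •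
        minorMap (R := R) (a := a) S := by
    -- Both sides are alternating in the top rows, so distinct basis vectors suffice. Sorting them
    -- produces the same sign on both sides.
    refine Module.Basis.ext_alternating (Pi.basisFun R (Fin (a + k))) fun v hv => ?_
    have hS : (Finset.univ.image v).card = a := by
      rw [Finset.card_image_of_injective _ hv]
      simp
    set S := Finset.univ.image v
    have hvS : ∀ i, v i ∈ S := fun i => Finset.mem_image_of_mem _ (Finset.mem_univ i)
    let ρ : Equiv.Perm (Fin a) := Equiv.ofBijective
      (fun i => (S.orderIsoOfFin hS).symm ⟨v i, hvS i⟩) (Finite.injective_iff_bijective.1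
        fun i j hij => hv (by simpa using hij))
    have hρ : v = S.orderEmbOfFin hS ∘ ρ := by
      funext i
      simp only [Function.comp_apply, ρ, Equiv.ofBijective_apply, ← Finset.coe_orderIsoOfFin_apply,
        OrderIso.apply_symm_apply]
    have hcomp : (fun i => Pi.basisFun R (Fin (a + k)) (v i)) =
        (fun i => (Pi.single (S.orderEmbOfFin hS i) 1 : Fin (a + k) → R)) ∘ ρ := by
      rw [hρ]
      funext i
      simp
    rw [hcomp, AlternatingMap.map_perm, AlternatingMap.map_perm]
    congr 1
    refine (det_stack_single hS Y).trans ?_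
    rw [alternatingMap_sum_apply, Finset.sum_eq_single S]
    · rw [AlternatingMap.smul_apply, minorMap_apply hS, plucker_single hS hS, if_pos rfl,
        smul_eq_mul, mul_one]
    · intro T hT hne
      have hT := (Finset.mem_powersetCard.1 hT).2
      rw [AlternatingMap.smul_apply, minorMap_apply hT, plucker_single hS hT, if_neg hne.symm,
        smul_zero]
    · intro h
      exact absurd (Finset.mem_powersetCard.2 ⟨Finset.subset_univ _, hS⟩) h
  have h2 := congrArg (fun f => f X) h
  refine h2.trans ?_
  simp only [alternatingMap_sum_apply]
  refine Finset.sum_congr rfl fun S hS => ?_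
  rw [AlternatingMap.smul_apply, minorMap_apply (Finset.mem_powersetCard.1 hS).2, smul_eq_mul]
  ring

end FlagVariety

/-! ### The incidence matrix, its determinant and its left kernel. -/

namespace FlagVariety

variable {R : Type*} [CommRing R]

theorem plucker_eq_plucker_image {r n a N : ℕ} {A : Matrix (Fin r) (Fin n) R}
    {B : Matrix (Fin a) (Fin N) R} (har : a ≤ r) {φ : Fin N → Fin n} {S : Finset (Fin N)}
    (hS : S.card = a) (hφ : StrictMonoOn φ S)
    (h : ∀ p, ∀ c ∈ S, B p c = A (Fin.castLE har p) (φ c)) :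
    plucker B S = plucker A (S.image φ) := by
  have hc : (S.image φ).card = a := by rw [Finset.card_image_of_injOn hφ.injOn, hS]
  have ho : φ ∘ S.orderEmbOfFin hS = (S.image φ).orderEmbOfFin hc := by
    refine Finset.orderEmbOfFin_unique hc (fun x => ?_) fun x y hxy => ?_
    · exact Finset.mem_image_of_mem _ (Finset.orderEmbOfFin_mem S hS x)
    · exact hφ (Finset.orderEmbOfFin_mem S hS x) (Finset.orderEmbOfFin_mem S hS y)
        ((S.orderEmbOfFin hS).strictMono hxy)
  rw [plucker_eq_det B hS le_rfl, plucker_eq_det A hc har]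
  congr 1
  ext p q
  rw [Matrix.submatrix_apply, Matrix.submatrix_apply,
    h _ _ (Finset.orderEmbOfFin_mem S hS q), ← ho]
  rfl

theorem plucker_eq_zero_of_col_eq_zero {m n : ℕ} (A : Matrix (Fin m) (Fin n) R)
    {S : Finset (Fin n)} {c : Fin n} (hc : c ∈ S) (h : ∀ p, A p c = 0) : plucker A S = 0 := by
  rw [plucker]
  split_ifs with hS
  · have : c ∈ Set.range (S.orderEmbOfFin rfl) := by simpa using hc
    obtain ⟨q, rfl⟩ := this
    exact Matrix.det_eq_zero_of_column_eq_zero q fun p => h _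
  · rfl

/-- Columns `< i` followed by the columns `≥ n - b + (i - a)`. -/
def selectCols {n a b i : ℕ} (hai : a < i) (hib : i < b) (hb : b ≤ n) (c : Fin (a + b)) : Fin n :=
  -- The `min` has no effect, since c < i < n in this branch; it only supplies the bound.
  if (c : ℕ) < i then ⟨min c (n - 1), by omega⟩ else ⟨n - b + (i - a) + c - i, by omega⟩

section

variable {r n a b i : ℕ} (hai : a < i) (hib : i < b) (hb : b ≤ n) (hbr : b ≤ r)

theorem selectCols_of_lt {c : Fin (a + b)} (hc : (c : ℕ) < i) :
    (selectCols hai hib hb c : ℕ) = c := by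
  rw [selectCols, if_pos hc]
  simp only
  omega

theorem selectCols_of_ge {c : Fin (a + b)} (hc : i ≤ (c : ℕ)) :
    (selectCols hai hib hb c : ℕ) = n - b + (i - a) + c - i := by
  rw [selectCols, if_neg (by omega)]

/-- The square matrix whose determinant is, up to sign, the equation of the projected Richardson
divisor: a vector in its left kernel is a pair `x ∈ F_a`, `y ∈ F_b` such that `y` is supported on
the first `n - b + (i - a)` coordinates and `x + y` on the last `n - i` ones. -/
def incidenceMatrix (A : Matrix (Fin r) (Fin n) R) : Matrix (Fin (a + b)) (Fin (a + b)) R :=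
  stack
    (fun p c => if (c : ℕ) < i then
      A (Fin.castLE ((hai.trans hib).le.trans hbr) p) (selectCols hai hib hb c) else 0)
    -- The entries of y in the columns from l = min i (n - b + (i - a)) up to i are set to zero. The
    -- last columns force those coordinates of y to vanish anyway, and the zeros confine J to the
    -- first l columns.
    (fun p c => if (c : ℕ) < min i (n - b + (i - a)) ∨ i ≤ (c : ℕ) then
      A (Fin.castLE hbr p) (selectCols hai hib hb c) else 0)

theorem mem_interval {n a b : ℕ} {c : Fin n} : c ∈ interval n a b ↔ a ≤ (c : ℕ) ∧ (c : ℕ) < b := by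
  simp only [interval, Finset.mem_filter, Finset.mem_univ, true_and]
  omega

theorem card_interval {n a b : ℕ} (hb : b ≤ n) : (interval n a b).card = b - a := by
  rw [← Nat.card_Ico, ← Finset.card_map Fin.valEmbedding]
  congr 1
  ext c
  simp only [Finset.mem_map, mem_interval, Finset.mem_Ico, Fin.valEmbedding_apply]
  constructor
  · rintro ⟨d, h, rfl⟩
    exact h
  · rintro h
    exact ⟨⟨c, by omega⟩, h, rfl⟩

theorem indexSum_eq {n : ℕ} (J : Finset (Fin n)) : indexSum J = ∑ c ∈ J, (c : ℕ) + J.card := by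
  simp [indexSum, Finset.sum_add_distrib]

/-- In the Laplace expansion along the first a rows, the nonzero terms choose S = [i] ∖ J with J in
the first l columns; the complement then selects J together with the final interval. -/
theorem det_incidenceMatrix (A : Matrix (Fin r) (Fin n) R) :
    ∃ e : ℕ, (incidenceMatrix hai hib hb hbr A).det = (-1) ^ e *
      ∑ J ∈ (interval n 0 (min i (n - b + (i - a)))).powersetCard (i - a),
        (-1) ^ indexSum J * plucker A (interval n 0 i \ J) *
          plucker A (J ∪ interval n (n - b + (i - a)) n) := by
  classical
  set l := min i (n - b + (i - a)) with hl
  set φ := selectCols hai hib hb with hφ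
  let T : Finset (Fin n) → Finset (Fin (a + b)) := fun J =>
    Finset.univ.filter fun c => (c : ℕ) < i ∧ φ c ∉ J
  have hJlt : ∀ J ∈ (interval n 0 l).powersetCard (i - a), ∀ c ∈ J, (c : ℕ) < l := fun J hJ c hc =>
    (mem_interval.1 ((Finset.mem_powersetCard.1 hJ).1 hc)).2
  have hsub : ∀ J ∈ (interval n 0 l).powersetCard (i - a), J ⊆ interval n 0 i := fun J hJ c hc =>
    mem_interval.2 ⟨Nat.zero_le _, (hJlt J hJ c hc).trans_le (min_le_left _ _)⟩
  have hmono1 : ∀ J : Finset (Fin n), StrictMonoOn φ (T J) := by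
    intro J c hc d hd hcd
    simp only [T, Finset.coe_filter, Set.mem_ofPred_eq] at hc hd
    rw [Fin.lt_def, hφ, selectCols_of_lt hai hib hb hc.2.1, selectCols_of_lt hai hib hb hd.2.1]
    exact hcd
  have him1 : ∀ J : Finset (Fin n), (T J).image φ = interval n 0 i \ J := by
    intro J
    ext d
    simp only [T, Finset.mem_image, Finset.mem_filter, Finset.mem_univ, true_and,
      Finset.mem_sdiff, mem_interval]
    constructor
    · rintro ⟨c, hc, rfl⟩
      refine ⟨⟨Nat.zero_le _, ?_⟩, hc.2⟩
      rw [hφ, selectCols_of_lt hai hib hb hc.1]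
      exact hc.1
    · rintro ⟨⟨-, h1⟩, h2⟩
      have : φ ⟨d, by omega⟩ = d := Fin.ext (selectCols_of_lt hai hib hb h1)
      exact ⟨⟨d, by omega⟩, ⟨h1, this.symm ▸ h2⟩, this⟩
  have hcard : ∀ J ∈ (interval n 0 l).powersetCard (i - a), (T J).card = a := by
    intro J hJ
    rw [← Finset.card_image_of_injOn (hmono1 J).injOn, him1,
      Finset.card_sdiff_of_subset (hsub J hJ), card_interval (by omega),
      (Finset.mem_powersetCard.1 hJ).2]
    omega
  -- No reordering sign arises: the columns of J precede the final interval, as l ≤ n - b + (i - a).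
  have hmono2 : ∀ J ∈ (interval n 0 l).powersetCard (i - a),
      StrictMonoOn φ ((T J)ᶜ : Finset (Fin (a + b))) := by
    intro J hJ c hc d hd hcd
    have hcd' := Fin.lt_def.1 hcd
    simp only [T, Finset.compl_filter, Finset.coe_filter, Finset.mem_univ, true_and,
      Set.mem_ofPred_eq, not_and, not_not] at hc hd
    rw [Fin.lt_def]
    rcases lt_or_ge (c : ℕ) i with h1 | h1 <;> rcases lt_or_ge (d : ℕ) i with h2 | h2
    · rw [hφ, selectCols_of_lt hai hib hb h1, selectCols_of_lt hai hib hb h2]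
      exact hcd
    · have := hJlt J hJ _ (hc h1)
      rw [hφ] at this ⊢
      rw [selectCols_of_ge hai hib hb h2]
      omega
    · omega
    · rw [hφ, selectCols_of_ge hai hib hb h1, selectCols_of_ge hai hib hb h2]
      omega
  have him2 : ∀ J ∈ (interval n 0 l).powersetCard (i - a),
      (T J)ᶜ.image φ = J ∪ interval n (n - b + (i - a)) n := by
    intro J hJ
    ext d
    simp only [T, Finset.mem_image, Finset.compl_filter, Finset.mem_filter, Finset.mem_univ,
      true_and, Finset.mem_union, mem_interval, not_and, not_not]
    constructor
    · rintro ⟨c, hc, rfl⟩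
      rcases lt_or_ge (c : ℕ) i with h1 | h1
      · exact Or.inl (hc h1)
      · right
        rw [hφ, selectCols_of_ge hai hib hb h1]
        omega
    · rintro (h | h)
      · have h1 := hJlt J hJ d h
        have : φ ⟨d, by omega⟩ = d :=
          Fin.ext (selectCols_of_lt hai hib hb (h1.trans_le (min_le_left _ _)))
        exact ⟨⟨d, by omega⟩, fun _ => this.symm ▸ h, this⟩
      · have : φ ⟨i + (d - (n - b + (i - a))), by omega⟩ = d :=
          Fin.ext ((selectCols_of_ge hai hib hb (by simp)).trans (by simp only; omega))
        exact ⟨⟨i + (d - (n - b + (i - a))), by omega⟩, fun h => by simp at h, this⟩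
  have hsum : ∀ J ∈ (interval n 0 l).powersetCard (i - a),
      ∑ c ∈ T J, (c : ℕ) + ∑ c ∈ J, (c : ℕ) = ∑ c ∈ interval n 0 i, (c : ℕ) := by
    intro J hJ
    rw [← Finset.sum_sdiff (hsub J hJ), ← him1, Finset.sum_image (hmono1 J).injOn]
    congr 1
    refine Finset.sum_congr rfl fun c hc => ?_
    rw [hφ, selectCols_of_lt hai hib hb (Finset.mem_filter.1 hc).2.1]
  -- Column sums over [i] ∖ J and J add up to a constant, so the sign depends on J only through the
  -- sum of J. The last summand i - a accounts for `indexSum` counting from 1.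
  refine ⟨∑ c ∈ interval n 0 i, (c : ℕ) + ∑ p : Fin a, (p : ℕ) + (i - a), ?_⟩
  rw [incidenceMatrix, det_stack, Finset.mul_sum]
  symm
  refine Finset.sum_of_injOn T ?_ ?_ ?_ ?_
  · intro J hJ J' hJ' h
    have := him1 J
    rw [h, him1 J'] at this
    rw [← Finset.sdiff_sdiff_eq_self (hsub J hJ), ← this, Finset.sdiff_sdiff_eq_self (hsub J' hJ')]
  · intro J hJ
    exact Finset.mem_powersetCard.2 ⟨Finset.subset_univ _, hcard J hJ⟩
  -- Any other S either uses a column that is zero in the top rows or leaves to the bottom rows a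
  -- column that is zero there.
  · intro S hS hS'
    have hSa := (Finset.mem_powersetCard.1 hS).2
    by_cases h1 : ∃ c ∈ S, i ≤ (c : ℕ)
    · obtain ⟨c, hc, hic⟩ := h1
      rw [plucker_eq_zero_of_col_eq_zero (c := c) _ hc fun p => ?_, mul_zero, zero_mul]
      exact if_neg (by omega)
    by_cases h2 : ∃ c ∈ Sᶜ, l ≤ (c : ℕ) ∧ (c : ℕ) < i
    · obtain ⟨c, hc, hlc⟩ := h2
      rw [plucker_eq_zero_of_col_eq_zero (A := Matrix.of fun p c => _) (c := c) hc fun p => ?_,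
        mul_zero]
      exact if_neg (by omega)
    exfalso
    push Not at h1 h2
    refine hS' ⟨interval n 0 i \ S.image φ, ?_, ?_⟩
    · have hSφ : S.image φ ⊆ interval n 0 i := by
        intro d hd
        obtain ⟨c, hc, rfl⟩ := Finset.mem_image.1 hd
        rw [mem_interval, hφ, selectCols_of_lt hai hib hb (h1 c hc)]
        exact ⟨Nat.zero_le _, h1 c hc⟩
      refine Finset.mem_coe.2 (Finset.mem_powersetCard.2 ⟨fun d hd => ?_, ?_⟩)
      · obtain ⟨hd1, hd2⟩ := Finset.mem_sdiff.1 hd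
        have hd1 := (mem_interval.1 hd1).2
        have : φ ⟨d, by omega⟩ = d := Fin.ext (selectCols_of_lt hai hib hb hd1)
        refine mem_interval.2 ⟨Nat.zero_le _, ?_⟩
        by_contra hcon
        have h3 := h2 ⟨d, by omega⟩ (Finset.mem_compl.2 fun h =>
          hd2 (Finset.mem_image.2 ⟨_, h, this⟩)) (by simpa using hcon)
        simp only at h3
        omega
      · rw [Finset.card_sdiff_of_subset hSφ, card_interval (by omega),
          Finset.card_image_of_injOn, hSa, Nat.sub_zero]
        intro c hc d hd hcd
        have := congrArg Fin.val hcd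
        rw [hφ, selectCols_of_lt hai hib hb (h1 c hc), selectCols_of_lt hai hib hb (h1 d hd)] at this
        exact Fin.ext this
    · ext c
      simp only [T, Finset.mem_filter, Finset.mem_univ, true_and, Finset.mem_sdiff, not_and,
        not_not, mem_interval]
      constructor
      · rintro ⟨hc, h⟩
        have h3 : (φ c : ℕ) = c := selectCols_of_lt hai hib hb hc
        obtain ⟨d, hd, hdc⟩ := Finset.mem_image.1 (h ⟨Nat.zero_le _, by omega⟩)
        have h4 : (φ d : ℕ) = d := selectCols_of_lt hai hib hb (h1 d hd)
        have : d = c := Fin.ext (by rw [← h4, hdc, h3])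
        exact this ▸ hd
      · exact fun hc => ⟨h1 c hc, fun _ => Finset.mem_image_of_mem _ hc⟩
  · intro J hJ
    have e1 := plucker_eq_plucker_image (R := R) (A := A)
      (B := Matrix.of fun p c => if (c : ℕ) < i then
        A (Fin.castLE ((hai.trans hib).le.trans hbr) p) (selectCols hai hib hb c) else 0)
      ((hai.trans hib).le.trans hbr) (hcard J hJ) (hmono1 J)
      fun p c hc => if_pos (Finset.mem_filter.1 hc).2.1
    have hcard2 : (T J)ᶜ.card = b := by
      rw [Finset.card_compl, hcard J hJ, Fintype.card_fin]
      omega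
    have e2 := plucker_eq_plucker_image (R := R) (A := A)
      (B := Matrix.of fun p c => if (c : ℕ) < l ∨ i ≤ (c : ℕ) then
        A (Fin.castLE hbr p) (selectCols hai hib hb c) else 0)
      hbr hcard2 (hmono2 J hJ) fun p c hc => if_pos (by
        rw [Finset.mem_compl, Finset.mem_filter] at hc
        by_contra h
        push Not at h
        refine hc ⟨Finset.mem_univ _, h.2, fun h' => ?_⟩
        have h3 := hJlt J hJ _ h'
        rw [hφ, selectCols_of_lt hai hib hb h.2] at h3
        omega)
    rw [e1, e2, him1, him2 J hJ, ← mul_assoc, ← mul_assoc, indexSum_eq,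
      (Finset.mem_powersetCard.1 hJ).2, ← pow_add, ← hsum J hJ]
    congr 2
    rw [show ∑ c ∈ T J, (c : ℕ) + ∑ c ∈ J, (c : ℕ) + ∑ p : Fin a, (p : ℕ) + (i - a) +
      (∑ c ∈ J, (c : ℕ) + (i - a)) = ∑ c ∈ T J, (c : ℕ) + ∑ p : Fin a, (p : ℕ) +
        2 * (∑ c ∈ J, (c : ℕ) + (i - a)) by ring, pow_add, pow_mul]
    simp

theorem mem_span_rows_iff {r n a : ℕ} (har : a ≤ r) (A : Matrix (Fin r) (Fin n) ℂ)
    (x : Fin n → ℂ) : x ∈ Submodule.span ℂ (A.row '' {p | (p : ℕ) < a}) ↔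
      ∃ u : Fin a → ℂ, ∑ p, u p • A (Fin.castLE har p) = x := by
  have : A.row '' {p | (p : ℕ) < a} = Set.range fun p => A (Fin.castLE har p) := by
    ext v
    constructor
    · rintro ⟨p, hp, rfl⟩
      exact ⟨⟨p, hp⟩, rfl⟩
    · rintro ⟨p, rfl⟩
      exact ⟨Fin.castLE har p, p.2, rfl⟩
  rw [this, Submodule.mem_span_range_iff_exists_fun]

/-- A row vector splits into the coefficients of x in the first a rows of A and those of y in the
first b rows. Independence of the rows makes it zero exactly when x = y = 0. -/
theorem det_incidenceMatrix_eq_zero_iff {A : Matrix (Fin r) (Fin n) ℂ}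
    (hA : LinearIndependent ℂ A.row) :
    (incidenceMatrix hai hib hb hbr A).det = 0 ↔
      ∃ x ∈ Submodule.span ℂ (A.row '' {p | (p : ℕ) < a}),
      ∃ y ∈ Submodule.span ℂ (A.row '' {p | (p : ℕ) < b}),
        y ∈ coordSub (below 1 (n - b + (i - a))) ∧ x + y ∈ coordSub (below Fin.revPerm (n - i)) ∧
          (x ≠ 0 ∨ y ≠ 0) := by
  have har : a ≤ r := (hai.trans hib).le.trans hbr
  have key : ∀ (w : Fin (a + b) → ℂ) (c : Fin (a + b)),
      Matrix.vecMul w (incidenceMatrix hai hib hb hbr A) c =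
        (if (c : ℕ) < i then
          (∑ p, w (Fin.castAdd b p) • A (Fin.castLE har p)) (selectCols hai hib hb c) else 0) +
        if (c : ℕ) < min i (n - b + (i - a)) ∨ i ≤ (c : ℕ) then
          (∑ p, w (Fin.natAdd a p) • A (Fin.castLE hbr p)) (selectCols hai hib hb c) else 0 := by
    intro w c
    rw [Matrix.vecMul, dotProduct, Fin.sum_univ_add]
    congr 1
    · simp only [incidenceMatrix, stack_castAdd]
      split_ifs <;> simp
    · simp only [incidenceMatrix, stack_natAdd]
      split_ifs <;> simp
  have hmem : ∀ w : Fin (a + b) → ℂ, Matrix.vecMul w (incidenceMatrix hai hib hb hbr A) = 0 ↔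
      (∑ p, w (Fin.natAdd a p) • A (Fin.castLE hbr p)) ∈ coordSub (below 1 (n - b + (i - a))) ∧
      (∑ p, w (Fin.castAdd b p) • A (Fin.castLE har p)) +
        (∑ p, w (Fin.natAdd a p) • A (Fin.castLE hbr p)) ∈
          coordSub (below Fin.revPerm (n - i)) := by
    intro w
    rw [funext_iff]
    simp only [key, Pi.zero_apply]
    generalize ∑ p, w (Fin.castAdd b p) • A (Fin.castLE har p) = x
    generalize ∑ p, w (Fin.natAdd a p) • A (Fin.castLE hbr p) = y
    simp only [mem_coordSub, mem_below, Equiv.Perm.coe_one, id_eq, Fin.revPerm_apply, Fin.val_rev, Pi.add_apply, not_lt]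
    constructor
    · intro h
      have hy : ∀ c : Fin n, n - b + (i - a) ≤ (c : ℕ) → y c = 0 := by
        intro c hc
        have h1 := h ⟨i + (c - (n - b + (i - a))), by omega⟩
        have h2 : selectCols hai hib hb ⟨i + (c - (n - b + (i - a))), by omega⟩ = c :=
          Fin.ext ((selectCols_of_ge hai hib hb (by simp)).trans (by simp only; omega))
        rw [h2, if_neg (by simp), if_pos (Or.inr (by simp)), zero_add] at h1
        exact h1
      refine ⟨hy, fun c hc => ?_⟩
      have hc' : (c : ℕ) < i := by omega
      have h1 := h ⟨c, by omega⟩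
      have h2 : selectCols hai hib hb ⟨c, by omega⟩ = c :=
        Fin.ext (selectCols_of_lt hai hib hb hc')
      rw [h2, if_pos hc'] at h1
      split_ifs at h1 with h3
      · exact h1
      · rw [hy c (by simp only [not_or] at h3; omega)]
        exact h1
    · rintro ⟨hy, hxy⟩ c
      rcases lt_or_ge (c : ℕ) i with hc | hc
      · have h2 := selectCols_of_lt hai hib hb hc
        rw [if_pos hc]
        have h3 := hxy (selectCols hai hib hb c) (by rw [h2]; omega)
        split_ifs with h4
        · exact h3
        · rw [hy (selectCols hai hib hb c) (by rw [h2]; omega)] at h3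
          exact h3
      · have h2 := selectCols_of_ge hai hib hb hc
        rw [if_neg (by omega), if_pos (Or.inr hc), zero_add]
        exact hy _ (by rw [h2]; omega)
  have hinj : ∀ {s : ℕ} (hs : s ≤ r) (u : Fin s → ℂ),
      ∑ p, u p • A (Fin.castLE hs p) = 0 → u = 0 := by
    intro s hs u hu
    have := Fintype.linearIndependent_iff.1 (hA.comp _ (Fin.castLE_injective hs)) u hu
    exact funext this
  rw [← Matrix.exists_vecMul_eq_zero_iff]
  constructor
  · rintro ⟨w, hw, h⟩
    obtain ⟨h1, h2⟩ := (hmem w).1 h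
    refine ⟨_, (mem_span_rows_iff har A _).2 ⟨_, rfl⟩, _, (mem_span_rows_iff hbr A _).2 ⟨_, rfl⟩,
      h1, h2, ?_⟩
    by_contra hcon
    push Not at hcon
    refine hw (funext fun p => ?_)
    refine Fin.addCases (fun q => ?_) (fun q => ?_) p
    · exact congrFun (hinj har _ hcon.1) q
    · exact congrFun (hinj hbr _ hcon.2) q
  · rintro ⟨x, hx, y, hy, h1, h2, h3⟩
    obtain ⟨u, rfl⟩ := (mem_span_rows_iff har A _).1 hx
    obtain ⟨v, rfl⟩ := (mem_span_rows_iff hbr A _).1 hy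
    refine ⟨Fin.append u v, ?_, ?_⟩
    · intro h
      have hu : u = 0 := funext fun p => by
        simpa using congrFun h (Fin.castAdd b p)
      have hv : v = 0 := funext fun p => by
        simpa using congrFun h (Fin.natAdd a p)
      simp [hu, hv] at h3
    · rw [hmem]
      simpa using ⟨h1, h2⟩

end

end FlagVariety

/-! ### Degrees in the rows and irreducibility of generic minors. -/

namespace FlagVariety

section RowDegree

variable {ι κ K : Type*} [Field K]

/-- The polynomial does not involve the variables of row `q`. -/
def FreeOfRow (q : ι) (h : MvPolynomial (ι × κ) K) : Prop := ∀ c, (q, c) ∉ h.vars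

theorem algHom_eq_of_freeOfRow {S : Type*} [CommRing S] [Algebra K S]
    (φ ψ : MvPolynomial (ι × κ) K →ₐ[K] S) {Q : Set ι} {h : MvPolynomial (ι × κ) K}
    (hQ : ∀ q ∈ Q, FreeOfRow q h)
    (hφ : ∀ p ∉ Q, ∀ c, φ (MvPolynomial.X (p, c)) = ψ (MvPolynomial.X (p, c))) :
    φ h = ψ h := by
  refine MvPolynomial.hom_congr_vars (f₁ := φ.toRingHom) (f₂ := ψ.toRingHom) ?_ ?_ rfl
  · ext r
    exact (φ.commutes r).trans (ψ.commutes r).symm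
  · rintro ⟨p, c⟩ hi -
    exact hφ p (fun hp => hQ p hp c hi) c

theorem isUnit_of_freeOfRow {h : MvPolynomial (ι × κ) K} (h0 : h ≠ 0)
    (hh : ∀ q, FreeOfRow q h) : IsUnit h := by
  have h1 : h.vars = ∅ := Finset.eq_empty_of_forall_notMem fun x => hh x.1 x.2
  rw [MvPolynomial.vars_eq_empty_iff_eq_C] at h1
  rw [h1] at h0 ⊢
  refine (IsUnit.mk0 _ fun h2 => h0 ?_).map _
  rw [h2, map_zero]

variable [DecidableEq ι]

/-- Multiplication of row `q` by an indeterminate. -/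
noncomputable def rowScale (q : ι) :
    MvPolynomial (ι × κ) K →ₐ[K] Polynomial (MvPolynomial (ι × κ) K) :=
  MvPolynomial.aeval fun x => (if x.1 = q then Polynomial.X else 1) *
    Polynomial.C (MvPolynomial.X x)

/-- A constant polynomial takes the same value at 1 and at 0, that is, h does not change when row q
is set to zero. -/
theorem freeOfRow_of_natDegree_eq_zero {q : ι} {h : MvPolynomial (ι × κ) K}
    (hd : (rowScale q h).natDegree = 0) : FreeOfRow q h := by
  have h1 := Polynomial.eq_C_of_natDegree_eq_zero hd
  have e1 : ∀ g : MvPolynomial (ι × κ) K, (rowScale q g).eval 1 = g := by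
    intro g
    have : ((Polynomial.aeval (R := MvPolynomial (ι × κ) K) (1 : MvPolynomial (ι × κ) K)).restrictScalars K).comp
        (rowScale q) = AlgHom.id K _ := by
      ext x : 1
      by_cases hx : x.1 = q <;> simp [rowScale, hx]
    have := DFunLike.congr_fun this g
    simpa [Polynomial.aeval_def] using this
  have e0 : ∀ g : MvPolynomial (ι × κ) K, (rowScale q g).eval 0 =
      MvPolynomial.bind₁ (fun x => if x.1 = q then 0 else MvPolynomial.X x) g := by
    intro g
    have : ((Polynomial.aeval (R := MvPolynomial (ι × κ) K) (0 : MvPolynomial (ι × κ) K)).restrictScalars K).comp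
        (rowScale q) = MvPolynomial.bind₁ (fun x => if x.1 = q then 0 else MvPolynomial.X x) := by
      ext x : 1
      by_cases hx : x.1 = q <;> simp [rowScale, hx]
    have := DFunLike.congr_fun this g
    simpa [Polynomial.aeval_def] using this
  have h2 : h = MvPolynomial.bind₁ (fun x => if x.1 = q then 0 else MvPolynomial.X x) h := by
    have e2 := e1 h
    have e3 := e0 h
    rw [h1, Polynomial.eval_C] at e2 e3
    exact e2.symm.trans e3
  intro c hc
  rw [h2] at hc
  obtain ⟨x, -, hx⟩ := MvPolynomial.mem_vars_bind₁ _ _ hc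
  split_ifs at hx with h3
  · simp at hx
  · rw [MvPolynomial.vars_X, Finset.mem_singleton] at hx
    exact h3 (hx ▸ rfl)

theorem natDegree_rowScale_add {q : ι} {g h : MvPolynomial (ι × κ) K} (h0 : g * h ≠ 0) {d : ℕ}
    (hs : rowScale q (g * h) = Polynomial.X ^ d * Polynomial.C (g * h)) :
    (rowScale q g).natDegree + (rowScale q h).natDegree = d := by
  have hd : (rowScale q (g * h)).natDegree = d := by
    rw [hs, Polynomial.natDegree_X_pow_mul _ (Polynomial.C_ne_zero.2 h0), Polynomial.natDegree_C,
      zero_add]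
  have hne : rowScale q (g * h) ≠ 0 := by
    rw [hs]
    exact mul_ne_zero (pow_ne_zero _ Polynomial.X_ne_zero) (Polynomial.C_ne_zero.2 h0)
  rw [map_mul] at hd hne
  rw [← hd, Polynomial.natDegree_mul (left_ne_zero_of_mul hne) (right_ne_zero_of_mul hne)]

/-- Replacing row `q` by row `p`. -/
noncomputable def rowReplace (q p : ι) : MvPolynomial (ι × κ) K →ₐ[K] MvPolynomial (ι × κ) K :=
  MvPolynomial.bind₁ fun x => MvPolynomial.X (if x.1 = q then p else x.1, x.2)

/-- By linearity each row of Q occurs in exactly one factor. If q occurs in g and p in h, replacing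
row q by row p fixes h and merely renames variables in g, so the product stays nonzero, although it
should vanish. -/
theorem freeOfRow_or {Q : Set ι} {g h : MvPolynomial (ι × κ) K} (h0 : g * h ≠ 0)
    (hs : ∀ q ∈ Q, rowScale q (g * h) = Polynomial.X * Polynomial.C (g * h))
    (hr : ∀ q ∈ Q, ∀ p ∈ Q, q ≠ p → rowReplace q p (g * h) = 0) :
    (∀ q ∈ Q, FreeOfRow q g) ∨ (∀ q ∈ Q, FreeOfRow q h) := by
  by_contra hcon
  push Not at hcon
  obtain ⟨⟨q, hq, hqg⟩, ⟨p, hp, hph⟩⟩ := hcon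
  have hdeg : ∀ q ∈ Q, FreeOfRow q g ∨ FreeOfRow q h := by
    intro q hq
    have := natDegree_rowScale_add h0 (d := 1) (by rw [pow_one]; exact hs q hq)
    rcases Nat.eq_zero_or_pos (rowScale q g).natDegree with h1 | h1
    · exact Or.inl (freeOfRow_of_natDegree_eq_zero h1)
    · exact Or.inr (freeOfRow_of_natDegree_eq_zero (by omega))
  have hqh := (hdeg q hq).resolve_left hqg
  have hpg := (hdeg p hp).resolve_right hph
  have hqp : q ≠ p := fun e => hqg (e ▸ hpg)
  have e1 : rowReplace q p h = h := by
    refine (algHom_eq_of_freeOfRow (rowReplace q p) (AlgHom.id K _) (Q := {q}) ?_ ?_)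
    · rintro _ rfl
      exact hqh
    · intro s hs c
      have : s ≠ q := hs
      simp [rowReplace, this]
  have e2 : rowReplace p q (rowReplace q p g) = g := by
    refine (algHom_eq_of_freeOfRow ((rowReplace p q).comp (rowReplace q p)) (AlgHom.id K _)
      (Q := {p}) ?_ ?_)
    · rintro _ rfl
      exact hpg
    · intro s hs c
      have : s ≠ p := hs
      by_cases hsq : s = q
      · simp [rowReplace, hsq]
      · simp [rowReplace, hsq, this]
  have e3 := hr q hq p hp hqp
  rw [map_mul, e1, mul_eq_zero] at e3
  rcases e3 with e3 | e3
  · rw [e3, map_zero] at e2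
    exact h0 (by rw [← e2, zero_mul])
  · exact h0 (by rw [e3, mul_zero])

end RowDegree

section Minors

variable {R : Type*} [CommRing R]

theorem plucker_congr {m n : ℕ} {A B : Matrix (Fin m) (Fin n) R} {J : Finset (Fin n)}
    (h : ∀ p : Fin m, (p : ℕ) < J.card → A p = B p) : plucker A J = plucker B J := by
  unfold plucker
  split_ifs with hJ
  · congr 1
    ext p q
    rw [Matrix.submatrix_apply, Matrix.submatrix_apply, h _ p.2]
  · rfl

theorem plucker_mul_rows {m n : ℕ} (A : Matrix (Fin m) (Fin n) R) (J : Finset (Fin n))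
    (v : Fin m → R) : plucker (Matrix.of fun p c => v p * A p c) J =
      (∏ p ∈ Finset.univ.filter fun p : Fin m => (p : ℕ) < J.card, v p) * plucker A J := by
  unfold plucker
  split_ifs with hJ
  · have e : (Finset.univ.filter fun p : Fin m => (p : ℕ) < J.card) =
        Finset.univ.map (Fin.castLEEmb hJ) := by
      ext p
      simp only [Finset.mem_filter, Finset.mem_univ, true_and, Finset.mem_map]
      constructor
      · exact fun h => ⟨⟨p, h⟩, rfl⟩
      · rintro ⟨q, rfl⟩
        exact q.2
    rw [e, Finset.prod_map]
    exact Matrix.det_mul_column _ _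
  · rw [mul_zero]

theorem plucker_eq_zero_of_row_eq {m n : ℕ} {A : Matrix (Fin m) (Fin n) R} {J : Finset (Fin n)}
    {p q : Fin m} (hp : (p : ℕ) < J.card) (hq : (q : ℕ) < J.card) (hpq : p ≠ q)
    (h : A p = A q) : plucker A J = 0 := by
  unfold plucker
  split_ifs with hJ
  · refine Matrix.det_zero_of_row_eq (i := ⟨p, hp⟩) (j := ⟨q, hq⟩) (fun e => hpq ?_) ?_
    · exact Fin.ext (Fin.mk.inj_iff.1 e)
    · funext c
      exact congrFun h _
  · rfl

theorem plucker_eq_zero_of_row_eq_zero {m n : ℕ} {A : Matrix (Fin m) (Fin n) R}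
    {J : Finset (Fin n)} {p : Fin m} (hp : (p : ℕ) < J.card) (h : ∀ c ∈ J, A p c = 0) :
    plucker A J = 0 := by
  unfold plucker
  split_ifs with hJ
  · exact Matrix.det_eq_zero_of_row_eq_zero ⟨p, hp⟩ fun c =>
      h _ (Finset.orderEmbOfFin_mem J rfl c)
  · rfl

/-- Evaluation of a minor whose last rows are coordinate vectors. -/
theorem exists_plucker_eq_of_single_rows {r n a u : ℕ} {B : Matrix (Fin r) (Fin n) R}
    {U W : Finset (Fin n)} (hU : U.card = u) (hW : W.card = a + u) (hUW : U ⊆ W)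
    (hr : a + u ≤ r)
    (hB : ∀ t : Fin u, B (Fin.castLE hr (Fin.natAdd a t)) = Pi.single (U.orderEmbOfFin hU t) 1) :
    ∃ e : ℕ, plucker B W = (-1) ^ e * plucker B (W \ U) := by
  classical
  set φ := W.orderEmbOfFin hW with hφ
  have hφW : ∀ d ∈ W, ∃ c, φ c = d := fun d hd => by
    have : d ∈ Set.range φ := by simpa [hφ] using hd
    exact this
  set U' : Finset (Fin (a + u)) := Finset.univ.filter fun c => φ c ∈ U with hU'
  have him : U'.image φ = U := by
    ext d
    simp only [hU', Finset.mem_image, Finset.mem_filter, Finset.mem_univ, true_and]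
    constructor
    · rintro ⟨c, hc, rfl⟩
      exact hc
    · intro hd
      obtain ⟨c, rfl⟩ := hφW d (hUW hd)
      exact ⟨c, hd, rfl⟩
  have himc : U'ᶜ.image φ = W \ U := by
    ext d
    simp only [hU', Finset.mem_image, Finset.mem_compl, Finset.mem_filter, Finset.mem_univ,
      true_and, Finset.mem_sdiff]
    constructor
    · rintro ⟨c, hc, rfl⟩
      exact ⟨Finset.orderEmbOfFin_mem W hW c, hc⟩
    · rintro ⟨hd, hd'⟩
      obtain ⟨c, rfl⟩ := hφW d hd
      exact ⟨c, hd', rfl⟩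
  have hcU' : U'.card = u := by
    rw [← Finset.card_image_of_injective U' φ.injective, him, hU]
  have hcU'c : U'ᶜ.card = a := by
    rw [Finset.card_compl, hcU', Fintype.card_fin]
    omega
  have horder : φ ∘ U'.orderEmbOfFin hcU' = U.orderEmbOfFin hU := by
    refine Finset.orderEmbOfFin_unique hU (fun x => ?_) fun x y hxy => ?_
    · rw [← him]
      exact Finset.mem_image_of_mem _ (Finset.orderEmbOfFin_mem U' hcU' x)
    · exact φ.strictMono ((U'.orderEmbOfFin hcU').strictMono hxy)
  let X : Fin a → Fin (a + u) → R := fun p c => B (Fin.castLE hr (Fin.castAdd u p)) (φ c)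
  let Y : Fin u → Fin (a + u) → R := fun t => Pi.single (U'.orderEmbOfFin hcU' t) 1
  have hdet : plucker B W = (stack X Y).det := by
    rw [plucker_eq_det B hW hr]
    congr 1
    ext p c
    refine Fin.addCases (fun q => ?_) (fun q => ?_) p
    · rw [stack_castAdd]
      rfl
    · rw [stack_natAdd, Matrix.submatrix_apply, hB, ← horder]
      simp only [Y, Pi.single_apply, Function.comp_apply, ← hφ, EmbeddingLike.apply_eq_iff_eq]
  refine ⟨∑ c ∈ U'ᶜ, (c : ℕ) + ∑ p : Fin a, (p : ℕ), ?_⟩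
  rw [hdet, det_stack, Finset.sum_eq_single U'ᶜ]
  · rw [compl_compl, plucker_single hcU' hcU', if_pos rfl, mul_one]
    congr 1
    rw [← himc]
    exact plucker_eq_plucker_image (Nat.le_add_right a u |>.trans hr) hcU'c
      (φ.strictMono.strictMonoOn _) fun p c _ => rfl
  · intro S hS hne
    have hSc : Sᶜ.card = u := by
      rw [Finset.card_compl, (Finset.mem_powersetCard.1 hS).2, Fintype.card_fin]
      omega
    rw [plucker_single hcU' hSc, if_neg, mul_zero]
    rintro e
    exact hne (by rw [e, compl_compl])
  · intro h
    exact absurd (Finset.mem_powersetCard.2 ⟨Finset.subset_univ _, hcU'c⟩) h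

end Minors

section Generic

variable {K : Type*} [Field K] {r n : ℕ}

/-- The `r × n` matrix of indeterminates. -/
noncomputable abbrev genericMatrix (K : Type*) [Field K] (r n : ℕ) :
    Matrix (Fin r) (Fin n) (MvPolynomial (Fin r × Fin n) K) :=
  Matrix.mvPolynomialX (Fin r) (Fin n) K

theorem algHom_plucker_generic {S : Type*} [CommRing S] [Algebra K S]
    (φ : MvPolynomial (Fin r × Fin n) K →ₐ[K] S) (J : Finset (Fin n)) :
    φ (plucker (genericMatrix K r n) J) = plucker (Matrix.of fun p c => φ (MvPolynomial.X (p, c))) J :=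
  map_plucker φ.toRingHom _ J

theorem rowScale_plucker (q : Fin r) (J : Finset (Fin n)) :
    rowScale q (plucker (genericMatrix K r n) J) =
      (if (q : ℕ) < J.card then Polynomial.X else 1) * Polynomial.C (plucker (genericMatrix K r n) J) := by
  rw [algHom_plucker_generic]
  have e : (Matrix.of fun p c => rowScale q (MvPolynomial.X (R := K) (p, c))) =
      Matrix.of fun (p : Fin r) (c : Fin n) => (if p = q then Polynomial.X else 1) *
        ((genericMatrix K r n).map Polynomial.C) p c := by
    ext1 p c
    simp [rowScale]
  rw [e, plucker_mul_rows, ← map_plucker, Finset.prod_ite_eq']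
  simp

theorem rowReplace_plucker {q p : Fin r} (hqp : q ≠ p) {J : Finset (Fin n)}
    (hq : (q : ℕ) < J.card) (hp : (p : ℕ) < J.card) : rowReplace q p (plucker (genericMatrix K r n) J) = 0 := by
  rw [algHom_plucker_generic]
  refine plucker_eq_zero_of_row_eq hq hp hqp ?_
  funext c
  simp [rowReplace]

/-- The point is the matrix whose first rows are the coordinate vectors of S; it separates minors of
equal size. -/
theorem exists_aeval_plucker {S : Finset (Fin n)} (hS : S.card ≤ r) :
    ∃ x : Fin r × Fin n → K, ∀ T : Finset (Fin n), T.card = S.card →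
      MvPolynomial.aeval x (plucker (genericMatrix K r n) T) = if S = T then 1 else 0 := by
  let x : Fin r × Fin n → K := fun x =>
    if h : (x.1 : ℕ) < S.card then (Pi.single (S.orderEmbOfFin rfl ⟨x.1, h⟩) 1 : Fin n → K) x.2
    else 0
  refine ⟨x, fun T hT => ?_⟩
  rw [algHom_plucker_generic, ← plucker_single (R := K) (a := S.card) rfl hT,
    plucker_eq_det _ hT hS, plucker_eq_det _ hT le_rfl]
  congr 1
  ext p c
  simp [x]

theorem plucker_generic_ne_zero {J : Finset (Fin n)} (hJ : J.card ≤ r) : plucker (genericMatrix K r n) J ≠ 0 := by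
  intro h
  obtain ⟨x, hx⟩ := exists_aeval_plucker (K := K) hJ
  have := hx J rfl
  rw [h, map_zero, if_pos rfl] at this
  exact zero_ne_one this

theorem eq_of_plucker_dvd {S T : Finset (Fin n)} (hS : S.card ≤ r) (hT : T.card = S.card)
    (h : plucker (genericMatrix K r n) T ∣ plucker (genericMatrix K r n) S) : S = T := by
  obtain ⟨x, hx⟩ := exists_aeval_plucker (K := K) hS
  obtain ⟨f, hf⟩ := h
  have h1 := congrArg (MvPolynomial.aeval x) hf
  rw [map_mul, hx S rfl, hx T hT, if_pos rfl] at h1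
  by_contra hne
  rw [if_neg hne, zero_mul] at h1
  exact one_ne_zero h1

/-- A minor is linear and alternating in its rows, so one factor involves none of them and is
constant. -/
theorem irreducible_plucker {J : Finset (Fin n)} (h0 : J.Nonempty) (hJ : J.card ≤ r) :
    Irreducible (plucker (genericMatrix K r n) J) := by
  have hne := plucker_generic_ne_zero (K := K) hJ
  refine ⟨fun hu => ?_, fun g h hgh => ?_⟩
  · have hpos := h0.card_pos
    have := hu.map (MvPolynomial.aeval (R := K) (fun _ : Fin r × Fin n => (0 : K)))
    rw [algHom_plucker_generic, plucker_eq_zero_of_row_eq_zero (p := ⟨0, by omega⟩) hpos] at this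
    · exact not_isUnit_zero this
    · intro c _
      simp
  · have hs := fun q : Fin r => rowScale_plucker (K := K) q J
    have hr : ∀ q ∈ {q : Fin r | (q : ℕ) < J.card}, ∀ p ∈ {q : Fin r | (q : ℕ) < J.card}, q ≠ p →
        rowReplace q p (plucker (genericMatrix K r n) J) = 0 := fun q hq p hp hqp => rowReplace_plucker hqp hq hp
    rw [hgh] at hs hne hr
    have hfree : ∀ q : Fin r, ¬ (q : ℕ) < J.card → FreeOfRow q g ∧ FreeOfRow q h := by
      intro q hq
      have := natDegree_rowScale_add hne (d := 0) (q := q) (by rw [hs, if_neg hq, pow_zero])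
      exact ⟨freeOfRow_of_natDegree_eq_zero (by omega), freeOfRow_of_natDegree_eq_zero (by omega)⟩
    rcases freeOfRow_or (Q := {q : Fin r | (q : ℕ) < J.card}) hne
      (fun q hq => (hs q).trans (by rw [if_pos (show (q : ℕ) < J.card from hq)])) hr with h1 | h1
    · left
      refine isUnit_of_freeOfRow (left_ne_zero_of_mul hne) fun q => ?_
      by_cases hq : (q : ℕ) < J.card
      · exact h1 q hq
      · exact (hfree q hq).1
    · right
      refine isUnit_of_freeOfRow (right_ne_zero_of_mul hne) fun q => ?_
      by_cases hq : (q : ℕ) < J.card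
      · exact h1 q hq
      · exact (hfree q hq).2

end Generic

end FlagVariety

/-! ### Irreducibility of the quadratic equation. -/

namespace FlagVariety

section

variable {K : Type*} [Field K] {r n a b i : ℕ}

/-- The equation of the projected Richardson divisor, in the entries of the generic matrix. -/
noncomputable def incidencePoly (K : Type*) [Field K] (r n a b i : ℕ) :
    MvPolynomial (Fin r × Fin n) K :=
  ∑ J ∈ (interval n 0 (min i (n - b + (i - a)))).powersetCard (i - a),
    (-1) ^ indexSum J * plucker (genericMatrix K r n) (interval n 0 i \ J) *
      plucker (genericMatrix K r n) (J ∪ interval n (n - b + (i - a)) n)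

theorem card_index (hai : a < i) (hib : i < b) (hb : b < n) {J : Finset (Fin n)}
    (hJ : J ∈ (interval n 0 (min i (n - b + (i - a)))).powersetCard (i - a)) :
    (interval n 0 i \ J).card = a ∧ (J ∪ interval n (n - b + (i - a)) n).card = b ∧
      Disjoint J (interval n (n - b + (i - a)) n) := by
  obtain ⟨h1, h2⟩ := Finset.mem_powersetCard.1 hJ
  have h3 : ∀ c ∈ J, (c : ℕ) < min i (n - b + (i - a)) := fun c hc => (mem_interval.1 (h1 hc)).2
  have h4 : Disjoint J (interval n (n - b + (i - a)) n) := by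
    rw [Finset.disjoint_left]
    intro c hc hc'
    have := h3 c hc
    have := (mem_interval.1 hc').1
    omega
  refine ⟨?_, ?_, h4⟩
  · rw [Finset.card_sdiff_of_subset, card_interval (by omega), h2]
    · omega
    · intro c hc
      have := h3 c hc
      exact mem_interval.2 ⟨Nat.zero_le _, by omega⟩
  · rw [Finset.card_union_of_disjoint h4, card_interval le_rfl, h2]
    omega

/-- Rows from a on enter only the second minor of each product, whence degree one for a ≤ q < b and
zero beyond. Rows before a enter both minors and need another argument. -/
theorem rowScale_incidencePoly (hai : a < i) (hib : i < b) (hb : b < n)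
    (q : Fin r) (haq : a ≤ (q : ℕ)) :
    rowScale q (incidencePoly K r n a b i) =
      (if (q : ℕ) < b then Polynomial.X else 1) * Polynomial.C (incidencePoly K r n a b i) := by
  rw [incidencePoly, map_sum, map_sum, Finset.mul_sum]
  refine Finset.sum_congr rfl fun J hJ => ?_
  obtain ⟨h1, h2, -⟩ := card_index hai hib hb hJ
  simp only [map_mul, rowScale_plucker, h1, h2, map_pow, map_neg, map_one, if_neg (not_lt.2 haq)]
  ring

theorem rowReplace_incidencePoly (hai : a < i) (hib : i < b) (hb : b < n) 
    {q p : Fin r} (hqp : q ≠ p) (hq : (q : ℕ) < b)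
    (hp : (p : ℕ) < b) : rowReplace q p (incidencePoly K r n a b i) = 0 := by
  rw [incidencePoly, map_sum]
  refine Finset.sum_eq_zero fun J hJ => ?_
  obtain ⟨-, h2, -⟩ := card_index hai hib hb hJ
  rw [map_mul, rowReplace_plucker hqp (by omega) (by omega), mul_zero]

/-- Rows a, …, b - 1 are replaced by the coordinate vectors of P ∪ Q. This kills every term with J ≠
P, since some row is then zero on the chosen columns, and leaves a product of two minors of size a.
-/
theorem exists_specialization (hai : a < i) (hib : i < b) (hb : b < n) (hbr : b ≤ r)
    {P Q : Finset (Fin n)}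
    (hP : P ∈ (interval n 0 (min i (n - b + (i - a)))).powersetCard (i - a))
    (hQ : Q ∈ (interval n (n - b + (i - a)) n).powersetCard (b - i)) :
    ∃ σ : MvPolynomial (Fin r × Fin n) K →ₐ[K] MvPolynomial (Fin r × Fin n) K,
      (∀ (p : Fin r) (c : Fin n), (p : ℕ) < a → σ (MvPolynomial.X (p, c)) = MvPolynomial.X (p, c)) ∧
      ∃ e : ℕ, σ (incidencePoly K r n a b i) =
        (-1) ^ e * (plucker (genericMatrix K r n) (interval n 0 i \ P) *
          plucker (genericMatrix K r n) (interval n (n - b + (i - a)) n \ Q)) := by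
  obtain ⟨hP1, hP2⟩ := Finset.mem_powersetCard.1 hP
  obtain ⟨hQ1, hQ2⟩ := Finset.mem_powersetCard.1 hQ
  obtain ⟨hc1, hc2, hdisj⟩ := card_index hai hib hb hP
  set V := interval n (n - b + (i - a)) n with hV
  have hU : (P ∪ Q).card = b - a := by
    rw [Finset.card_union_of_disjoint (hdisj.mono_right hQ1), hP2, hQ2]
    omega
  have hab : a + (b - a) = b := by omega
  let g : Fin r × Fin n → MvPolynomial (Fin r × Fin n) K := fun x =>
    if h : a ≤ (x.1 : ℕ) ∧ (x.1 : ℕ) < b then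
      (Pi.single ((P ∪ Q).orderEmbOfFin hU ⟨x.1 - a, by omega⟩) 1 : Fin n → _) x.2
    else MvPolynomial.X x
  have hg : ∀ (p : Fin r) c, (p : ℕ) < a → g (p, c) = MvPolynomial.X (p, c) := fun p c hp =>
    dif_neg (by simp only; omega)
  refine ⟨MvPolynomial.bind₁ g, fun p c hp => ?_, ?_⟩
  · rw [MvPolynomial.bind₁_X_right, hg p c hp]
  set B : Matrix (Fin r) (Fin n) (MvPolynomial (Fin r × Fin n) K) :=
    Matrix.of fun p c => g (p, c) with hBdef
  have hpl : ∀ J, MvPolynomial.bind₁ g (plucker (genericMatrix K r n) J) = plucker B J := by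
    intro J
    rw [algHom_plucker_generic]
    simp only [MvPolynomial.bind₁_X_right]
    rfl
  have hBtop : ∀ J : Finset (Fin n), J.card ≤ a → plucker B J = plucker (genericMatrix K r n) J :=
    fun J hJ => plucker_congr fun p hp => funext fun c => hg p c (by omega)
  have hrow : ∀ t : Fin (b - a), B (Fin.castLE (hab.le.trans hbr) (Fin.natAdd a t)) =
      Pi.single ((P ∪ Q).orderEmbOfFin hU t) 1 := by
    intro t
    funext c
    simp only [hBdef, Matrix.of_apply, g]
    rw [dif_pos (by simp only [Fin.val_castLE, Fin.val_natAdd]; omega)]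
    congr 3
    simp
  obtain ⟨e, he⟩ := exists_plucker_eq_of_single_rows hU (hc2.trans hab.symm)
    (Finset.union_subset_union_right hQ1) (hab.le.trans hbr) hrow
  have hWU : (P ∪ V) \ (P ∪ Q) = V \ Q := by
    ext c
    simp only [Finset.mem_sdiff, Finset.mem_union]
    constructor
    · rintro ⟨h1 | h1, h2⟩
      · exact absurd (Or.inl h1) h2
      · exact ⟨h1, fun h => h2 (Or.inr h)⟩
    · rintro ⟨h1, h2⟩
      exact ⟨Or.inr h1, fun h => h.elim (fun h => Finset.disjoint_left.1 hdisj h h1) h2⟩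
  have hVQ : (V \ Q).card = a := by
    rw [Finset.card_sdiff_of_subset hQ1, card_interval le_rfl, hQ2]
    omega
  refine ⟨indexSum P + e, ?_⟩
  rw [incidencePoly, map_sum, Finset.sum_eq_single P]
  · rw [map_mul, map_mul, map_pow, map_neg, map_one, hpl, hpl, he, hWU, hBtop _ hc1.le,
      hBtop _ hVQ.le, pow_add]
    ring
  · intro J hJ hne
    obtain ⟨hJ1, hJ2⟩ := Finset.mem_powersetCard.1 hJ
    obtain ⟨-, hJb, -⟩ := card_index hai hib hb hJ
    have : ∃ c ∈ P, c ∉ J := by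
      by_contra h
      push Not at h
      exact hne (Finset.eq_of_subset_of_card_le h (by omega)).symm
    obtain ⟨c, hcP, hcJ⟩ := this
    have hcU : c ∈ Set.range ((P ∪ Q).orderEmbOfFin hU) := by
      simpa using Or.inl hcP
    obtain ⟨t, rfl⟩ := hcU
    have h0 : plucker B (J ∪ V) = 0 := by
      refine plucker_eq_zero_of_row_eq_zero
        (p := Fin.castLE (hab.le.trans hbr) (Fin.natAdd a t)) ?_ fun d hd => ?_
      · rw [hJb]
        simp only [Fin.val_castLE, Fin.val_natAdd]
        omega
      · rw [hrow]
        refine Pi.single_eq_of_ne ?_ _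
        rintro rfl
        rcases Finset.mem_union.1 hd with h | h
        · exact hcJ h
        · exact Finset.disjoint_left.1 hdisj hcP h
    rw [map_mul, hpl (J ∪ V), h0, mul_zero]
  · exact fun h => absurd hP h

theorem exists_two_subsets {α : Type*} [DecidableEq α] {S : Finset α} {k : ℕ} (hk : 0 < k)
    (hS : k < S.card) : ∃ P ∈ S.powersetCard k, ∃ P' ∈ S.powersetCard k, P ≠ P' := by
  have : 1 < (S.powersetCard k).card := by
    rw [Finset.card_powersetCard]
    have h1 := Nat.choose_pos hS.le
    have h2 : S.card.choose k ≠ 1 := fun h => by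
      rcases Nat.choose_eq_one_iff.1 h with h | h <;> omega
    omega
  obtain ⟨P, hP, P', hP', h⟩ := Finset.one_lt_card.1 this
  exact ⟨P, hP, P', hP', h⟩

theorem incidencePoly_ne_zero (ha : 0 < a) (hai : a < i) (hib : i < b) (hb : b < n) (hbr : b ≤ r) :
    incidencePoly K r n a b i ≠ 0 := by
  obtain ⟨P, hP, -⟩ := exists_two_subsets
    (S := interval n 0 (min i (n - b + (i - a)))) (k := i - a) (by omega)
    (by rw [card_interval (by omega)]; omega)
  obtain ⟨Q, hQ, -⟩ := exists_two_subsets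
    (S := interval n (n - b + (i - a)) n) (k := b - i) (by omega)
    (by rw [card_interval le_rfl]; omega)
  obtain ⟨σ, -, e, he⟩ := exists_specialization (K := K) hai hib hb hbr hP hQ
  intro h
  rw [h, map_zero] at he
  have h1 : (interval n 0 i \ P).card ≤ r := by
    rw [(card_index hai hib hb hP).1]
    omega
  have h2 : (interval n (n - b + (i - a)) n \ Q).card ≤ r := by
    rw [Finset.card_sdiff_of_subset (Finset.mem_powersetCard.1 hQ).1, card_interval le_rfl,
      (Finset.mem_powersetCard.1 hQ).2]
    omega
  refine mul_ne_zero (pow_ne_zero e (neg_ne_zero.2 one_ne_zero))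
    (mul_ne_zero (plucker_generic_ne_zero h1) (plucker_generic_ne_zero h2)) he.symm

/-- A divisor in the first a rows is fixed by all the specializations, so a prime factor of it
divides each product of two irreducible minors. It can divide only one minor of size a up to
equality, but there are at least two choices of P and of Q. -/
theorem isUnit_of_dvd_incidencePoly (ha : 0 < a) (hai : a < i) (hib : i < b) (hb : b < n) (hbr : b ≤ r)
    {h : MvPolynomial (Fin r × Fin n) K}
    (hdvd : h ∣ incidencePoly K r n a b i) (hfree : ∀ q : Fin r, a ≤ (q : ℕ) → FreeOfRow q h) :
    IsUnit h := by
  by_contra hu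
  have h0 : h ≠ 0 := fun e => incidencePoly_ne_zero ha hai hib hb hbr
    (zero_dvd_iff.1 (e ▸ hdvd))
  obtain ⟨p, hp, hph⟩ := WfDvdMonoid.exists_irreducible_factor hu h0
  have hpp : Prime p := UniqueFactorizationMonoid.irreducible_iff_prime.1 hp
  set V := interval n (n - b + (i - a)) n with hV
  have hVcard : V.card = b - (i - a) := by
    rw [card_interval le_rfl]
    omega
  have hdiv : ∀ P ∈ (interval n 0 (min i (n - b + (i - a)))).powersetCard (i - a),
      ∀ Q ∈ V.powersetCard (b - i),
      p ∣ plucker (genericMatrix K r n) (interval n 0 i \ P) ∨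
        p ∣ plucker (genericMatrix K r n) (V \ Q) := by
    intro P hP Q hQ
    obtain ⟨σ, hσ, e, he⟩ := exists_specialization (K := K) hai hib hb hbr hP hQ
    have h1 : σ h = h := algHom_eq_of_freeOfRow σ (AlgHom.id K _) (Q := {q | a ≤ (q : ℕ)})
      (fun q hq => hfree q hq) fun q hq c => hσ q c (by simpa using hq)
    have h2 := map_dvd σ hdvd
    rw [h1, he] at h2
    have h3 := hph.trans h2
    rw [((isUnit_one.neg).pow e).dvd_mul_left] at h3
    exact hpp.dvd_or_dvd h3
  have huniq : ∀ S T : Finset (Fin n), S.card = a → T.card = a →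
      p ∣ plucker (genericMatrix K r n) S → p ∣ plucker (genericMatrix K r n) T → S = T := by
    intro S T hS hT h1 h2
    have hirr : ∀ S : Finset (Fin n), S.card = a → Irreducible (plucker (genericMatrix K r n) S) :=
      fun S hS => irreducible_plucker (Finset.card_pos.1 (by omega)) (by omega)
    have h3 := hp.associated_of_dvd (hirr S hS) h1
    have h4 := hp.associated_of_dvd (hirr T hT) h2
    exact eq_of_plucker_dvd (K := K) (by omega) (hT.trans hS.symm) (h4.symm.trans h3).dvd
  obtain ⟨P, hP, P', hP', hPP'⟩ := exists_two_subsets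
    (S := interval n 0 (min i (n - b + (i - a)))) (k := i - a) (by omega)
    (by rw [card_interval (by omega)]; omega)
  obtain ⟨Q, hQ, Q', hQ', hQQ'⟩ := exists_two_subsets (S := V) (k := b - i) (by omega) (by omega)
  have hcP : ∀ P ∈ (interval n 0 (min i (n - b + (i - a)))).powersetCard (i - a),
      (interval n 0 i \ P).card = a ∧ P ⊆ interval n 0 i := by
    intro P hP
    refine ⟨(card_index hai hib hb hP).1, fun c hc => ?_⟩
    have := (mem_interval.1 ((Finset.mem_powersetCard.1 hP).1 hc)).2
    exact mem_interval.2 ⟨Nat.zero_le _, by omega⟩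
  have hcQ : ∀ Q ∈ V.powersetCard (b - i), (V \ Q).card = a ∧ Q ⊆ V := by
    intro Q hQ
    obtain ⟨h1, h2⟩ := Finset.mem_powersetCard.1 hQ
    exact ⟨by rw [Finset.card_sdiff_of_subset h1, hVcard, h2]; omega, h1⟩
  have hneP : interval n 0 i \ P ≠ interval n 0 i \ P' := by
    intro e
    apply hPP'
    rw [← Finset.sdiff_sdiff_eq_self (hcP P hP).2, e, Finset.sdiff_sdiff_eq_self (hcP P' hP').2]
  have hneQ : V \ Q ≠ V \ Q' := by
    intro e
    apply hQQ'
    rw [← Finset.sdiff_sdiff_eq_self (hcQ Q hQ).2, e, Finset.sdiff_sdiff_eq_self (hcQ Q' hQ').2]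
  have hP2 := fun h1 h2 => hneP (huniq _ _ (hcP P hP).1 (hcP P' hP').1 h1 h2)
  have hQ2 := fun h1 h2 => hneQ (huniq _ _ (hcQ Q hQ).1 (hcQ Q' hQ').1 h1 h2)
  have d1 := hdiv P hP Q hQ
  have d2 := hdiv P hP Q' hQ'
  have d3 := hdiv P' hP' Q hQ
  have d4 := hdiv P' hP' Q' hQ'
  -- The prime misses the minor of P or of P', and that of Q or of Q'; the product for the missed
  -- pair is a contradiction.
  tauto

/-- The equation is linear and alternating in the rows a, …, b - 1, so one factor avoids them. That
factor lives in the first a rows and is therefore a unit. -/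
theorem irreducible_incidencePoly (ha : 0 < a) (hai : a < i) (hib : i < b) (hb : b < n) (hbr : b ≤ r) :
    Irreducible (incidencePoly K r n a b i) := by
  have hne := incidencePoly_ne_zero (K := K) ha hai hib hb hbr
  refine ⟨fun hu => ?_, fun g h hgh => ?_⟩
  · have hz := hu.map (MvPolynomial.aeval (R := K) (fun _ : Fin r × Fin n => (0 : K)))
    rw [incidencePoly, map_sum, Finset.sum_eq_zero] at hz
    · exact not_isUnit_zero hz
    · intro J hJ
      have h1 : plucker (Matrix.of fun p c => MvPolynomial.aeval (R := K)
          (fun _ : Fin r × Fin n => (0 : K)) (MvPolynomial.X (p, c)))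
          (J ∪ interval n (n - b + (i - a)) n) = 0 := by
        refine plucker_eq_zero_of_row_eq_zero (p := ⟨0, by omega⟩) ?_ fun c _ => by simp
        rw [(card_index hai hib hb hJ).2.1]
        simp only
        omega
      rw [map_mul, algHom_plucker_generic _ (J ∪ _), h1, mul_zero]
  · have hs := rowScale_incidencePoly (K := K) (r := r) hai hib hb
    have hr : ∀ q ∈ {q : Fin r | a ≤ (q : ℕ) ∧ (q : ℕ) < b},
        ∀ p ∈ {q : Fin r | a ≤ (q : ℕ) ∧ (q : ℕ) < b}, q ≠ p →
        rowReplace q p (incidencePoly K r n a b i) = 0 :=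
      fun q hq p hp hqp => rowReplace_incidencePoly hai hib hb hqp hq.2 hp.2
    have hfac : ∀ h : MvPolynomial (Fin r × Fin n) K, h ∣ incidencePoly K r n a b i →
        (∀ q ∈ {q : Fin r | a ≤ (q : ℕ) ∧ (q : ℕ) < b}, FreeOfRow q h) →
        (∀ q : Fin r, b ≤ (q : ℕ) → FreeOfRow q h) → IsUnit h := by
      intro h h1 h2 h3
      refine isUnit_of_dvd_incidencePoly ha hai hib hb hbr h1 fun q hq => ?_
      rcases lt_or_ge (q : ℕ) b with h4 | h4
      · exact h2 q ⟨hq, h4⟩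
      · exact h3 q h4
    rw [hgh] at hs hne hr hfac
    have hfree : ∀ q : Fin r, b ≤ (q : ℕ) → FreeOfRow q g ∧ FreeOfRow q h := by
      intro q hq
      have := natDegree_rowScale_add hne (d := 0) (q := q)
        (by rw [hs q (by omega), if_neg (by omega), pow_zero])
      exact ⟨freeOfRow_of_natDegree_eq_zero (by omega), freeOfRow_of_natDegree_eq_zero (by omega)⟩
    rcases freeOfRow_or (Q := {q : Fin r | a ≤ (q : ℕ) ∧ (q : ℕ) < b}) hne
      (fun q hq => (hs q hq.1).trans (by rw [if_pos hq.2])) hr with h1 | h1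
    · exact Or.inl (hfac g (dvd_mul_right g h) h1 fun q hq => (hfree q hq).1)
    · exact Or.inr (hfac h (dvd_mul_left h g) h1 fun q hq => (hfree q hq).2)

end

end FlagVariety

/-! ### From irreducible equations to ideals, and the five cases. -/

namespace FlagVariety

variable {n : ℕ}

theorem linearIndependent_row_of_plucker_ne_zero {r : ℕ} {A : Matrix (Fin r) (Fin n) ℂ}
    {J : Finset (Fin n)} (hJ : J.card = r) (h : plucker A J ≠ 0) :
    LinearIndependent ℂ A.row := by
  rw [plucker_eq_det A hJ le_rfl] at h
  have h1 := Matrix.linearIndependent_rows_of_det_ne_zero h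
  exact LinearIndependent.of_comp (LinearMap.funLeft ℂ ℂ (J.orderEmbOfFin hJ)) h1

theorem exists_flag_of_linearIndependent {D : Finset ℕ} {A : Matrix (Fin (D.sup id)) (Fin n) ℂ}
    (hA : LinearIndependent ℂ A.row) : ∃ F : PartialFlag n D, Represents A F := by
  refine ⟨⟨fun j => Submodule.span ℂ (A.row '' {a | (a : ℕ) < (j : ℕ)}), fun j => ?_,
    fun i j hij => Submodule.span_mono (Set.image_mono fun a ha => lt_of_lt_of_le ha hij)⟩,
    hA, fun j => rfl⟩
  have hj : (j : ℕ) ≤ D.sup id := Finset.le_sup (f := id) j.2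
  have hs : A.row '' {a | (a : ℕ) < (j : ℕ)} = Set.range (A.row ∘ Fin.castLE hj) := by
    ext v
    constructor
    · rintro ⟨a, ha, rfl⟩
      exact ⟨⟨a, ha⟩, rfl⟩
    · rintro ⟨a, rfl⟩
      exact ⟨Fin.castLE hj a, a.2, rfl⟩
  rw [hs, finrank_span_eq_card (hA.comp _ (Fin.castLE_injective hj)), Fintype.card_fin]

theorem exists_plucker_coordFlag_ne_zero {D : Finset ℕ} (hD : D ⊆ Finset.Ioo 0 n)
    (hne : D.Nonempty) (v : Equiv.Perm (Fin n)) {A : Matrix (Fin (D.sup id)) (Fin n) ℂ}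
    (hA : Represents A (coordFlag hD v)) :
    ∃ J : Finset (Fin n), J.card = D.sup id ∧ plucker A J ≠ 0 := by
  have hr : D.sup id ∈ D := by
    obtain ⟨j, hj, h⟩ := Finset.exists_mem_eq_sup D hne id
    exact h ▸ hj
  have hcard := card_below v⁻¹ (Finset.mem_Ioo.1 (hD hr)).2.le
  refine ⟨below v⁻¹ (D.sup id), hcard, fun h => ?_⟩
  obtain ⟨z, hz, hz0, hz1⟩ := (hA.plucker_eq_zero_iff ⟨_, hr⟩ hcard).1 h
  rw [coordFlag_space] at hz
  refine hz0 (funext fun c => ?_)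
  by_cases hc : c ∈ below v⁻¹ (D.sup id)
  · exact hz1 c hc
  · exact hz c hc

/-- An irreducible equation which cuts out a nonempty set of flags generates its ideal. -/
theorem isDefinedBy_of_irreducible {D : Finset ℕ} (hD : D ⊆ Finset.Ioo 0 n) (hne : D.Nonempty)
    {Z : Set (PartialFlag n D)} {f : MvPolynomial (Finset (Fin n)) ℂ}
    (hf : Irreducible (toEntries D f))
    (hZ : ∀ F A, Represents A F → (F ∈ Z ↔ MvPolynomial.aeval (plucker A) f = 0))
    (v : Equiv.Perm (Fin n)) (hv : coordFlag hD v ∈ Z) : IsDefinedBy Z f := by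
  have hn : 0 < n := by
    obtain ⟨j, hj⟩ := hne
    have := Finset.mem_Ioo.1 (hD hj)
    omega
  refine ⟨fun F => ⟨fun hF A hA => (hZ F A hA).1 hF, fun h => ?_⟩, le_antisymm ?_ ?_⟩
  · obtain ⟨A, hA⟩ := exists_represents hD hn F
    exact (hZ F A hA).2 (h A hA)
  · intro g hg
    obtain ⟨A, hA⟩ := exists_represents hD hn (coordFlag hD v)
    obtain ⟨J, hJ, hJA⟩ := exists_plucker_coordFlag_ne_zero hD hne v hA
    have hprime : Prime (toEntries D f) := UniqueFactorizationMonoid.irreducible_iff_prime.1 hf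
    have hI : (Ideal.span {toEntries D f}).IsPrime :=
      (Ideal.span_singleton_prime hprime.ne_zero).2 hprime
    -- At a zero of f either this maximal minor vanishes or the matrix has full rank and represents
    -- a flag of Z, where g vanishes. The Nullstellensatz applies because (f) is prime.
    have hmem : g * plucker (genericMatrix ℂ (D.sup id) n) J ∈ Ideal.span {toEntries D f} := by
      rw [← MvPolynomial.IsPrime.vanishingIdeal_zeroLocus (K := ℂ) (Ideal.span {toEntries D f}),
        MvPolynomial.mem_vanishingIdeal_iff]
      intro x hx
      have hx0 := hx _ (Ideal.mem_span_singleton_self _)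
      rw [aeval_toEntries] at hx0
      rw [map_mul, algHom_plucker_generic]
      simp only [MvPolynomial.aeval_X]
      by_cases hxJ : plucker (Matrix.of fun p c => x (p, c)) J = 0
      · rw [hxJ, mul_zero]
      · obtain ⟨F, hF⟩ := exists_flag_of_linearIndependent
          (linearIndependent_row_of_plucker_ne_zero hJ hxJ)
        rw [hg x ⟨F, (hZ F _ hF).2 hx0, hF⟩, zero_mul]
    rw [Ideal.mem_span_singleton] at hmem ⊢
    -- f cannot divide the minor: at a matrix of the coordinate flag in Z, f vanishes but the minor
    -- does not.
    refine (hprime.dvd_or_dvd hmem).resolve_right fun hdvd => hJA ?_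
    have h1 := map_dvd (MvPolynomial.aeval fun x : Fin (D.sup id) × Fin n => A x.1 x.2) hdvd
    rw [aeval_toEntries, algHom_plucker_generic] at h1
    simp only [MvPolynomial.aeval_X] at h1
    exact zero_dvd_iff.1 ((hZ _ A hA).1 hv ▸ h1)
  · rw [Ideal.span_singleton_le_iff_mem]
    rintro x ⟨F, hF, hx⟩
    rw [aeval_toEntries]
    exact (hZ F _ hx).1 hF

theorem isDefinedBy_plucker {D : Finset ℕ} (hD : D ⊆ Finset.Ioo 0 n) (j : D)
    {Z : Set (PartialFlag n D)} {J : Finset (Fin n)} (hJ : J.card = j)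
    (hZ : ∀ F, F ∈ Z ↔ ∃ z ∈ F.space j, z ≠ 0 ∧ ∀ c ∈ J, z c = 0)
    (v : Equiv.Perm (Fin n)) (hv : coordFlag hD v ∈ Z) :
    IsDefinedBy Z (MvPolynomial.X J) := by
  refine isDefinedBy_of_irreducible hD ⟨j, j.2⟩ ?_ (fun F A hA => ?_) v hv
  · rw [toEntries, MvPolynomial.aeval_X]
    refine irreducible_plucker (Finset.card_pos.1 ?_) ?_
    · rw [hJ]
      exact (Finset.mem_Ioo.1 (hD j.2)).1
    · rw [hJ]
      exact Finset.le_sup (f := id) j.2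
  · rw [MvPolynomial.aeval_X, hA.plucker_eq_zero_iff j hJ, hZ]

theorem single_mem_coordFlag_space {D : Finset ℕ} (hD : D ⊆ Finset.Ioo 0 n)
    (v : Equiv.Perm (Fin n)) (j : D) (p : Fin n) (hp : (p : ℕ) < j) :
    (Pi.single (v p) 1 : Fin n → ℂ) ∈ (coordFlag hD v).space j :=
  Submodule.subset_span ⟨p, hp, rfl⟩

theorem single_one_ne_zero (c : Fin n) : (Pi.single c 1 : Fin n → ℂ) ≠ 0 := fun h =>
  one_ne_zero (α := ℂ) (by simpa using congrFun h c)

theorem isDefinedBy_schubert_divisor {D : Finset ℕ} (hD : D ⊆ Finset.Ioo 0 n) {i : ℕ}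
    (hi : i ∈ D) :
    IsDefinedBy (projRichardson hD 1 (longestW n * simpleTransposition n i * longestWP n D))
      (MvPolynomial.X (interval n (n - i) n)) := by
  have hin := Finset.mem_Ioo.1 (hD hi)
  refine isDefinedBy_plucker hD ⟨i, hi⟩ (by rw [card_interval le_rfl]; simp only; omega)
    (fun F => ?_) 1 ?_
  · rw [mem_projRichardson_schubert_divisor_iff hD hi]
    simp only [mem_coordSub, mem_below, mem_interval, Equiv.Perm.coe_one, id_eq, not_lt,
      Fin.is_lt, and_true]
  · rw [mem_projRichardson_schubert_divisor_iff hD hi]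
    refine ⟨_, single_mem_coordFlag_space hD 1 ⟨i, hi⟩ ⟨0, by omega⟩ hin.1, single_one_ne_zero _,
      single_mem_coordSub ?_ _⟩
    rw [mem_below]
    simp only [Equiv.Perm.coe_one, id_eq]
    omega

theorem isDefinedBy_opposite_divisor {D : Finset ℕ} (hD : D ⊆ Finset.Ioo 0 n) {i : ℕ}
    (hi : i ∈ D) :
    IsDefinedBy (projRichardson hD (simpleTransposition n i) (longestW n * longestWP n D))
      (MvPolynomial.X (interval n 0 i)) := by
  have hin := Finset.mem_Ioo.1 (hD hi)
  refine isDefinedBy_plucker hD ⟨i, hi⟩ (by rw [card_interval hin.2.le, Nat.sub_zero])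
    (fun F => ?_) Fin.revPerm ?_
  · rw [mem_projRichardson_opposite_divisor_iff hD hi]
    refine exists_congr fun z => and_congr_right fun _ => and_congr_right fun _ => ?_
    rw [mem_coordSub]
    refine forall_congr' fun c => ?_
    rw [mem_below, mem_interval, Fin.revPerm_apply, Fin.val_rev]
    exact imp_congr_left (by omega)
  · rw [mem_projRichardson_opposite_divisor_iff hD hi]
    refine ⟨_, single_mem_coordFlag_space hD _ ⟨i, hi⟩ ⟨0, by omega⟩ hin.1, single_one_ne_zero _,
      single_mem_coordSub ?_ _⟩
    rw [mem_below]
    simp only [Fin.revPerm_apply, Fin.val_rev]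
    omega

/-- The case in which `i` is smaller than all dimensions in `D`. -/
theorem isDefinedBy_of_lt {D : Finset ℕ} (hD : D ⊆ Finset.Ioo 0 n) {i b : ℕ} (hi : 0 < i)
    (hb : b ∈ D) (hbD : ∀ c ∈ D, b ≤ c) (hib : i < b) :
    IsDefinedBy (projRichardson hD (simpleTransposition n i) (longestW n * longestWP n D))
      (MvPolynomial.X (interval n 0 i ∪ interval n (n - b + i) n)) := by
  have hbn := Finset.mem_Ioo.1 (hD hb)
  have hmem : ∀ F : PartialFlag n D,
      F ∈ projRichardson hD (simpleTransposition n i) (longestW n * longestWP n D) ↔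
        ∃ z ∈ F.space ⟨b, hb⟩, z ≠ 0 ∧ ∀ c ∈ interval n 0 i ∪ interval n (n - b + i) n, z c = 0 := by
    intro F
    -- With F_0 = 0 the vector x disappears, and y alone must vanish on both intervals.
    rw [mem_projRichardson_iff hD (a := 0) (b := b) (Fa := ⊥) (Fb := F.space ⟨b, hb⟩)
      (Or.inr (Or.inl rfl)) (Or.inl hb) (fun c hc => Or.inr (hbD c hc)) hi hib bot_le
      (by simp) (F.finrank_space _)
      (fun j hj => absurd (Finset.mem_Ioo.1 (hD j.2)).1 (by omega))
      (fun j hj => F.mono _ _ hj)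
      (fun G j hG hj => ⟨bot_le, by
        subst hG
        exact G.mono _ _ (by simp only; omega)⟩)]
    constructor
    · rintro ⟨x, hx, y, hy, h1, h2, h3⟩
      rw [Submodule.mem_bot] at hx
      subst hx
      rw [zero_add] at h2
      refine ⟨y, hy, by simpa using h3, fun c hc => ?_⟩
      rcases Finset.mem_union.1 hc with h | h
      · refine h2 c ?_
        rw [mem_below, Fin.revPerm_apply, Fin.val_rev]
        have := (mem_interval.1 h).2
        omega
      · refine h1 c ?_
        rw [mem_below]
        have := (mem_interval.1 h).1
        simp only [Equiv.Perm.coe_one, id_eq]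
        omega
    · rintro ⟨z, hz, hz0, h⟩
      refine ⟨0, Submodule.zero_mem _, z, hz, fun c hc => h c ?_, ?_, Or.inr hz0⟩
      · rw [mem_below] at hc
        simp only [Equiv.Perm.coe_one, id_eq] at hc
        exact Finset.mem_union_right _ (mem_interval.2 ⟨by omega, c.2⟩)
      · rw [zero_add]
        intro c hc
        rw [mem_below, Fin.revPerm_apply, Fin.val_rev] at hc
        exact h c (Finset.mem_union_left _ (mem_interval.2 ⟨Nat.zero_le _, by omega⟩))
  refine isDefinedBy_plucker hD ⟨b, hb⟩ ?_ hmem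
    -- This coordinate flag contains e_i (counted from 0), which avoids both intervals because b <
    -- n.
    (Equiv.swap ⟨0, by omega⟩ ⟨i, by omega⟩) ((hmem _).2 ?_)
  · rw [Finset.card_union_of_disjoint, card_interval (by omega), card_interval le_rfl]
    · simp only
      omega
    · rw [Finset.disjoint_left]
      intro c hc hc'
      have := (mem_interval.1 hc).2
      have := (mem_interval.1 hc').1
      omega
  · refine ⟨_, single_mem_coordFlag_space hD _ ⟨b, hb⟩ ⟨0, by omega⟩ hbn.1, single_one_ne_zero _,
      fun c hc => ?_⟩
    rw [Equiv.swap_apply_left]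
    refine Pi.single_eq_of_ne ?_ _
    rintro rfl
    rcases Finset.mem_union.1 hc with h | h
    · have := (mem_interval.1 h).2
      simp at this
    · have := (mem_interval.1 h).1
      simp only at this
      omega

/-- The case in which `i` is larger than all dimensions in `D`. -/
theorem isDefinedBy_of_gt {D : Finset ℕ} (hD : D ⊆ Finset.Ioo 0 n) {i a : ℕ} (hi : i < n)
    (ha : a ∈ D) (haD : ∀ c ∈ D, c ≤ a) (hai : a < i) :
    IsDefinedBy (projRichardson hD (simpleTransposition n i) (longestW n * longestWP n D))
      (MvPolynomial.X (interval n (i - a) i)) := by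
  have han := Finset.mem_Ioo.1 (hD ha)
  have hmem : ∀ F : PartialFlag n D,
      F ∈ projRichardson hD (simpleTransposition n i) (longestW n * longestWP n D) ↔
        ∃ z ∈ F.space ⟨a, ha⟩, z ≠ 0 ∧ ∀ c ∈ interval n (i - a) i, z c = 0 := by
    intro F
    -- With F_n = ℂⁿ the vector y is unrestricted except for its support, and only x must satisfy a
    -- condition.
    rw [mem_projRichardson_iff hD (a := a) (b := n) (Fa := F.space ⟨a, ha⟩) (Fb := ⊤)
      (Or.inl ha) (Or.inr (Or.inr rfl)) (fun c hc => Or.inl (haD c hc)) hai hi le_top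
      (F.finrank_space _) (by simp)
      (fun j hj => F.mono _ _ hj)
      (fun j hj => absurd (Finset.mem_Ioo.1 (hD j.2)).2 (by omega))
      (fun G j hG hj => ⟨by
        subst hG
        exact G.mono _ _ (by simp only; omega), le_top⟩)]
    constructor
    · rintro ⟨x, hx, y, -, h1, h2, h3⟩
      have hxy : ∀ c : Fin n, (c : ℕ) < i → x c + y c = 0 := by
        intro c hc
        refine h2 c ?_
        rw [mem_below, Fin.revPerm_apply, Fin.val_rev]
        omega
      have hy : ∀ c : Fin n, i - a ≤ (c : ℕ) → y c = 0 := by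
        intro c hc
        refine h1 c ?_
        rw [mem_below]
        simp only [Equiv.Perm.coe_one, id_eq]
        omega
      refine ⟨x, hx, ?_, fun c hc => ?_⟩
      · rintro rfl
        refine h3.elim (fun h => h rfl) fun h => h (funext fun c => ?_)
        rcases lt_or_ge (c : ℕ) (i - a) with hc | hc
        · simpa using hxy c (by omega)
        · exact hy c hc
      · have hc := mem_interval.1 hc
        have := hxy c hc.2
        rwa [hy c hc.1, add_zero] at this
    · rintro ⟨z, hz, hz0, h⟩
      -- y cancels x on the first i - a coordinates; on the rest of [i] the vector x already
      -- vanishes.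
      refine ⟨z, hz, fun c => if (c : ℕ) < i - a then - z c else 0, Submodule.mem_top,
        fun c hc => ?_, fun c hc => ?_, Or.inl hz0⟩
      · rw [mem_below] at hc
        simp only [Equiv.Perm.coe_one, id_eq] at hc
        exact if_neg (by omega)
      · rw [mem_below, Fin.revPerm_apply, Fin.val_rev] at hc
        rw [Pi.add_apply]
        split_ifs with h1
        · simp
        · rw [h c (mem_interval.2 ⟨by omega, by omega⟩), add_zero]
  refine isDefinedBy_plucker hD ⟨a, ha⟩ ?_ hmem Fin.revPerm ((hmem _).2 ?_)
  · rw [card_interval hi.le]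
    simp only
    omega
  · refine ⟨_, single_mem_coordFlag_space hD _ ⟨a, ha⟩ ⟨0, by omega⟩ han.1, single_one_ne_zero _,
      fun c hc => Pi.single_eq_of_ne ?_ _⟩
    rintro rfl
    have := (mem_interval.1 hc).2
    rw [Fin.revPerm_apply, Fin.val_rev] at this
    simp only at this
    omega

/-- The case in which `i` lies strictly between two consecutive dimensions in `D`. -/
theorem isDefinedBy_of_between {D : Finset ℕ} (hD : D ⊆ Finset.Ioo 0 n) {i a b : ℕ} (ha : a ∈ D)
    (hb : b ∈ D) (hab : ∀ c ∈ D, c ≤ a ∨ b ≤ c) (hai : a < i) (hib : i < b) :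
    IsDefinedBy (projRichardson hD (simpleTransposition n i) (longestW n * longestWP n D))
      (∑ J ∈ (interval n 0 (min i (n - b + (i - a)))).powersetCard (i - a),
        (-1) ^ indexSum J * MvPolynomial.X (interval n 0 i \ J) *
          MvPolynomial.X (J ∪ interval n (n - b + (i - a)) n)) := by
  have han := Finset.mem_Ioo.1 (hD ha)
  have hbn := Finset.mem_Ioo.1 (hD hb)
  have hbr : b ≤ D.sup id := Finset.le_sup (f := id) hb
  have hmem : ∀ F : PartialFlag n D,
      F ∈ projRichardson hD (simpleTransposition n i) (longestW n * longestWP n D) ↔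
        ∃ x ∈ F.space ⟨a, ha⟩, ∃ y ∈ F.space ⟨b, hb⟩, y ∈ coordSub (below 1 (n - b + (i - a))) ∧
        x + y ∈ coordSub (below Fin.revPerm (n - i)) ∧ (x ≠ 0 ∨ y ≠ 0) := fun F =>
    mem_projRichardson_iff hD (Or.inl ha) (Or.inl hb) hab hai hib
      (F.mono _ _ (hai.trans hib).le) (F.finrank_space _) (F.finrank_space _)
      (fun j hj => F.mono _ _ hj) (fun j hj => F.mono _ _ hj)
      (fun G j hG hj => by
        subst hG
        exact ⟨G.mono _ _ (by simp only; omega), G.mono _ _ (by simp only; omega)⟩)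
  refine isDefinedBy_of_irreducible hD ⟨a, ha⟩ ?_ (fun F A hA => ?_) Fin.revPerm ((hmem _).2 ?_)
  · have := irreducible_incidencePoly (K := ℂ) han.1 hai hib hbn.2 hbr
    convert this using 1
    simp [toEntries, incidencePoly]
  · rw [hmem, hA.2 ⟨a, ha⟩, hA.2 ⟨b, hb⟩,
      ← det_incidenceMatrix_eq_zero_iff hai hib hbn.2.le hbr hA.1]
    obtain ⟨e, he⟩ := det_incidenceMatrix hai hib hbn.2.le hbr A
    rw [he, mul_eq_zero, or_iff_right (pow_ne_zero e (neg_ne_zero.2 one_ne_zero))]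
    simp
  · refine ⟨_, single_mem_coordFlag_space hD _ ⟨a, ha⟩ ⟨0, by omega⟩ han.1, 0,
      Submodule.zero_mem _, Submodule.zero_mem _, ?_, Or.inl (single_one_ne_zero _)⟩
    rw [add_zero]
    refine single_mem_coordSub ?_ _
    rw [mem_below]
    simp only [Fin.revPerm_apply, Fin.val_rev]
    omega

end FlagVariety

theorem theorem4p1 (n : ℕ) (D : Finset ℕ) (hD : D ⊆ Finset.Ioo 0 n) (hne : D.Nonempty)
    (i : ℕ) (hi : 0 < i) (hin : i < n) :
    (i ∈ D →
      projRichardson hD 1 (longestW n * simpleTransposition n i * longestWP n D) =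
        schubertVariety hD (longestW n * simpleTransposition n i * longestWP n D) ∧
      IsDefinedBy (projRichardson hD 1 (longestW n * simpleTransposition n i * longestWP n D))
        (MvPolynomial.X (interval n (n - i) n))) ∧
    (i ∈ D →
      projRichardson hD (simpleTransposition n i) (longestW n * longestWP n D) =
        oppositeSchubertVariety hD (simpleTransposition n i) ∧
      IsDefinedBy (projRichardson hD (simpleTransposition n i) (longestW n * longestWP n D))
        (MvPolynomial.X (interval n 0 i))) ∧
    (i < D.min' hne →
      IsDefinedBy (projRichardson hD (simpleTransposition n i) (longestW n * longestWP n D))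
        (MvPolynomial.X (interval n 0 i ∪ interval n (n - D.min' hne + i) n))) ∧
    (D.max' hne < i →
      IsDefinedBy (projRichardson hD (simpleTransposition n i) (longestW n * longestWP n D))
        (MvPolynomial.X (interval n (i - D.max' hne) i))) ∧
    (∀ a ∈ D, ∀ b ∈ D, (∀ c ∈ D, c ≤ a ∨ b ≤ c) → a < i → i < b →
      ∀ k l : ℕ, k = i - a → l = min i (n - b + k) →
      IsDefinedBy (projRichardson hD (simpleTransposition n i) (longestW n * longestWP n D))
        (∑ J ∈ (interval n 0 l).powersetCard k,
          (-1) ^ indexSum J * MvPolynomial.X (interval n 0 i \ J) *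
            MvPolynomial.X (J ∪ interval n (n - b + k) n))) := by
  refine ⟨fun h => ⟨?_, isDefinedBy_schubert_divisor hD h⟩,
    fun h => ⟨?_, isDefinedBy_opposite_divisor hD h⟩, fun h => ?_, fun h => ?_, ?_⟩
  · ext F
    rw [mem_projRichardson_schubert_divisor_iff hD h, mem_schubertVariety_divisor_iff hD h]
  · ext F
    rw [mem_projRichardson_opposite_divisor_iff hD h,
      mem_oppositeSchubertVariety_simpleTransposition_iff hD h]
  · exact isDefinedBy_of_lt hD hi (D.min'_mem hne) (fun c hc => D.min'_le c hc) h
  · exact isDefinedBy_of_gt hD hin (D.max'_mem hne) (fun c hc => D.le_max' c hc) h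
  · rintro a ha b hb hab hai hib k l rfl rfl
    exact isDefinedBy_of_between hD ha hb hab hai hib
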